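/- Let $V=\mathbb{R}^{2n+2}$ with its Euclidean inner product, and let $(P_0,\dots,P_m)$ be a symmetric Clifford system on $V$: symmetric endomorphisms with $P_iP_j+P_jP_i=2\delta_{ij}\,\mathrm{Id}$. Put $\mathcal{P}=\mathrm{span}\{P_0,\dots,P_m\}$, $m_1=m$, $m_2=n-m$, and assume that $m_2>0$ and $m_1\le m_2$. The FKM-foliation $\mathcal{F}_{\mathcal{P}}$ of the unit sphere $S(V)$ has as leaves the level sets of the restriction to $S(V)$ of $$F(x)=\langle x,x\rangle^2-2\sum_{i=0}^m\langle P_ix,x\rangle^2 ,$$ and $\mathrm{Aut}(\mathcal{F}_{\mathcal{P}})\subseteq O(V)$ is the group of orthogonal transformations that map leaves to leaves. Let $\mathrm{Cl}^*_{m+1}$ be the Clifford algebra of $\mathbb{R}^{m+1}$ with relations $E_iE_j+E_jE_i=2\delta_{ij}$, let $\mathrm{Pin}(m+1)$ be the group generated by the unit vectors in $\mathrm{Cl}^*_{m+1}$, and let $\mathrm{Spin}(m+1)$ be its subgroup of even elements. Let $\chi_{\mathcal{P}}:\mathrm{Cl}^*_{m+1}\to\mathrm{End}(V)$, $E_i\mapsto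 P_i$. Write $\mathrm{Spin}(\mathcal{P})=\chi_{\mathcal{P}}(\mathrm{Spin}(m+1))$ and $U^+(\mathcal{P})=\{U\in O(V): PU=UP\text{ for all }P\in\mathcal{P}\}$. Let $\mathbb{K}=\mathbb{R}$ if $m\equiv 0,1,7$, $\mathbb{K}=\mathbb{C}$ if $m\equiv 2,6$, and $\mathbb{K}=\mathbb{H}$ if $m\equiv 3,4,5 \pmod 8$. There are irreducible real representations $\chi$ of $\mathrm{Cl}^*_{m+1}$ on some $\mathfrak{d}=\mathbb{K}^r$ by $\mathbb{K}$-matrices (acting on columns from the left, so commuting with right multiplication by $\mathbb{K}$); let $\chi$ be any of them. If $m\equiv 0\pmod 4$, put $\mathfrak{d}_+=\mathfrak{d}$, and let $\mathfrak{d}_-$ be the same space with the representation $\chi\circ\alpha$, where $\alpha$ is the automorphism of $\mathrm{Cl}^*_{m+1}$ extending $-\mathrm{Id}$ on $\mathbb{R}^{m+1}$. If $m\not\equiv 0\pmod 4$, then $V\cong\bigoplus_{i=1}^k\mathfrak{d}$ as a $\mathrm{Cl}^*_{m+1}$-module for some $k$; if $m\equiv 0\pmod 4$, then $V\cong\bigl(\bigoplus_{i=1}^{k_+}\mathfrak{d}_+\bigr)\oplus\bigl(\bigoplus_{i=1}^{k_-}\mathfrak{d}_-\bigr)$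 for some $k_+,k_-\ge 0$. For these numbers the following holds. 1. If $m$ is odd, the representation of $\mathrm{Aut}(\mathcal{F}_{\mathcal{P}})$ on $V$ is equivalent to the action of $\mathrm{Pin}(m+1)\cdot O(k)$ on $\mathfrak{d}\otimes_{\mathbb{R}}\mathbb{R}^k$ if $m\equiv 1,7\pmod 8$, or of $\mathrm{Pin}(m+1)\cdot \mathrm{Sp}(k)$ on $\mathfrak{d}\otimes_{\mathbb{H}}\mathbb{H}^k$ if $m\equiv 3,5\pmod 8$. 2. If $m\equiv 2\pmod 4$, then $\mathrm{Spin}(\mathcal{P})\cdot U^+(\mathcal{P})$ is a subgroup of $\mathrm{Aut}(\mathcal{F}_{\mathcal{P}})$, and its representation on $V$ is equivalent to the action of $\mathrm{Spin}(m+1)\cdot U(k)$ on $\mathfrak{d}\otimes_{\mathbb{C}}\mathbb{C}^k$. 3. If $m\equiv 0\pmod 4$, then $\mathrm{Spin}(\mathcal{P})\cdot U^+(\mathcal{P})$ is a subgroup of $\mathrm{Aut}(\mathcal{F}_{\mathcal{P}})$, and its representation on $V$ is equivalent to the action of $\mathrm{Spin}(m+1)\cdot(O(k_+)\times O(k_-))$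 if $m\equiv 0\pmod 8$, or of $\mathrm{Spin}(m+1)\cdot(\mathrm{Sp}(k_+)\times \mathrm{Sp}(k_-))$ if $m\equiv 4\pmod 8$, on $(\mathfrak{d}_+\otimes_{\mathbb{K}}\mathbb{K}^{k_+})\oplus(\mathfrak{d}_-\otimes_{\mathbb{K}}\mathbb{K}^{k_-})$. Here $\mathrm{Pin}(m+1)$ and $\mathrm{Spin}(m+1)$ act on the left factors through $\chi$ (respectively $\chi$ and $\chi\circ\alpha$), and the classical groups act on the right factors by their standard representations. For $\mathbb{K}=\mathbb{H}$ the tensor product of right $\mathbb{H}$-spaces is formed with $vq\otimes w=v\otimes w\bar q$. The dot denotes a direct product modulo a finite subgroup, and "equivalent" means that there are a group isomorphism and a real linear isomorphism from $V$ onto the tensor product space that intertwine the two actions. The group isomorphism can be chosen so that $\chi_{\mathcal{P}}(f)$ corresponds to $f$ for every $f$ in $\mathrm{Pin}(m+1)$ (respectively $\mathrm{Spin}(m+1)$), and so that $U^+(\mathcal{P})$ corresponds to the image of the classical group. -/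

import Mathlib

open scoped TensorProduct Quaternion

noncomputable section

namespace FKM

/-! ### Clifford algebra, pin and spin groups of Euclidean space -/

/-- The standard positive definite quadratic form `∑ i, v i ^ 2` on `ℝ^(m+1)`. -/
abbrev stdForm (m : ℕ) : QuadraticForm ℝ (Fin (m + 1) → ℝ) :=
  QuadraticMap.weightedSumSquares ℝ (fun _ : Fin (m + 1) => (1 : ℝ))

/-- The Clifford algebra `Cl*_{m+1}` of the positive definite form: `v * v = |v|^2`. -/
abbrev Cl (m : ℕ) : Type := CliffordAlgebra (stdForm m)

/-- `Pin(m+1)`: the group generated by the unit vectors inside the units of `Cl*_{m+1}`.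
(Mathlib's `pinGroup` imposes `star x * x = 1` with `star v = -v` on vectors, which for a positive
definite form excludes the unit vectors.) -/
def Pin (m : ℕ) : Subgroup (Cl m)ˣ :=
  Subgroup.closure {u | ∃ v : Fin (m + 1) → ℝ,
    stdForm m v = 1 ∧ (u : Cl m) = CliffordAlgebra.ι (stdForm m) v}

/-- `Spin(m+1)`: the elements of `Pin(m+1)` that lie in the even part of the Clifford algebra. -/
def Spin (m : ℕ) : Subgroup (Cl m)ˣ :=
  Pin m ⊓ (CliffordAlgebra.even (stdForm m)).toSubmonoid.units

/-! ### Clifford systems and FKM-foliations -/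

/-- The Euclidean space `V = ℝ^(2n+2)`. -/
abbrev V (n : ℕ) : Type := EuclideanSpace ℝ (Fin (2 * n + 2))

/-- The orthogonal group `O(V)`. -/
abbrev OV (n : ℕ) : Type := V n ≃ₗᵢ[ℝ] V n

/-- A symmetric Clifford system `(P_0, …, P_m)` on `V = ℝ^(2n+2)`. -/
structure CliffordSystem (m n : ℕ) where
  /-- The operators `P_0, …, P_m`. -/
  P : Fin (m + 1) → Module.End ℝ (V n)
  symm : ∀ i, (P i).IsSymmetric
  rel : ∀ i j, P i * P j + P j * P i = if i = j then 2 else 0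

namespace CliffordSystem

variable {m n : ℕ} (C : CliffordSystem m n)

/-- The linear map `v ↦ ∑ i, v i • P i`. -/
def gen : (Fin (m + 1) → ℝ) →ₗ[ℝ] Module.End ℝ (V n) := Fintype.linearCombination ℝ C.P

theorem gen_mul_self (v : Fin (m + 1) → ℝ) :
    C.gen v * C.gen v = algebraMap ℝ (Module.End ℝ (V n)) (stdForm m v) := by
  have key : (2 : ℝ) • (C.gen v * C.gen v) =
      (2 : ℝ) • algebraMap ℝ (Module.End ℝ (V n)) (stdForm m v) := by
    have h1 : C.gen v * C.gen v = ∑ i, ∑ j, (v i * v j) • (C.P i * C.P j) := by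
      simp only [gen, Fintype.linearCombination_apply, Finset.sum_mul, Finset.mul_sum,
        smul_mul_smul_comm]
      rw [Finset.sum_comm]
    have h2 : C.gen v * C.gen v = ∑ i, ∑ j, (v i * v j) • (C.P j * C.P i) := by
      rw [h1, Finset.sum_comm]
      simp only [mul_comm]
    rw [two_smul]
    conv_lhs => rw [h1]
    conv_lhs => arg 2; rw [← h1, h2]
    simp only [← Finset.sum_add_distrib, ← smul_add, C.rel]
    simp [QuadraticMap.weightedSumSquares_apply, Algebra.algebraMap_eq_smul_one,
      Finset.smul_sum, smul_smul]
    refine Finset.sum_congr rfl fun i _ => ?_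
    rw [mul_comm (2 : ℝ), mul_smul (v i * v i) (2 : ℝ), two_smul, one_add_one_eq_two]
  exact smul_right_injective _ (two_ne_zero) key

/-- The representation `χ : Cl*_{m+1} → End V` with `χ(E_i) = P_i`. -/
def rep : Cl m →ₐ[ℝ] Module.End ℝ (V n) :=
  CliffordAlgebra.lift (stdForm m) ⟨C.gen, C.gen_mul_self⟩

/-- The vector space `𝒫 = span {P_0, …, P_m}`. -/
def space : Submodule ℝ (Module.End ℝ (V n)) := Submodule.span ℝ (Set.range C.P)

/-- The Cartan–Münzner polynomial `F(x) = ⟨x,x⟩² - 2 ∑ i, ⟨P_i x, x⟩²`. -/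
def cartanMunzner (x : V n) : ℝ :=
  (inner ℝ x x) ^ 2 - 2 * ∑ i, (inner ℝ (C.P i x) x) ^ 2

/-- The leaves of the FKM-foliation: the (nonempty) level sets of `F` on the unit sphere. -/
def leaves : Set (Set (V n)) :=
  {L | L.Nonempty ∧ ∃ c : ℝ, L = {x | x ∈ Metric.sphere (0 : V n) 1 ∧ C.cartanMunzner x = c}}

/-- The group `Aut(F_𝒫)` of the orthogonal transformations that map leaves to leaves. -/
def aut : Subgroup (OV n) where
  carrier := {A | ∀ L ∈ C.leaves, A '' L ∈ C.leaves ∧ (A⁻¹ : OV n) '' L ∈ C.leaves}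
  one_mem' := by
    intro L hL
    simpa using hL
  mul_mem' := by
    intro A B hA hB L hL
    refine ⟨?_, ?_⟩
    · have := (hA _ (hB L hL).1).1
      rwa [← Set.image_comp, ← LinearIsometryEquiv.coe_mul] at this
    · have := (hB _ (hA L hL).2).2
      rwa [← Set.image_comp, ← LinearIsometryEquiv.coe_mul, ← mul_inv_rev] at this
  inv_mem' := by
    intro A hA L hL
    exact ⟨(hA L hL).2, by simpa using (hA L hL).1⟩

/-- The image in `O(V)` of a group of units of the Clifford algebra. -/
def image (L : Subgroup (Cl m)ˣ) : Subgroup (OV n) where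
  carrier := {A | ∃ f ∈ L, ∀ x, A x = C.rep (f : Cl m) x}
  one_mem' := ⟨1, L.one_mem, by simp⟩
  mul_mem' := by
    rintro A B ⟨f, hf, hA⟩ ⟨g, hg, hB⟩
    exact ⟨f * g, L.mul_mem hf hg, fun x => by simp [hA, hB]⟩
  inv_mem' := by
    rintro A ⟨f, hf, hA⟩
    refine ⟨f⁻¹, L.inv_mem hf, fun x => A.injective ?_⟩
    rw [hA (C.rep _ x), ← Module.End.mul_apply, ← map_mul, Units.mul_inv, map_one]
    exact A.apply_symm_apply x

/-- `Spin(𝒫) ⊆ O(V)`. -/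
def spin : Subgroup (OV n) := C.image (Spin m)

/-- `U⁺(𝒫)`: the orthogonal transformations that commute with every element of `𝒫`. -/
def uPlus : Subgroup (OV n) where
  carrier := {U | ∀ Q ∈ C.space, ∀ x, Q (U x) = U (Q x)}
  one_mem' := by simp
  mul_mem' := by
    intro A B hA hB Q hQ x
    simp [hA Q hQ, hB Q hQ]
  inv_mem' := by
    intro A hA Q hQ x
    apply A.injective
    change A (Q (A.symm x)) = A (A.symm (Q x))
    rw [← hA Q hQ, A.apply_symm_apply, A.apply_symm_apply]

/-- `Spin(𝒫) · U⁺(𝒫)`. -/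
def spinUPlus : Subgroup (OV n) := C.spin ⊔ C.uPlus

end CliffordSystem

/-! ### Irreducible Clifford modules on `𝕂^r` and multiplicities -/

section Modules

variable {𝕂 : Type} [Ring 𝕂] [Algebra ℝ 𝕂]

/-- The real linear action of a matrix over `𝕂` on columns, by left multiplication; it commutes
with the right multiplication by scalars of `𝕂`. -/
def colAct {r : ℕ} (M : Matrix (Fin r) (Fin r) 𝕂) : (Fin r → 𝕂) →ₗ[ℝ] (Fin r → 𝕂) where
  toFun v := M.mulVec v
  map_add' v w := M.mulVec_add v w
  map_smul' c v := M.mulVec_smul c v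

/-- The real representation of `Cl*_{m+1}` on the right `𝕂`-space `𝕂^r` given by a homomorphism
into `𝕂(r)` is irreducible. -/
def IsIrreducibleRep {m r : ℕ} (χ : Cl m →ₐ[ℝ] Matrix (Fin r) (Fin r) 𝕂) : Prop :=
  Nontrivial (Fin r → 𝕂) ∧ ∀ W : Submodule ℝ (Fin r → 𝕂),
    (∀ a : Cl m, ∀ w ∈ W, colAct (χ a) w ∈ W) → W = ⊥ ∨ W = ⊤

/-- `χ₋ = χ₊ ∘ α`, where `α` is the automorphism of the Clifford algebra with `α(v) = -v`. -/
def twist {m r : ℕ} (χ : Cl m →ₐ[ℝ] Matrix (Fin r) (Fin r) 𝕂) :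
    Cl m →ₐ[ℝ] Matrix (Fin r) (Fin r) 𝕂 :=
  χ.comp CliffordAlgebra.involute

/-- As a `Cl*_{m+1}`-module, `V` is isomorphic to the sum of `k` copies of `χ`. -/
def IsSumOf {m n r : ℕ} (C : CliffordSystem m n) (χ : Cl m →ₐ[ℝ] Matrix (Fin r) (Fin r) 𝕂)
    (k : ℕ) : Prop :=
  ∃ S : V n ≃ₗ[ℝ] (Fin k → Fin r → 𝕂),
    ∀ (a : Cl m) (x : V n) (i : Fin k), S (C.rep a x) i = colAct (χ a) (S x i)

/-- As a `Cl*_{m+1}`-module, `V` is isomorphic to the sum of `k₁` copies of `χ₁` and `k₂` copies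
of `χ₂`. -/
def IsSumOf₂ {m n r : ℕ} (C : CliffordSystem m n) (χ₁ χ₂ : Cl m →ₐ[ℝ] Matrix (Fin r) (Fin r) 𝕂)
    (k₁ k₂ : ℕ) : Prop :=
  ∃ S : V n ≃ₗ[ℝ] (Fin k₁ → Fin r → 𝕂) × (Fin k₂ → Fin r → 𝕂),
    ∀ (a : Cl m) (x : V n), (∀ i, (S (C.rep a x)).1 i = colAct (χ₁ a) ((S x).1 i)) ∧
      (∀ i, (S (C.rep a x)).2 i = colAct (χ₂ a) ((S x).2 i))

end Modules

/-! ### The tensor products `𝕂^r ⊗_𝕂 𝕂^k` -/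

/-- `M ⊗ U` on `𝕂^r ⊗_𝕂 𝕂^k`, for commutative `𝕂` (`ℝ` or `ℂ`), as a real linear map. -/
def tensorAct {𝕂 : Type} [CommRing 𝕂] [Algebra ℝ 𝕂] {r k : ℕ}
    (M : Matrix (Fin r) (Fin r) 𝕂) (U : Matrix (Fin k) (Fin k) 𝕂) :
    ((Fin r → 𝕂) ⊗[𝕂] (Fin k → 𝕂)) →ₗ[ℝ] ((Fin r → 𝕂) ⊗[𝕂] (Fin k → 𝕂)) :=
  (TensorProduct.map M.mulVecLin U.mulVecLin).restrictScalars ℝ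

/-- The relations `(v q) ⊗ w = v ⊗ (w q̄)` defining the tensor product over `ℍ` of two right
quaternionic vector spaces (the second one is made a left space by `q · w = w q̄`). -/
def quatRel (r k : ℕ) : Submodule ℝ ((Fin r → ℍ[ℝ]) ⊗[ℝ] (Fin k → ℍ[ℝ])) :=
  Submodule.span ℝ {t | ∃ (v : Fin r → ℍ[ℝ]) (w : Fin k → ℍ[ℝ]) (q : ℍ[ℝ]),
    t = (fun i => v i * q) ⊗ₜ[ℝ] w - v ⊗ₜ[ℝ] (fun j => w j * star q)}

/-- The real vector space `ℍ^r ⊗_ℍ ℍ^k`. -/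
abbrev QuatTensor (r k : ℕ) : Type :=
  ((Fin r → ℍ[ℝ]) ⊗[ℝ] (Fin k → ℍ[ℝ])) ⧸ quatRel r k

theorem colAct_mul_right {r : ℕ} (M : Matrix (Fin r) (Fin r) ℍ[ℝ]) (v : Fin r → ℍ[ℝ])
    (q : ℍ[ℝ]) : colAct M (fun i => v i * q) = fun i => colAct M v i * q := by
  funext i
  simp [colAct, Matrix.mulVec, dotProduct, Finset.sum_mul, mul_assoc]

theorem quatRel_le {r k : ℕ} (M : Matrix (Fin r) (Fin r) ℍ[ℝ]) (U : Matrix (Fin k) (Fin k) ℍ[ℝ]) :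
    quatRel r k ≤ (quatRel r k).comap (TensorProduct.map (colAct M) (colAct U)) := by
  refine Submodule.span_le.2 ?_
  rintro _ ⟨v, w, q, rfl⟩
  refine Submodule.subset_span ⟨colAct M v, colAct U w, q, ?_⟩
  rw [map_sub, TensorProduct.map_tmul, TensorProduct.map_tmul, colAct_mul_right, colAct_mul_right]

/-- `M ⊗ U` on `ℍ^r ⊗_ℍ ℍ^k`. -/
def quatTensorAct {r k : ℕ} (M : Matrix (Fin r) (Fin r) ℍ[ℝ]) (U : Matrix (Fin k) (Fin k) ℍ[ℝ]) :
    QuatTensor r k →ₗ[ℝ] QuatTensor r k :=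
  (quatRel r k).mapQ (quatRel r k) (TensorProduct.map (colAct M) (colAct U)) (quatRel_le M U)

/-- The compact symplectic group `Sp(k)`: quaternionic `k × k` matrices with `A* A = A A* = 1`. -/
abbrev Sp (k : ℕ) : Submonoid (Matrix (Fin k) (Fin k) ℍ[ℝ]) := unitary _

/-! ### Equivalence with a tensor product representation -/

/-- The representation on `V` of the group `H ⊆ O(V)` is equivalent to the action of `L · B` on
`X`, where `L` is `Pin(m+1)` or `Spin(m+1)`, `B` is a group, `L · B` is the direct product modulo
a finite subgroup, and `(f, b)` acts on `X` by `act f b`. The group isomorphism between `L · B`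
and `H` comes from the homomorphism `Φ : L × B → O(V)`; it is `χ` on `L` and takes `B` onto
`U⁺(𝒫)`. -/
def IsEquivalentToAction {m n : ℕ} (C : CliffordSystem m n) (H : Subgroup (OV n))
    (L : Subgroup (Cl m)ˣ) (B : Type) [Group B] (X : Type) [AddCommGroup X] [Module ℝ X]
    (act : Cl m → B → (X →ₗ[ℝ] X)) : Prop :=
  ∃ Φ : L × B →* OV n,
    Φ.range = H ∧
    (Φ.ker : Set (L × B)).Finite ∧
    (∀ (f : L) (x : V n), Φ (f, 1) x = C.rep ((f : (Cl m)ˣ) : Cl m) x) ∧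
    (Φ.comp (MonoidHom.inr L B)).range = C.uPlus ∧
    ∃ T : V n ≃ₗ[ℝ] X, ∀ (f : L) (b : B) (x : V n),
      T (Φ (f, b) x) = act ((f : (Cl m)ˣ) : Cl m) b (T x)

end FKM

end

open FKM

/-! The theorem has two independent halves: for every `m`, the group generated by `U⁺(𝒫)` and the
image of the pin or spin group is described by a tensor product; for odd `m`, `Aut(F_𝒫)` is the
group generated by `U⁺(𝒫)` and the image of `Pin(m+1)`.

Tensor product. Up to sign the monomials `e_I` form a finite group, with `e_I⁻¹ = eps |I| • e_I`,
and `sum_mon_conj` is averaging over it. On an irreducible module `E` with symmetric generators, `T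
↦ ∑ e_I T* e_I⁻¹` maps `End E` into the commutant `D` and is `2^(m+1)` times the adjoint on `D`. By
Schur `T + T*` is a scalar for `T` in `D`, so computing the trace in two ways gives `(2 - dim D)
2^(m+1) = dim E · ∑ eps |I|` (`finrank_commutant`). The last sum is the real plus the imaginary part
of `(1+i)^(m+1)`; its sign depends on `m` mod 8 and decides between `ℝ`, `ℂ` and `ℍ`. Averaging rank
one maps produces a nonzero intertwiner from an irreducible module into any nonzero invariant
subspace, provided for `4 ∣ m` that the volume element acts by the same sign (`exists_intertwiner`).
Hence `V` is an orthogonal sum of copies of `χ` (and of its twist, if `4 ∣ m`), and by Schur all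
copies carry the same inner product after rescaling. In such a frame an endomorphism commuting with
`𝒫` is a matrix of right multiplications by scalars, and it is orthogonal exactly when the matrix is
unitary (`isEquivalentToAction_of_frame`). The kernel is finite because a pin element that acts
inside the commutant is central, hence `±1` or `±vol`.

Automorphisms. Put `q(x) = (⟨P_i x, x⟩)_i`. On the unit sphere `F = 1 - 2|q|²` and `|q| ≤ 1`; the
set `|q| = 1` is the disjoint union of the unit spheres of the `1`-eigenspaces `E(v)` of the unit
elements of `𝒫`, each of dimension `n + 1`. An automorphism induces a monotone bijection of the leaf
space, so it preserves or exchanges the sets `|q| = 1` and `q = 0` (`aut_focal`). An exchange would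
make `𝒫` anticommute with its conjugate, which contradicts `2m ≤ n` (`not_exchange`). If `|q| = 1`
is preserved, a dimension count, again with `2m ≤ n`, shows that every `E(v)` is an eigenspace of
the conjugate system (`exists_gen_eq`), so the automorphism normalizes `𝒫`. For odd `m` every
isometry of `ℝ^(m+1)` is conjugation by a pin element (`exists_pin_conj`), and correcting by that
element leaves an element of `U⁺(𝒫)`. -/

noncomputable section

namespace FKM

/-! ### Monomials in the Clifford algebra -/

section Monomials

variable {m : ℕ}

/-- The standard generator `E_i` of the Clifford algebra. -/
def e (i : Fin (m + 1)) : Cl m := CliffordAlgebra.ι (stdForm m) (Pi.single i 1)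

theorem stdForm_apply (v : Fin (m + 1) → ℝ) : stdForm m v = ∑ i, v i ^ 2 := by
  simp [QuadraticMap.weightedSumSquares_apply, pow_two]

theorem stdForm_single (i : Fin (m + 1)) : stdForm m (Pi.single i 1) = 1 := by
  rw [stdForm_apply, Finset.sum_eq_single i] <;> simp +contextual

theorem e_sq (i : Fin (m + 1)) : e i * e i = 1 := by
  rw [e, CliffordAlgebra.ι_sq_scalar, stdForm_single, map_one]

theorem e_anticomm {i j : Fin (m + 1)} (h : i ≠ j) : e i * e j = -(e j * e i) := by
  rw [eq_neg_iff_add_eq_zero, e, e, CliffordAlgebra.ι_mul_ι_add_swap, QuadraticMap.polar,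
    stdForm_single, stdForm_single, stdForm_apply, ← map_zero (algebraMap ℝ (Cl m))]
  congr 1
  have : ∀ k, (Pi.single i (1 : ℝ) + Pi.single j 1 : Fin (m + 1) → ℝ) k ^ 2 =
      (Pi.single i (1 : ℝ) : Fin (m + 1) → ℝ) k + (Pi.single j (1 : ℝ) : Fin (m + 1) → ℝ) k := by
    intro k
    by_cases hi : k = i
    · subst hi; simp [h]
    · by_cases hj : k = j
      · subst hj; simp [hi]
      · simp [hi, hj]
  simp only [this, Finset.sum_add_distrib, Pi.single_apply]
  simp

theorem ι_eq_sum (v : Fin (m + 1) → ℝ) :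
    CliffordAlgebra.ι (stdForm m) v = ∑ i, v i • e i := by
  conv_lhs => rw [pi_eq_sum_univ' v]
  simp only [map_sum, map_smul, e]

/-- Distinct generators anticommute, so each transposition costs a sign. Signs are recorded as a
real `s` with `s * s = 1`, since their actual values play no role. -/
theorem prod_e_perm {l l' : List (Fin (m + 1))} (h : l.Perm l') (hn : l.Nodup) :
    ∃ s : ℝ, s * s = 1 ∧ (l'.map e).prod = s • (l.map e).prod := by
  induction h with
  | nil => exact ⟨1, by simp, by simp⟩
  | cons x _ ih =>
    obtain ⟨s, hs, h⟩ := ih (List.nodup_cons.1 hn).2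
    exact ⟨s, hs, by simp [h]⟩
  | swap x y l =>
    refine ⟨-1, by norm_num, ?_⟩
    have hxy : x ≠ y := by
      rintro rfl
      simp at hn
    simp only [List.map_cons, List.prod_cons, ← mul_assoc]
    rw [e_anticomm hxy]
    simp
  | trans h1 _ ih1 ih2 =>
    obtain ⟨s, hs, h⟩ := ih1 hn
    obtain ⟨t, ht, h'⟩ := ih2 (h1.nodup_iff.1 hn)
    exact ⟨t * s, by rw [mul_mul_mul_comm, hs, ht, one_mul], by rw [h', h, smul_smul]⟩

/-- The monomial `E_{i_1} ⋯ E_{i_k}` for `I = {i_1 < ⋯ < i_k}`. -/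
def mon (I : Finset (Fin (m + 1))) : Cl m := ((I.sort (· ≤ ·)).map e).prod

@[simp] theorem mon_empty : mon (∅ : Finset (Fin (m + 1))) = 1 := by simp [mon]

theorem mon_insert {i : Fin (m + 1)} {I : Finset (Fin (m + 1))} (h : i ∉ I) :
    ∃ s : ℝ, s * s = 1 ∧ mon (insert i I) = s • (e i * mon I) := by
  have hp : (i :: I.sort (· ≤ ·)).Perm ((insert i I).sort (· ≤ ·)) := by
    rw [List.perm_ext_iff_of_nodup]
    · simp
    · simp [h]
    · simp
  obtain ⟨s, hs, h'⟩ := prod_e_perm hp (by simp [h])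
  exact ⟨s, hs, by simpa [mon] using h'⟩

theorem mon_insert_right {i : Fin (m + 1)} {I : Finset (Fin (m + 1))} (h : i ∉ I) :
    ∃ s : ℝ, s * s = 1 ∧ mon (insert i I) = s • (mon I * e i) := by
  have hp : (I.sort (· ≤ ·) ++ [i]).Perm ((insert i I).sort (· ≤ ·)) := by
    rw [List.perm_ext_iff_of_nodup]
    · simp [or_comm]
    · simp [List.nodup_append, h]
    · simp
  obtain ⟨s, hs, h'⟩ := prod_e_perm hp (by simp [List.nodup_append, h])
  exact ⟨s, hs, by simpa [mon] using h'⟩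

theorem e_mul_mon (i : Fin (m + 1)) (I : Finset (Fin (m + 1))) :
    ∃ s : ℝ, s * s = 1 ∧ e i * mon I = s • mon (symmDiff I {i}) := by
  by_cases h : i ∈ I
  · obtain ⟨s, hs, h'⟩ := mon_insert (Finset.notMem_erase i I)
    rw [Finset.insert_erase h] at h'
    refine ⟨s, hs, ?_⟩
    have : symmDiff I {i} = I.erase i := by
      ext j
      simp only [Finset.mem_symmDiff, Finset.mem_singleton, Finset.mem_erase]
      grind
    rw [this, h', mul_smul_comm, ← mul_assoc, e_sq, one_mul]
  · obtain ⟨s, hs, h'⟩ := mon_insert h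
    refine ⟨s, hs, ?_⟩
    have : symmDiff I {i} = insert i I := by
      ext j
      simp only [Finset.mem_symmDiff, Finset.mem_singleton, Finset.mem_insert]
      grind
    rw [this, h', smul_smul, hs, one_smul]

theorem mon_mul_e (i : Fin (m + 1)) (I : Finset (Fin (m + 1))) :
    ∃ s : ℝ, s * s = 1 ∧ mon I * e i = s • mon (symmDiff I {i}) := by
  by_cases h : i ∈ I
  · obtain ⟨s, hs, h'⟩ := mon_insert_right (Finset.notMem_erase i I)
    rw [Finset.insert_erase h] at h'
    refine ⟨s, hs, ?_⟩
    have : symmDiff I {i} = I.erase i := by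
      ext j
      simp only [Finset.mem_symmDiff, Finset.mem_singleton, Finset.mem_erase]
      grind
    rw [this, h', smul_mul_assoc, mul_assoc, e_sq, mul_one]
  · obtain ⟨s, hs, h'⟩ := mon_insert_right h
    refine ⟨s, hs, ?_⟩
    have : symmDiff I {i} = insert i I := by
      ext j
      simp only [Finset.mem_symmDiff, Finset.mem_singleton, Finset.mem_insert]
      grind
    rw [this, h', smul_smul, hs, one_smul]

/-- Passing `e i` through the monomial costs one sign for each factor other than `e i` itself. -/
theorem mon_comm (i : Fin (m + 1)) (I : Finset (Fin (m + 1))) :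
    e i * mon I = (-1 : ℝ) ^ (I.erase i).card • (mon I * e i) := by
  induction I using Finset.induction_on with
  | empty => simp
  | insert j I hj ih =>
    obtain ⟨s, hs, h⟩ := mon_insert hj
    rw [h]
    by_cases hij : i = j
    · subst hij
      rw [Finset.erase_insert hj]
      rw [Finset.erase_eq_of_notMem hj] at ih
      have h2 : e i * (e i * mon I) = (-1 : ℝ) ^ I.card • (e i * mon I * e i) := by
        rw [mul_assoc, ← mul_smul_comm, ← ih]
      rw [mul_smul_comm, h2, smul_mul_assoc, smul_comm]
    · rw [Finset.erase_insert_of_ne (Ne.symm hij), Finset.card_insert_of_notMem (by simp [hj]),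
        mul_smul_comm, ← mul_assoc, e_anticomm hij, neg_mul, mul_assoc, ih, pow_succ]
      simp [smul_smul, mul_assoc, mul_comm]

/-- The sign of the square of a monomial with `k` factors. -/
def eps (k : ℕ) : ℝ := (-1) ^ (k.choose 2)

theorem eps_succ (k : ℕ) : eps (k + 1) = (-1) ^ k * eps k := by
  simp [eps, Nat.choose_succ_succ, pow_add]

theorem eps_mul_self (k : ℕ) : eps k * eps k = 1 := by
  rw [eps, ← pow_add, ← two_mul, pow_mul]
  simp

theorem mon_sq (I : Finset (Fin (m + 1))) : mon I * mon I = eps I.card • (1 : Cl m) := by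
  induction I using Finset.induction_on with
  | empty => simp [eps]
  | insert j I hj ih =>
    obtain ⟨s, hs, h⟩ := mon_insert hj
    have hc := mon_comm j I
    rw [Finset.erase_eq_of_notMem hj] at hc
    rw [h, smul_mul_smul_comm, hs, one_smul, Finset.card_insert_of_notMem hj, eps_succ]
    nth_rewrite 1 [hc]
    rw [smul_mul_assoc, mul_assoc, ← mul_assoc (e j), e_sq, one_mul, ih, smul_smul]

/-- Invariance of averaging over the group of signed monomials: `eps I.card • mon I` is the inverse
of `mon I`, so the sum is `∑ β(g, g⁻¹)`, and multiplication by `e i` permutes the monomials up to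
sign through `I ↦ I ∆ {i}`. Every later averaging argument is a choice of `β`. -/
theorem sum_mon_conj {Y : Type*} [AddCommGroup Y] [Module ℝ Y] (β : Cl m →ₗ[ℝ] Cl m →ₗ[ℝ] Y)
    (i : Fin (m + 1)) :
    ∑ I : Finset (Fin (m + 1)), eps I.card • β (e i * mon I) (mon I * e i) =
      ∑ I : Finset (Fin (m + 1)), eps I.card • β (mon I) (mon I) := by
  have hinv : Function.Involutive fun I : Finset (Fin (m + 1)) => symmDiff I {i} :=
    fun I => symmDiff_symmDiff_cancel_right _ _
  rw [← Equiv.sum_comp hinv.toPerm (fun I => eps I.card • β (mon I) (mon I))]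
  refine Finset.sum_congr rfl fun I _ => ?_
  obtain ⟨s, hs, h1⟩ := e_mul_mon i I
  obtain ⟨t, ht, h2⟩ := mon_mul_e i I
  -- The signs `s` and `t` of the two factors need not be known: this product determines `s * t`,
  -- which is all that the bilinear `β` sees.
  have h3 : (e i * mon I) * (mon I * e i) = eps I.card • (1 : Cl m) := by
    rw [mul_assoc, ← mul_assoc (mon I), mon_sq, smul_mul_assoc, one_mul, mul_smul_comm, e_sq]
  rw [h1, h2, smul_mul_smul_comm, mon_sq, smul_smul] at h3
  change _ = eps (symmDiff I {i}).card • β (mon (symmDiff I {i})) (mon (symmDiff I {i}))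
  rw [h1, h2]
  have h4 : s * t * eps (symmDiff I {i}).card = eps I.card := by
    have : algebraMap ℝ (Cl m) (s * t * eps (symmDiff I {i}).card) =
        algebraMap ℝ (Cl m) (eps I.card) := by
      simpa [Algebra.algebraMap_eq_smul_one] using h3
    have hnt : Nontrivial (Cl m) := inferInstance
    exact (algebraMap ℝ (Cl m)).injective this
  simp only [map_smul, LinearMap.smul_apply, smul_smul]
  congr 1
  rw [← h4]
  linear_combination (eps (symmDiff I {i}).card) * (s * s * ht + hs)

theorem sum_mon_conj' {Y : Type*} [AddCommGroup Y] [Module ℝ Y] (β : Cl m →ₗ[ℝ] Cl m →ₗ[ℝ] Y)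
    (i : Fin (m + 1)) :
    ∑ I : Finset (Fin (m + 1)), eps I.card • β (mon I * e i) (e i * mon I) =
      ∑ I : Finset (Fin (m + 1)), eps I.card • β (mon I) (mon I) :=
  sum_mon_conj β.flip i

/-- By `mon_comm` an index with `|I \ {i}|` odd is wanted: one inside `I` if `|I|` is even, one
outside if `|I|` is odd. This fails only for the empty monomial and for the full one of odd degree
`m + 1`. -/
theorem exists_anticomm {I : Finset (Fin (m + 1))} (h0 : I ≠ ∅)
    (h1 : ¬(I = Finset.univ ∧ Even m)) : ∃ i, e i * mon I = -(mon I * e i) := by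
  rcases Nat.even_or_odd I.card with h | h
  · obtain ⟨i, hi⟩ := Finset.nonempty_iff_ne_empty.2 h0
    refine ⟨i, ?_⟩
    have : Odd (I.erase i).card := by
      rw [Finset.card_erase_of_mem hi]
      have := Finset.card_pos.2 ⟨i, hi⟩
      exact Nat.Even.sub_odd this h odd_one
    rw [mon_comm, this.neg_one_pow, neg_smul, one_smul]
  · have hI : I ≠ Finset.univ := by
      rintro rfl
      rw [Finset.card_univ, Fintype.card_fin] at h
      exact h1 ⟨rfl, by grind⟩
    obtain ⟨i, hi⟩ : ∃ i, i ∉ I := by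
      by_contra! hc
      exact hI (Finset.eq_univ_iff_forall.2 hc)
    refine ⟨i, ?_⟩
    rw [mon_comm, Finset.erase_eq_of_notMem hi, h.neg_one_pow, neg_smul, one_smul]

theorem span_mon : Submodule.span ℝ (Set.range (mon (m := m))) = ⊤ := by
  rw [eq_top_iff]
  intro x _
  induction x using CliffordAlgebra.left_induction with
  | algebraMap r =>
    rw [Algebra.algebraMap_eq_smul_one, ← mon_empty]
    exact Submodule.smul_mem _ _ (Submodule.subset_span ⟨_, rfl⟩)
  | add x y hx hy => exact Submodule.add_mem _ (hx trivial) (hy trivial)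
  | ι_mul x v hx =>
    have hx := hx trivial
    rw [ι_eq_sum, Finset.sum_mul]
    refine Submodule.sum_mem _ fun i _ => ?_
    rw [smul_mul_assoc]
    refine Submodule.smul_mem _ _ ?_
    suffices ∀ y ∈ Submodule.span ℝ (Set.range (mon (m := m))),
        e i * y ∈ Submodule.span ℝ (Set.range (mon (m := m))) from this x hx
    intro y hy
    induction hy using Submodule.span_induction with
    | mem y hy =>
      obtain ⟨I, rfl⟩ := hy
      obtain ⟨s, -, h⟩ := e_mul_mon i I
      rw [h]
      exact Submodule.smul_mem _ _ (Submodule.subset_span ⟨_, rfl⟩)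
    | zero => simp
    | add y z _ _ hy hz => rw [mul_add]; exact Submodule.add_mem _ hy hz
    | smul c y _ hy => rw [mul_smul_comm]; exact Submodule.smul_mem _ _ hy

/-- The volume element. -/
def vol (m : ℕ) : Cl m := mon Finset.univ

theorem e_mul_vol (hm : Even m) (i : Fin (m + 1)) : e i * vol m = vol m * e i := by
  rw [vol, mon_comm, Finset.card_erase_of_mem (Finset.mem_univ i), Finset.card_univ,
    Fintype.card_fin, Nat.add_sub_cancel, hm.neg_one_pow, one_smul]

theorem vol_sq : vol m * vol m = eps (m + 1) • (1 : Cl m) := by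
  rw [vol, mon_sq, Finset.card_univ, Fintype.card_fin]

theorem map_mem_of_gen {A : Type*} [Ring A] [Algebra ℝ A] (ρ : Cl m →ₐ[ℝ] A) (S : Subalgebra ℝ A)
    (h : ∀ i, ρ (e i) ∈ S) (a : Cl m) : ρ a ∈ S := by
  induction a using CliffordAlgebra.left_induction with
  | algebraMap r => rw [AlgHom.commutes]; exact S.algebraMap_mem r
  | add x y hx hy => rw [map_add]; exact S.add_mem hx hy
  | ι_mul x v hx =>
    rw [map_mul, ι_eq_sum, map_sum]
    refine S.mul_mem (S.sum_mem fun i _ => ?_) hx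
    rw [map_smul]
    exact S.smul_mem (h i) _

theorem commute_of_gen {x : Cl m} (h : ∀ i, e i * x = x * e i) (a : Cl m) : a * x = x * a := by
  have := map_mem_of_gen (AlgHom.id ℝ (Cl m)) (Subalgebra.centralizer ℝ {x}) (by
    intro i
    rw [Subalgebra.mem_centralizer_iff]
    rintro _ rfl
    exact (h i).symm) a
  rw [Subalgebra.mem_centralizer_iff] at this
  exact (this x rfl).symm

theorem vol_central (hm : Even m) (a : Cl m) : a * vol m = vol m * a :=
  commute_of_gen (e_mul_vol hm) a

/-- The center of the Clifford algebra is spanned by `1` and, if `m` is even, the volume element. -/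
theorem mem_span_of_central {x : Cl m} (h : ∀ a, a * x = x * a) :
    (∃ a b : ℝ, x = a • 1 + b • vol m) ∧ (Odd m → ∃ a : ℝ, x = a • 1) := by
  -- `A` is `y ↦ ∑ e_I y e_I⁻¹`. It multiplies central elements by `2^(m+1)` and kills every
  -- monomial that anticommutes with a generator, so the centre lies in the span of the surviving
  -- monomials.
  let A : Cl m →ₗ[ℝ] Cl m :=
    ∑ I : Finset (Fin (m + 1)), eps I.card • LinearMap.mulLeft ℝ (mon I) ∘ₗ LinearMap.mulRight ℝ (mon I)
  have hA : ∀ y, A y = ∑ I : Finset (Fin (m + 1)), eps I.card • (mon I * (y * mon I)) := by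
    intro y
    simp [A, LinearMap.sum_apply]
  have hAx : A x = (2 : ℝ) ^ (m + 1) • x := by
    rw [hA]
    have : ∀ I : Finset (Fin (m + 1)), eps I.card • (mon I * (x * mon I)) = x := by
      intro I
      rw [← h, ← mul_assoc, mon_sq, smul_mul_assoc, one_mul, smul_smul, eps_mul_self, one_smul]
    rw [Finset.sum_congr rfl fun I _ => this I]
    simp [← Nat.cast_smul_eq_nsmul ℝ]
  have hA0 : ∀ J : Finset (Fin (m + 1)), J ≠ ∅ → ¬(J = Finset.univ ∧ Even m) → A (mon J) = 0 := by
    intro J h0 h1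
    obtain ⟨i, hi⟩ := exists_anticomm h0 h1
    have key := sum_mon_conj' (LinearMap.mul ℝ (Cl m) ∘ₗ LinearMap.mulRight ℝ (mon J)) i
    have h2 : A (mon J) = -A (mon J) := by
      rw [hA, ← Finset.sum_neg_distrib]
      simp only [LinearMap.comp_apply, LinearMap.mulRight_apply, LinearMap.mul_apply'] at key
      simp only [← mul_assoc] at key ⊢
      rw [← key]
      refine Finset.sum_congr rfl fun I _ => ?_
      rw [mul_assoc (mon I) (e i), hi, mul_neg, neg_mul, neg_mul, mul_assoc (mon I) (mon J * e i),
        mul_assoc (mon J), e_sq, mul_one, smul_neg]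
    have h3 : (2 : ℝ) • A (mon J) = 0 := by
      rw [two_smul]; nth_rewrite 1 [h2]; exact neg_add_cancel _
    exact (smul_eq_zero.1 h3).resolve_left two_ne_zero
  have h2 : (2 : ℝ) ^ (m + 1) ≠ 0 := by positivity
  have hxm : x ∈ Submodule.span ℝ (Set.range (mon (m := m))) := by rw [span_mon]; trivial
  have hvol : A (vol m) = if Even m then (2 : ℝ) ^ (m + 1) • vol m else 0 := by
    split_ifs with he
    · rw [hA]
      have : ∀ I : Finset (Fin (m + 1)), eps I.card • (mon I * (vol m * mon I)) = vol m := by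
        intro I
        rw [← vol_central he, ← mul_assoc, mon_sq, smul_mul_assoc, one_mul, smul_smul,
          eps_mul_self, one_smul]
      rw [Finset.sum_congr rfl fun I _ => this I]
      simp [← Nat.cast_smul_eq_nsmul ℝ]
    · exact hA0 _ (Finset.univ_nonempty.ne_empty) (fun h => he h.2)
  have hone : A 1 = (2 : ℝ) ^ (m + 1) • (1 : Cl m) := by
    rw [hA]
    simp [mon_sq, smul_smul, eps_mul_self, ← Nat.cast_smul_eq_nsmul ℝ]
  have hmem : ∀ y ∈ Submodule.span ℝ (Set.range (mon (m := m))),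
      ∃ a b : ℝ, A y = a • 1 + b • vol m ∧ (Odd m → b = 0) := by
    intro y hy
    induction hy using Submodule.span_induction with
    | mem y hy =>
      obtain ⟨J, rfl⟩ := hy
      by_cases h0 : J = ∅
      · subst h0
        exact ⟨2 ^ (m + 1), 0, by rw [mon_empty, hone, zero_smul, add_zero], fun _ => rfl⟩
      · by_cases h1 : J = Finset.univ ∧ Even m
        · obtain ⟨rfl, he⟩ := h1
          refine ⟨0, 2 ^ (m + 1), ?_, fun ho => absurd he (Nat.not_even_iff_odd.2 ho)⟩
          have := hvol
          rw [if_pos he] at this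
          rw [zero_smul, zero_add]
          exact this
        · exact ⟨0, 0, by simp [hA0 J h0 h1], fun _ => rfl⟩
    | zero => exact ⟨0, 0, by simp, fun _ => rfl⟩
    | add y z _ _ hy hz =>
      obtain ⟨a, b, h, ho⟩ := hy
      obtain ⟨a', b', h', ho'⟩ := hz
      exact ⟨a + a', b + b', by rw [map_add, h, h', add_smul, add_smul]; abel,
        fun hm => by rw [ho hm, ho' hm, add_zero]⟩
    | smul c y _ hy =>
      obtain ⟨a, b, h, ho⟩ := hy
      exact ⟨c * a, c * b, by rw [map_smul, h, smul_add, smul_smul, smul_smul],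
        fun hm => by rw [ho hm, mul_zero]⟩
  obtain ⟨a, b, hab, ho⟩ := hmem x hxm
  have hx : x = ((2 ^ (m + 1))⁻¹ * a) • 1 + ((2 ^ (m + 1))⁻¹ * b) • vol m := by
    rw [mul_smul, mul_smul, ← smul_add, ← hab, hAx, smul_smul, inv_mul_cancel₀ h2, one_smul]
  refine ⟨⟨_, _, hx⟩, fun hm => ⟨(2 ^ (m + 1))⁻¹ * a, ?_⟩⟩
  rw [hx, ho hm]
  simp

/-- The traces of the noncentral monomials vanish in every representation. -/
theorem trace_mon {M : Type*} [AddCommGroup M] [Module ℝ M] (ρ : Cl m →ₐ[ℝ] Module.End ℝ M)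
    {I : Finset (Fin (m + 1))} (h0 : I ≠ ∅) (h1 : ¬(I = Finset.univ ∧ Even m)) :
    LinearMap.trace ℝ M (ρ (mon I)) = 0 := by
  obtain ⟨i, hi⟩ := exists_anticomm h0 h1
  have h : LinearMap.trace ℝ M (ρ (mon I)) = -LinearMap.trace ℝ M (ρ (mon I)) := by
    calc LinearMap.trace ℝ M (ρ (mon I))
        = LinearMap.trace ℝ M (ρ (e i) * ρ (e i * mon I)) := by
          rw [← map_mul, ← mul_assoc, e_sq, one_mul]
      _ = LinearMap.trace ℝ M (ρ (e i * mon I) * ρ (e i)) := LinearMap.trace_mul_comm ..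
      _ = _ := by
          rw [← map_mul, hi, neg_mul, mul_assoc, e_sq, mul_one, map_neg, map_neg]
  linarith

end Monomials

/-! ### Representations of the Clifford algebra -/

section Reps

variable {m : ℕ}

/-- `T` intertwines the representations `ρ` and `σ`. -/
def Intertwines {M M' : Type*} [AddCommGroup M] [Module ℝ M] [AddCommGroup M'] [Module ℝ M']
    (ρ : Cl m →ₐ[ℝ] Module.End ℝ M) (σ : Cl m →ₐ[ℝ] Module.End ℝ M') (T : M →ₗ[ℝ] M') : Prop :=
  ∀ a x, T (ρ a x) = σ a (T x)

/-- `W` is an invariant subspace of the representation `ρ`. -/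
def IsInvariant {M : Type*} [AddCommGroup M] [Module ℝ M] (ρ : Cl m →ₐ[ℝ] Module.End ℝ M)
    (W : Submodule ℝ M) : Prop :=
  ∀ a, ∀ w ∈ W, ρ a w ∈ W

/-- `ρ` is irreducible. -/
def IrrRep {M : Type*} [AddCommGroup M] [Module ℝ M] (ρ : Cl m →ₐ[ℝ] Module.End ℝ M) : Prop :=
  Nontrivial M ∧ ∀ W : Submodule ℝ M, IsInvariant ρ W → W = ⊥ ∨ W = ⊤

variable {M M' M'' : Type*} [AddCommGroup M] [Module ℝ M] [AddCommGroup M'] [Module ℝ M']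
  [AddCommGroup M''] [Module ℝ M'']
  {ρ : Cl m →ₐ[ℝ] Module.End ℝ M} {σ : Cl m →ₐ[ℝ] Module.End ℝ M'}
  {τ : Cl m →ₐ[ℝ] Module.End ℝ M''}

theorem Intertwines.comp {S : M' →ₗ[ℝ] M''} {T : M →ₗ[ℝ] M'} (hS : Intertwines σ τ S)
    (hT : Intertwines ρ σ T) : Intertwines ρ τ (S ∘ₗ T) :=
  fun a x => by simp [hT a x, hS a]

theorem intertwines_of_gen {T : M →ₗ[ℝ] M'} (h : ∀ i x, T (ρ (e i) x) = σ (e i) (T x)) :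
    Intertwines ρ σ T := by
  intro a
  induction a using CliffordAlgebra.left_induction with
  | algebraMap r => intro x; simp [Algebra.algebraMap_eq_smul_one]
  | add x y hx hy => intro z; simp [hx, hy]
  | ι_mul x v hx =>
    intro z
    rw [ι_eq_sum]
    simp [LinearMap.sum_apply, h, hx]

theorem Intertwines.isInvariant_ker {T : M →ₗ[ℝ] M'} (hT : Intertwines ρ σ T) :
    IsInvariant ρ (LinearMap.ker T) := by
  intro a w hw
  rw [LinearMap.mem_ker] at hw ⊢
  rw [hT, hw, map_zero]

theorem Intertwines.isInvariant_range {T : M →ₗ[ℝ] M'} (hT : Intertwines ρ σ T) :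
    IsInvariant σ (LinearMap.range T) := by
  rintro a _ ⟨x, rfl⟩
  exact ⟨ρ a x, hT a x⟩

theorem isInvariant_of_gen {W : Submodule ℝ M} (h : ∀ i, ∀ w ∈ W, ρ (e i) w ∈ W) :
    IsInvariant ρ W := by
  intro a
  induction a using CliffordAlgebra.left_induction with
  | algebraMap r =>
    intro w hw
    simpa [Algebra.algebraMap_eq_smul_one] using W.smul_mem r hw
  | add x y hx hy => intro z hz; simpa using W.add_mem (hx z hz) (hy z hz)
  | ι_mul x v hx =>
    intro z hz
    rw [ι_eq_sum]
    simp only [map_mul, map_sum, map_smul, Module.End.mul_apply, LinearMap.sum_apply,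
      LinearMap.smul_apply]
    exact W.sum_mem fun i _ => W.smul_mem _ (h i _ (hx z hz))

theorem IrrRep.injective (h : IrrRep ρ) {T : M →ₗ[ℝ] M'} (hT : Intertwines ρ σ T) (h0 : T ≠ 0) :
    Function.Injective T := by
  rcases h.2 _ hT.isInvariant_ker with h | h
  · exact LinearMap.ker_eq_bot.1 h
  · exact absurd (LinearMap.ker_eq_top.1 h) h0

/-- The subrepresentation on an invariant subspace. -/
def subRep (ρ : Cl m →ₐ[ℝ] Module.End ℝ M) (W : Submodule ℝ M) (hW : IsInvariant ρ W) :
    Cl m →ₐ[ℝ] Module.End ℝ W :=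
  AlgHom.ofLinearMap
    { toFun := fun a => (ρ a).restrict (hW a)
      map_add' := fun a b => by ext; simp
      map_smul' := fun c a => by ext; simp }
    (by ext; simp) (fun a b => by ext; simp)

theorem IrrRep.of_equiv (h : IrrRep ρ) (f : M ≃ₗ[ℝ] M') (hf : Intertwines ρ σ f.toLinearMap) :
    IrrRep σ := by
  have := h.1
  refine ⟨f.injective.nontrivial, fun W hW => ?_⟩
  have : IsInvariant ρ (W.comap f.toLinearMap) := by
    intro a w hw
    rw [Submodule.mem_comap, hf]
    exact hW a _ hw
  rcases h.2 _ this with h | h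
  · left
    rw [eq_bot_iff]
    intro x hx
    have : f.symm x ∈ W.comap f.toLinearMap := by simpa using hx
    rw [h] at this
    simpa using this
  · right
    rw [eq_top_iff]
    intro x _
    have : f.symm x ∈ W.comap f.toLinearMap := by rw [h]; trivial
    simpa using this

/-- The commutant of a representation. -/
def commutant (ρ : Cl m →ₐ[ℝ] Module.End ℝ M) : Submodule ℝ (Module.End ℝ M) where
  carrier := {T | Intertwines ρ ρ T}
  add_mem' := fun hS hT a x => by simp [hS a x, hT a x]
  zero_mem' := fun a x => by simp
  smul_mem' := fun c T hT a x => by simp [hT a x]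

theorem one_mem_commutant : (1 : Module.End ℝ M) ∈ commutant ρ := fun _ _ => rfl

theorem mul_mem_commutant {S T : Module.End ℝ M} (hS : S ∈ commutant ρ) (hT : T ∈ commutant ρ) :
    S * T ∈ commutant ρ := Intertwines.comp hS hT

theorem algebraMap_mem_commutant (c : ℝ) : c • (1 : Module.End ℝ M) ∈ commutant ρ :=
  (commutant ρ).smul_mem c one_mem_commutant

end Reps

/-! ### Symmetric representations on Euclidean spaces -/

section Euclidean

variable {m : ℕ} {E F : Type*} [NormedAddCommGroup E] [InnerProductSpace ℝ E]
  [NormedAddCommGroup F] [InnerProductSpace ℝ F]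
  {ρ : Cl m →ₐ[ℝ] Module.End ℝ E} {σ : Cl m →ₐ[ℝ] Module.End ℝ F}

/-- The generators act by symmetric endomorphisms. -/
def IsSymmRep (ρ : Cl m →ₐ[ℝ] Module.End ℝ E) : Prop :=
  ∀ i, (ρ (e i)).IsSymmetric

theorem IsSymmRep.subRep (h : IsSymmRep ρ) {W : Submodule ℝ E} (hW : IsInvariant ρ W) :
    IsSymmRep (subRep ρ W hW) :=
  fun i x y => h i x y

theorem IsSymmRep.orthogonal (h : IsSymmRep ρ) {W : Submodule ℝ E} (hW : IsInvariant ρ W) :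
    IsInvariant ρ Wᗮ := by
  refine isInvariant_of_gen fun i w hw => ?_
  rw [Submodule.mem_orthogonal] at hw ⊢
  intro u hu
  rw [← h i]
  exact hw _ (hW _ _ hu)

/-- A symmetric operator with square one is orthogonal, and a monomial is a product of such
operators up to sign. -/
theorem IsSymmRep.inner_mon (h : IsSymmRep ρ) (I : Finset (Fin (m + 1))) (x y : E) :
    inner ℝ (ρ (mon I) x) (ρ (mon I) y) = inner ℝ x y := by
  induction I using Finset.induction_on with
  | empty => simp
  | insert j I hj ih =>
    obtain ⟨s, hs, h'⟩ := mon_insert hj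
    rw [h']
    simp only [map_smul, map_mul, LinearMap.smul_apply, Module.End.mul_apply, inner_smul_left,
      inner_smul_right]
    rw [h j, ← Module.End.mul_apply (ρ (e j)), ← map_mul, e_sq, map_one, Module.End.one_apply, ih]
    simp only [conj_trivial]
    rw [← mul_assoc, hs, one_mul]

variable [FiniteDimensional ℝ E] [FiniteDimensional ℝ F]

theorem adjoint_intertwines (hρ : IsSymmRep ρ) (hσ : IsSymmRep σ) {T : E →ₗ[ℝ] F}
    (hT : Intertwines ρ σ T) : Intertwines σ ρ (LinearMap.adjoint T) := by
  refine intertwines_of_gen fun i x => ext_inner_right ℝ fun y => ?_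
  rw [LinearMap.adjoint_inner_left, hσ i, ← hT, hρ i, LinearMap.adjoint_inner_left]

/-- Schur's lemma works over `ℝ` here because a symmetric operator has a real eigenvalue, whose
eigenspace is invariant. -/
theorem exists_scalar (h : IrrRep ρ) {T : Module.End ℝ E} (hs : T.IsSymmetric)
    (hT : T ∈ commutant ρ) : ∃ c : ℝ, T = c • 1 := by
  have := h.1
  obtain ⟨c, hc⟩ : ∃ c, Module.End.HasEigenvalue T c := ⟨_, hs.hasEigenvalue_iSup_of_finiteDimensional⟩
  refine ⟨c, ?_⟩
  have hinv : IsInvariant ρ (Module.End.eigenspace T c) := by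
    intro a w hw
    rw [Module.End.mem_eigenspace_iff] at hw ⊢
    rw [hT, hw, map_smul]
  rcases h.2 _ hinv with h | h
  · exact absurd h hc
  · ext x
    have : x ∈ Module.End.eigenspace T c := by rw [h]; trivial
    simpa [Module.End.mem_eigenspace_iff] using this

/-- The sum of `T` and its adjoint is symmetric and in the commutant, hence a scalar;
`adjoint_eq_trace` finds this scalar by taking traces. -/
theorem exists_adjoint_eq (hρ : IsSymmRep ρ) (h : IrrRep ρ) {T : Module.End ℝ E}
    (hT : T ∈ commutant ρ) : ∃ c : ℝ, LinearMap.adjoint T = c • 1 - T := by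
  have h1 : LinearMap.adjoint T ∈ commutant ρ := adjoint_intertwines hρ hρ hT
  obtain ⟨c, hc⟩ := exists_scalar h (T := LinearMap.adjoint T + T) (by
    intro x y
    simp only [LinearMap.add_apply, inner_add_left, inner_add_right, LinearMap.adjoint_inner_left,
      LinearMap.adjoint_inner_right]
    ring) ((commutant ρ).add_mem h1 hT)
  exact ⟨c, by rw [← hc]; abel⟩

theorem adjoint_eq_trace (hρ : IsSymmRep ρ) (h : IrrRep ρ) {T : Module.End ℝ E}
    (hT : T ∈ commutant ρ) : LinearMap.adjoint T =
      (2 * LinearMap.trace ℝ E T / Module.finrank ℝ E) • (1 : Module.End ℝ E) - T := by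
  have := h.1
  obtain ⟨c, hc⟩ := exists_adjoint_eq hρ h hT
  have hd : (Module.finrank ℝ E : ℝ) ≠ 0 := by exact_mod_cast Module.finrank_pos.ne'
  have ht : LinearMap.trace ℝ E (LinearMap.adjoint T) = LinearMap.trace ℝ E T := by
    let b := stdOrthonormalBasis ℝ E
    rw [LinearMap.trace_eq_sum_inner _ b, LinearMap.trace_eq_sum_inner _ b]
    refine Finset.sum_congr rfl fun i _ => ?_
    rw [LinearMap.adjoint_inner_right, real_inner_comm]
  have h2 := congrArg (LinearMap.trace ℝ E) hc
  rw [ht, map_sub, map_smul, LinearMap.trace_one, smul_eq_mul] at h2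
  rw [hc]
  congr 2
  field_simp
  linarith

/-- The sum of the squares of the monomials. -/
def sumEps (m : ℕ) : ℝ := ∑ I : Finset (Fin (m + 1)), eps I.card

/-- A Frobenius–Schur type formula for the dimension of the commutant. -/
theorem finrank_commutant (hρ : IsSymmRep ρ) (h : IrrRep ρ) :
    (2 - Module.finrank ℝ (commutant ρ)) * 2 ^ (m + 1) = Module.finrank ℝ E * sumEps m := by
  have := h.1
  let adj : Module.End ℝ E →ₗ[ℝ] Module.End ℝ E :=
    { toFun := fun T => LinearMap.adjoint T
      map_add' := fun S T => map_add _ S T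
      map_smul' := fun c T => by simp }
  -- The average of the adjoint over the signed monomials. Its trace is computed once through its
  -- values in the commutant and once on matrix units.
  let Θ : Module.End ℝ E →ₗ[ℝ] Module.End ℝ E :=
    ∑ I : Finset (Fin (m + 1)), eps I.card •
      LinearMap.mulLeft ℝ (ρ (mon I)) ∘ₗ LinearMap.mulRight ℝ (ρ (mon I)) ∘ₗ adj
  have hΘ : ∀ T, Θ T = ∑ I : Finset (Fin (m + 1)),
      eps I.card • (ρ (mon I) * (LinearMap.adjoint T * ρ (mon I))) := by
    intro T
    simp [Θ, LinearMap.sum_apply, adj]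
  have hmem : ∀ T, Θ T ∈ commutant ρ := by
    intro T
    refine intertwines_of_gen fun i x => ?_
    let β : Cl m →ₗ[ℝ] Cl m →ₗ[ℝ] Module.End ℝ E :=
      (LinearMap.mul ℝ (Module.End ℝ E)).compl₁₂ ρ.toLinearMap
        (LinearMap.mulLeft ℝ (LinearMap.adjoint T) ∘ₗ ρ.toLinearMap)
    have hβ : ∀ a b, β a b = ρ a * (LinearMap.adjoint T * ρ b) := fun a b => rfl
    have key := sum_mon_conj β i
    simp only [hβ] at key
    rw [← hΘ] at key
    have key2 : ρ (e i) * Θ T * ρ (e i) = Θ T := by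
      refine Eq.trans ?_ key
      rw [hΘ, Finset.mul_sum, Finset.sum_mul]
      refine Finset.sum_congr rfl fun I _ => ?_
      simp only [map_mul, mul_smul_comm, smul_mul_assoc, mul_assoc]
    have h1 : Θ T * ρ (e i) = ρ (e i) * Θ T := by
      nth_rewrite 2 [← key2]
      rw [← mul_assoc, ← mul_assoc, ← map_mul, e_sq, map_one, one_mul]
    exact LinearMap.congr_fun h1 x
  have hres : ∀ T ∈ commutant ρ, Θ T = (2 : ℝ) ^ (m + 1) • LinearMap.adjoint T := by
    intro T hT
    have hT' : LinearMap.adjoint T ∈ commutant ρ := adjoint_intertwines hρ hρ hT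
    have h1 : ∀ a, ρ a * LinearMap.adjoint T = LinearMap.adjoint T * ρ a := fun a =>
      LinearMap.ext fun x => (hT' a x).symm
    rw [hΘ]
    have : ∀ I : Finset (Fin (m + 1)), eps I.card • (ρ (mon I) * (LinearMap.adjoint T * ρ (mon I)))
        = LinearMap.adjoint T := by
      intro I
      rw [← h1, ← mul_assoc, ← map_mul, mon_sq, map_smul, smul_mul_assoc, smul_smul, eps_mul_self,
        one_smul, map_one, one_mul]
    rw [Finset.sum_congr rfl fun I _ => this I]
    simp [← Nat.cast_smul_eq_nsmul ℝ]
  -- Since `Θ` takes values in the commutant, its trace is that of its restriction, `2^(m+1)` times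
  -- `T ↦ (2 tr T / dim E) • 1 - T`. The rank one part has trace 2 and the identity has trace `dim
  -- D`.
  have htr1 : LinearMap.trace ℝ _ Θ = (2 - Module.finrank ℝ (commutant ρ)) * 2 ^ (m + 1) := by
    have h1 : Θ = (commutant ρ).subtype ∘ₗ Θ.codRestrict (commutant ρ) hmem := rfl
    rw [h1, LinearMap.trace_comp_comm']
    let φ : commutant ρ →ₗ[ℝ] ℝ := (2 / Module.finrank ℝ E : ℝ) •
      (LinearMap.trace ℝ E ∘ₗ (commutant ρ).subtype)
    let one : commutant ρ := ⟨1, one_mem_commutant⟩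
    have h2 : Θ.codRestrict (commutant ρ) hmem ∘ₗ (commutant ρ).subtype +
        (2 : ℝ) ^ (m + 1) • LinearMap.id = (2 : ℝ) ^ (m + 1) • φ.smulRight one := by
      refine LinearMap.ext fun T => Subtype.ext ?_
      change Θ T + (2 : ℝ) ^ (m + 1) • (T : Module.End ℝ E) =
        (2 : ℝ) ^ (m + 1) • φ T • (1 : Module.End ℝ E)
      rw [hres _ T.2, adjoint_eq_trace hρ h T.2, ← smul_add, sub_add_cancel]
      congr 2
      simp only [φ, LinearMap.smul_apply, LinearMap.comp_apply, Submodule.subtype_apply,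
        smul_eq_mul]
      ring
    have h3 : φ one = 2 := by
      simp only [φ, one, LinearMap.smul_apply, LinearMap.comp_apply, Submodule.subtype_apply,
        smul_eq_mul, LinearMap.trace_one]
      have hd : (Module.finrank ℝ E : ℝ) ≠ 0 := by exact_mod_cast Module.finrank_pos.ne'
      field_simp
    have h4 := congrArg (LinearMap.trace ℝ (commutant ρ)) h2
    rw [map_add, map_smul, map_smul, LinearMap.trace_smulRight, h3, LinearMap.trace_id,
      smul_eq_mul, smul_eq_mul] at h4
    linarith
  have htr2 : LinearMap.trace ℝ _ Θ = Module.finrank ℝ E * sumEps m := by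
    let b := stdOrthonormalBasis ℝ E
    have h1 : ∀ i j, LinearMap.adjoint ((b.toBasis.linearMap b.toBasis) (i, j)) =
        (b.toBasis.linearMap b.toBasis) (j, i) := by
      intro i j
      symm
      rw [LinearMap.eq_adjoint_iff_basis b.toBasis b.toBasis]
      intro k l
      rw [Module.Basis.linearMap_apply_apply, Module.Basis.linearMap_apply_apply]
      simp only [OrthonormalBasis.coe_toBasis]
      split_ifs <;> simp_all [b.inner_eq_ite]
      all_goals grind
    have h2 : ∀ i j x, (b.toBasis.linearMap b.toBasis) (i, j) x = inner ℝ (b j) x • b i := by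
      intro i j x
      have : (b.toBasis.linearMap b.toBasis) (i, j) =
          ((innerₛₗ ℝ (b j)).smulRight (b i)) := by
        refine b.toBasis.ext fun k => ?_
        rw [Module.Basis.linearMap_apply_apply]
        simp [b.inner_eq_ite]
      rw [this]
      simp
    have hrepr : ∀ (T : Module.End ℝ E) i j,
        (b.toBasis.linearMap b.toBasis).repr T (i, j) = inner ℝ (b i) (T (b j)) := by
      intro T i j
      simp [Module.Basis.linearMap_repr_apply, Matrix.stdBasis, LinearMap.toMatrix_apply,
        b.repr_apply_apply]
    rw [LinearMap.trace_eq_matrix_trace ℝ (b.toBasis.linearMap b.toBasis), Matrix.trace,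
      Fintype.sum_prod_type]
    have h3 : ∀ i j, (LinearMap.toMatrix (b.toBasis.linearMap b.toBasis)
        (b.toBasis.linearMap b.toBasis) Θ).diag (i, j) =
        ∑ I : Finset (Fin (m + 1)), eps I.card *
          (inner ℝ (ρ (mon I) (b j)) (b i) * inner ℝ (b i) (ρ (mon I) (b j))) := by
      intro i j
      rw [Matrix.diag_apply, LinearMap.toMatrix_apply, hrepr, hΘ, h1, LinearMap.sum_apply,
        inner_sum]
      refine Finset.sum_congr rfl fun I _ => ?_
      rw [LinearMap.smul_apply, Module.End.mul_apply, Module.End.mul_apply, h2, map_smul,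
        inner_smul_right, inner_smul_right, real_inner_comm (b i)]
    simp only [h3]
    rw [Finset.sum_comm]
    -- Parseval in `i`: the inner sum is `‖e_I b_j‖² = 1`, so only the signs remain.
    have h4 : ∀ j, ∑ i, ∑ I : Finset (Fin (m + 1)), eps I.card *
        (inner ℝ (ρ (mon I) (b j)) (b i) * inner ℝ (b i) (ρ (mon I) (b j))) = sumEps m := by
      intro j
      rw [Finset.sum_comm, sumEps]
      refine Finset.sum_congr rfl fun I _ => ?_
      rw [← Finset.mul_sum, b.sum_inner_mul_inner, hρ.inner_mon, real_inner_self_eq_norm_sq,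
        b.norm_eq_one]
      norm_num
    rw [Finset.sum_congr rfl fun j _ => h4 j]
    simp
  rw [← htr1, htr2]

end Euclidean

/-! ### The type of the commutant -/

/-- The signs run through `1, 1, -1, -1` with period four. Written with powers of `i`, their sum
over all subsets becomes a binomial expansion. -/
theorem eps_eq (k : ℕ) : eps k = (Complex.I ^ k).re + (Complex.I ^ k).im := by
  induction k using Nat.twoStepInduction with
  | zero => simp [eps]
  | one => simp [eps]
  | more k h _ =>
    have h1 : eps (k + 2) = -eps k := by
      rw [eps_succ, eps_succ, ← mul_assoc, ← pow_add]
      have : Odd (k + 1 + k) := ⟨k, by ring⟩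
      rw [this.neg_one_pow, neg_one_mul]
    rw [h1, h, pow_add, Complex.I_sq]
    simp
    ring

theorem sumEps_eq (m : ℕ) :
    sumEps m = ((1 + Complex.I) ^ (m + 1)).re + ((1 + Complex.I) ^ (m + 1)).im := by
  have h := Finset.sum_pow_mul_eq_add_pow Complex.I (1 : ℂ) (Finset.univ : Finset (Fin (m + 1)))
  rw [Finset.card_univ, Fintype.card_fin, add_comm Complex.I] at h
  rw [← h, Complex.re_sum, Complex.im_sum, ← Finset.sum_add_distrib, sumEps]
  simp [eps_eq]

/-- The eightfold periodicity is `(1 + i)^8 = 16 > 0`; only the sign of the sum is needed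
afterwards. -/
theorem sumEps_mod (m : ℕ) : ∃ c : ℝ, 0 < c ∧ sumEps m = c * sumEps (m % 8) := by
  refine ⟨16 ^ (m / 8), by positivity, ?_⟩
  have h8 : (1 + Complex.I) ^ 8 = ((16 : ℝ) : ℂ) := by
    have h2 : (1 + Complex.I) ^ 2 = 2 * Complex.I := by
      rw [add_sq, Complex.I_sq]; ring
    rw [show 8 = 2 * 4 from rfl, pow_mul, h2, mul_pow, Complex.I_pow_four]
    norm_num
  have h : (1 + Complex.I) ^ (m + 1) =
      (((16 : ℝ) ^ (m / 8) : ℝ) : ℂ) * (1 + Complex.I) ^ (m % 8 + 1) := by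
    conv_lhs => rw [← Nat.div_add_mod m 8]
    rw [add_assoc, pow_add, pow_mul, h8, Complex.ofReal_pow]
  rw [sumEps_eq, sumEps_eq, h, Complex.re_ofReal_mul, Complex.im_ofReal_mul, mul_add]

theorem sumEps_small : sumEps 0 = 2 ∧ sumEps 1 = 2 ∧ sumEps 2 = 0 ∧ sumEps 3 = -4 ∧
    sumEps 4 = -8 ∧ sumEps 5 = -8 ∧ sumEps 6 = 0 ∧ sumEps 7 = 16 := by
  simp only [sumEps_eq]
  norm_num [pow_succ]

theorem sumEps_pos {m : ℕ} (h : m % 8 = 0 ∨ m % 8 = 1 ∨ m % 8 = 7) : 0 < sumEps m := by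
  obtain ⟨c, hc, h'⟩ := sumEps_mod m
  obtain ⟨h0, h1, h2, h3, h4, h5, h6, h7⟩ := sumEps_small
  rw [h']
  rcases h with h | h | h <;> rw [h] <;> simp [*]

theorem sumEps_zero {m : ℕ} (h : m % 4 = 2) : sumEps m = 0 := by
  obtain ⟨c, hc, h'⟩ := sumEps_mod m
  obtain ⟨h0, h1, h2, h3, h4, h5, h6, h7⟩ := sumEps_small
  rw [h']
  have : m % 8 = 2 ∨ m % 8 = 6 := by omega
  rcases this with h | h <;> rw [h] <;> simp [*]

theorem sumEps_neg {m : ℕ} (h : m % 8 = 3 ∨ m % 8 = 4 ∨ m % 8 = 5) : sumEps m < 0 := by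
  obtain ⟨c, hc, h'⟩ := sumEps_mod m
  obtain ⟨h0, h1, h2, h3, h4, h5, h6, h7⟩ := sumEps_small
  rw [h']
  rcases h with h | h | h <;> rw [h] <;> simp [*]

section Commutant

variable {m : ℕ} {E : Type*} [NormedAddCommGroup E] [InnerProductSpace ℝ E]
  {ρ : Cl m →ₐ[ℝ] Module.End ℝ E}

theorem smul_one_injective (h : IrrRep ρ) {a b : ℝ}
    (hab : a • (1 : Module.End ℝ E) = b • 1) : a = b := by
  have := h.1
  exact smul_left_injective ℝ (one_ne_zero (α := Module.End ℝ E)) hab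

variable [FiniteDimensional ℝ E]

/-- In `finrank_commutant` the sign of `sumEps m` is that of `2 - dim D`. Positive means `dim D =
1`; zero and negative are the complex and quaternionic cases of the next two lemmas. -/
theorem finrank_commutant_eq_one (hρ : IsSymmRep ρ) (h : IrrRep ρ)
    (hm : m % 8 = 0 ∨ m % 8 = 1 ∨ m % 8 = 7) : ∀ T ∈ commutant ρ, ∃ c : ℝ, T = c • 1 := by
  have := h.1
  have hF := finrank_commutant hρ h
  have hd : (0 : ℝ) < Module.finrank ℝ E := by exact_mod_cast Module.finrank_pos
  have h1 : (0 : ℝ) < 2 - Module.finrank ℝ (commutant ρ) := by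
    have := mul_pos hd (sumEps_pos hm)
    rw [← hF] at this
    exact pos_of_mul_pos_left this (by positivity)
  have h2 : Module.finrank ℝ (commutant ρ) < 2 := by
    have : (Module.finrank ℝ (commutant ρ) : ℝ) < 2 := by linarith
    exact_mod_cast this
  intro T hT
  have hone : (⟨1, one_mem_commutant⟩ : commutant ρ) ≠ 0 := by
    intro h0
    exact one_ne_zero (congrArg Subtype.val h0)
  have h3 : Module.finrank ℝ (commutant ρ) = 1 := by
    have : Nontrivial (commutant ρ) := ⟨_, _, hone⟩
    have := Module.finrank_pos (R := ℝ) (M := commutant ρ)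
    omega
  obtain ⟨c, hc⟩ := (finrank_eq_one_iff_of_nonzero' _ hone).1 h3 ⟨T, hT⟩
  exact ⟨c, (congrArg Subtype.val hc).symm⟩

theorem finrank_commutant_eq_two (hρ : IsSymmRep ρ) (h : IrrRep ρ) (hm : m % 4 = 2) :
    Module.finrank ℝ (commutant ρ) = 2 := by
  have hF := finrank_commutant hρ h
  rw [sumEps_zero hm, mul_zero] at hF
  have : (2 - Module.finrank ℝ (commutant ρ) : ℝ) = 0 :=
    (mul_eq_zero.1 hF).resolve_right (by positivity)
  have : (Module.finrank ℝ (commutant ρ) : ℝ) = 2 := by linarith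
  exact_mod_cast this

theorem two_lt_finrank_commutant (hρ : IsSymmRep ρ) (h : IrrRep ρ)
    (hm : m % 8 = 3 ∨ m % 8 = 4 ∨ m % 8 = 5) : 2 < Module.finrank ℝ (commutant ρ) := by
  have := h.1
  have hF := finrank_commutant hρ h
  have hd : (0 : ℝ) < Module.finrank ℝ E := by exact_mod_cast Module.finrank_pos
  have h1 : (0 : ℝ) < Module.finrank ℝ (commutant ρ) - 2 := by
    have h2 : 0 < Module.finrank ℝ E * -sumEps m := mul_pos hd (neg_pos.2 (sumEps_neg hm))
    have h3 : 0 < (Module.finrank ℝ (commutant ρ) - 2 : ℝ) * 2 ^ (m + 1) := by linarith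
    exact pos_of_mul_pos_left h3 (by positivity)
  have : (2 : ℝ) < (Module.finrank ℝ (commutant ρ) : ℝ) := by linarith
  exact_mod_cast this

/-- A skew element of the commutant squares to a nonpositive scalar. -/
theorem exists_sq_of_skew (h : IrrRep ρ) {T : Module.End ℝ E} (hT : T ∈ commutant ρ)
    (hs : LinearMap.adjoint T = -T) (h0 : T ≠ 0) : ∃ t : ℝ, t ≠ 0 ∧ (t • T) * (t • T) = -1 := by
  have := h.1
  have hin : ∀ x y, inner ℝ (T x) y = -inner ℝ x (T y) := by
    intro x y
    rw [← LinearMap.adjoint_inner_right, hs, LinearMap.neg_apply, inner_neg_right]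
  obtain ⟨c, hc⟩ := exists_scalar h (T := T * T) (fun x y => by
    simp [hin]) (mul_mem_commutant hT hT)
  obtain ⟨x, hx⟩ : ∃ x, T x ≠ 0 := by
    by_contra! hc
    exact h0 (LinearMap.ext hc)
  have hx0 : x ≠ 0 := by rintro rfl; simp at hx
  have hc1 : c * inner ℝ x x = -inner ℝ (T x) (T x) := by
    rw [hin x (T x), neg_neg, ← Module.End.mul_apply, hc]
    simp [inner_smul_right]
  have hp1 : 0 < inner ℝ x x := real_inner_self_pos.2 hx0
  have hp2 : 0 < inner ℝ (T x) (T x) := real_inner_self_pos.2 hx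
  have hneg : c < 0 := by
    by_contra! hn
    have := mul_nonneg hn hp1.le
    linarith
  have hsq : 0 < Real.sqrt (-c) := Real.sqrt_pos.2 (by linarith)
  refine ⟨(Real.sqrt (-c))⁻¹, inv_ne_zero hsq.ne', ?_⟩
  rw [smul_mul_smul_comm, hc, smul_smul, ← mul_inv, Real.mul_self_sqrt (by linarith)]
  have : (-c)⁻¹ * c = -1 := by
    have : c ≠ 0 := hneg.ne
    field_simp
  rw [this, neg_one_smul]

/-- With `J* = c - J`, the scalar `J* J` equals `c J + 1`. If `c ≠ 0`, then `J` would be a real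
scalar with square `-1`. -/
theorem adjoint_of_sq (hρ : IsSymmRep ρ) (h : IrrRep ρ) {J : Module.End ℝ E}
    (hJ : J ∈ commutant ρ) (hs : J * J = -1) : LinearMap.adjoint J = -J := by
  have := h.1
  obtain ⟨c, hc⟩ := exists_adjoint_eq hρ h hJ
  have hJ' : LinearMap.adjoint J ∈ commutant ρ := adjoint_intertwines hρ hρ hJ
  obtain ⟨d, hd⟩ := exists_scalar h (T := LinearMap.adjoint J * J)
    (LinearMap.isSymmetric_adjoint_comp_self J) (mul_mem_commutant hJ' hJ)
  rw [hc, sub_mul, smul_mul_assoc, one_mul, hs, sub_neg_eq_add] at hd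
  by_cases h0 : c = 0
  · rw [hc, h0, zero_smul, zero_sub]
  · exfalso
    have hJs : J = (c⁻¹ * (d - 1)) • (1 : Module.End ℝ E) := by
      rw [mul_smul, sub_smul, ← hd, one_smul, add_sub_cancel_right, smul_smul, inv_mul_cancel₀ h0,
        one_smul]
    rw [hJs, smul_mul_smul_comm, mul_one, ← neg_one_smul ℝ] at hs
    have := smul_one_injective h hs
    nlinarith [mul_self_nonneg (c⁻¹ * (d - 1))]

theorem exists_skew_part (hρ : IsSymmRep ρ) (h : IrrRep ρ) {T : Module.End ℝ E}
    (hT : T ∈ commutant ρ) : ∃ (c : ℝ) (S : Module.End ℝ E), S ∈ commutant ρ ∧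
      LinearMap.adjoint S = -S ∧ T = c • 1 + S := by
  obtain ⟨c, hc⟩ := exists_adjoint_eq hρ h hT
  refine ⟨c / 2, T - (c / 2) • 1, (commutant ρ).sub_mem hT (algebraMap_mem_commutant _), ?_, by abel⟩
  have h1 : LinearMap.adjoint (1 : Module.End ℝ E) = 1 := LinearMap.adjoint_id
  rw [map_sub, hc, map_smulₛₗ, h1]
  have : c • (1 : Module.End ℝ E) = (c / 2) • 1 + (c / 2) • 1 := by rw [← add_smul, add_halves]
  simp only [conj_trivial]
  rw [this]
  abel

theorem exists_unit (hρ : IsSymmRep ρ) (h : IrrRep ρ) {T : Module.End ℝ E}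
    (hT : T ∈ commutant ρ) (h0 : ∀ c : ℝ, T ≠ c • 1) :
    ∃ (a b : ℝ) (J : Module.End ℝ E), J ∈ commutant ρ ∧ J * J = -1 ∧ T = a • 1 + b • J := by
  obtain ⟨c, S, hS, hs, rfl⟩ := exists_skew_part hρ h hT
  have hS0 : S ≠ 0 := by
    rintro rfl
    exact h0 c (by simp)
  obtain ⟨t, ht, h2⟩ := exists_sq_of_skew h hS hs hS0
  exact ⟨c, t⁻¹, t • S, (commutant ρ).smul_mem _ hS, h2, by rw [smul_smul, inv_mul_cancel₀ ht, one_smul]⟩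

/-- Two skew elements anticommute up to a scalar. -/
theorem skew_anticomm (hρ : IsSymmRep ρ) (h : IrrRep ρ) {J S : Module.End ℝ E}
    (hJ : J ∈ commutant ρ) (hJ2 : J * J = -1) (hS : S ∈ commutant ρ)
    (hs : LinearMap.adjoint S = -S) : ∃ c : ℝ, J * S + S * J = c • 1 := by
  have hj := adjoint_of_sq hρ h hJ hJ2
  have hin : ∀ {T : Module.End ℝ E}, LinearMap.adjoint T = -T →
      ∀ x y, inner ℝ (T x) y = -inner ℝ x (T y) := by
    intro T hT x y
    rw [← LinearMap.adjoint_inner_right, hT, LinearMap.neg_apply, inner_neg_right]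
  refine exists_scalar h (fun x y => ?_)
    ((commutant ρ).add_mem (mul_mem_commutant hJ hS) (mul_mem_commutant hS hJ))
  simp only [LinearMap.add_apply, Module.End.mul_apply, inner_add_left, inner_add_right, hin hj,
    hin hs, neg_neg]
  ring

/-- As `dim D > 2`, there is an element outside the span of `1` and a first unit `J`. Removing its
scalar part and its `J` component leaves a skew element that anticommutes with `J`, and it can be
rescaled to a unit. -/
theorem exists_quaternion_units (hρ : IsSymmRep ρ) (h : IrrRep ρ)
    (hm : m % 8 = 3 ∨ m % 8 = 4 ∨ m % 8 = 5) :
    ∃ I J : Module.End ℝ E, I ∈ commutant ρ ∧ J ∈ commutant ρ ∧ I * I = -1 ∧ J * J = -1 ∧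
      J * I = -(I * J) := by
  have := h.1
  have hd := two_lt_finrank_commutant hρ h hm
  obtain ⟨T, hT, hT0⟩ : ∃ T ∈ commutant ρ, ∀ c : ℝ, T ≠ c • 1 := by
    by_contra! hc
    have : Module.finrank ℝ (commutant ρ) ≤ 1 := by
      refine finrank_le_one ⟨1, one_mem_commutant⟩ fun T => ?_
      obtain ⟨c, hc⟩ := hc T.1 T.2
      exact ⟨c, Subtype.ext hc.symm⟩
    omega
  obtain ⟨-, -, J, hJ, hJ2, -⟩ := exists_unit hρ h hT hT0
  obtain ⟨S, hS, hS0⟩ : ∃ S ∈ commutant ρ, ∀ a b : ℝ, S ≠ a • 1 + b • J := by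
    by_contra! hc
    let f : ℝ × ℝ →ₗ[ℝ] commutant ρ :=
      (LinearMap.toSpanSingleton ℝ (commutant ρ) ⟨1, one_mem_commutant⟩).coprod
        (LinearMap.toSpanSingleton ℝ (commutant ρ) ⟨J, hJ⟩)
    have hf : LinearMap.range f = ⊤ := by
      rw [LinearMap.range_eq_top]
      rintro ⟨S, hS⟩
      obtain ⟨a, b, rfl⟩ := hc S hS
      exact ⟨(a, b), rfl⟩
    have h1 := f.finrank_range_le
    rw [hf, finrank_top, Module.finrank_prod, Module.finrank_self] at h1
    omega
  obtain ⟨c, S', hS', hs', rfl⟩ := exists_skew_part hρ h hS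
  obtain ⟨d, hd⟩ := skew_anticomm hρ h hJ hJ2 hS' hs'
  -- The anticommutator of `J` with `(d / 2) • J` is `-d`, since `J² = -1`; this cancels `J S' + S'
  -- J = d`.
  let S2 := S' + (d / 2) • J
  have hS2 : S2 ∈ commutant ρ := (commutant ρ).add_mem hS' ((commutant ρ).smul_mem _ hJ)
  have hs2 : LinearMap.adjoint S2 = -S2 := by
    simp only [S2, map_add, map_smulₛₗ, hs', adjoint_of_sq hρ h hJ hJ2, conj_trivial]
    rw [smul_neg, neg_add]
  have hS20 : S2 ≠ 0 := by
    intro h0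
    refine hS0 c (-(d / 2)) ?_
    rw [neg_smul, ← eq_neg_of_add_eq_zero_left h0]
  have hanti : S2 * J = -(J * S2) := by
    rw [eq_neg_iff_add_eq_zero]
    simp only [S2, add_mul, mul_add, smul_mul_assoc, mul_smul_comm, hJ2]
    have : S' * J + (d / 2) • (-1 : Module.End ℝ E) + (J * S' + (d / 2) • -1) =
        (J * S' + S' * J) - ((d / 2) • 1 + (d / 2) • 1) := by
      rw [smul_neg]; abel
    rw [this, hd, ← add_smul, add_halves, sub_self]
  obtain ⟨t, ht, htt⟩ := exists_sq_of_skew h hS2 hs2 hS20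
  exact ⟨J, t • S2, hJ, (commutant ρ).smul_mem _ hS2, hJ2, htt,
    by rw [smul_mul_assoc, hanti, mul_smul_comm, smul_neg]⟩

end Commutant

/-- The action `l` of `K` is the whole commutant, and conjugation is the adjoint. -/
structure IsFullScalar {m : ℕ} {E : Type*} [NormedAddCommGroup E] [InnerProductSpace ℝ E]
    {K : Type*} [Ring K] [StarRing K] [Algebra ℝ K]
    (ρ : Cl m →ₐ[ℝ] Module.End ℝ E) (l : K →ₐ[ℝ] Module.End ℝ E) : Prop where
  adj : ∀ q x y, inner ℝ (l q x) y = inner ℝ x (l (star q) y)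
  full : ∀ T ∈ commutant ρ, ∃ q, T = l q

/-- `K` is the commutant of all irreducible representations of the Clifford algebra. -/
def IsCommutantField (K : Type) [Ring K] [StarRing K] [Algebra ℝ K] (m : ℕ) : Prop :=
  ∀ (E : Type) [NormedAddCommGroup E] [InnerProductSpace ℝ E] [FiniteDimensional ℝ E]
    (ρ : Cl m →ₐ[ℝ] Module.End ℝ E), IsSymmRep ρ → IrrRep ρ →
    (∃ l : K →ₐ[ℝ] Module.End ℝ E, ∀ q, l q ∈ commutant ρ) ∧
      ∀ l : K →ₐ[ℝ] Module.End ℝ E, (∀ q, l q ∈ commutant ρ) → IsFullScalar ρ l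

theorem isCommutantField_real {m : ℕ} (hm : m % 8 = 0 ∨ m % 8 = 1 ∨ m % 8 = 7) :
    IsCommutantField ℝ m := by
  intro E _ _ _ ρ hρ h
  refine ⟨⟨Algebra.ofId _ _, fun q => ?_⟩, fun l _ => ⟨fun q x y => ?_, fun T hT => ?_⟩⟩
  · rw [Algebra.ofId_apply, Algebra.algebraMap_eq_smul_one]
    exact algebraMap_mem_commutant q
  · have : l q = q • 1 := by
      rw [← Algebra.algebraMap_eq_smul_one]
      exact l.commutes q
    simp [this, inner_smul_left, inner_smul_right]
  · obtain ⟨c, rfl⟩ := finrank_commutant_eq_one hρ h hm T hT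
    exact ⟨c, by rw [← Algebra.algebraMap_eq_smul_one]; exact (l.commutes c).symm⟩

theorem inner_of_adjoint_eq_neg {E : Type*} [NormedAddCommGroup E] [InnerProductSpace ℝ E]
    [FiniteDimensional ℝ E] {T : Module.End ℝ E} (hT : LinearMap.adjoint T = -T) (x y : E) :
    inner ℝ (T x) y = -inner ℝ x (T y) := by
  rw [← LinearMap.adjoint_inner_right, hT, LinearMap.neg_apply, inner_neg_right]

theorem isCommutantField_complex {m : ℕ} (hm : m % 4 = 2) : IsCommutantField ℂ m := by
  intro E _ _ _ ρ hρ h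
  have := h.1
  have hd := finrank_commutant_eq_two hρ h hm
  have hz : ∀ z : ℂ, z = algebraMap ℝ ℂ z.re + z.im • Complex.I := by
    intro z
    simp [Complex.re_add_im]
  have hl : ∀ (l : ℂ →ₐ[ℝ] Module.End ℝ E) z, l z = z.re • 1 + z.im • l Complex.I := by
    intro l z
    conv_lhs => rw [hz z]
    rw [map_add, l.commutes, map_smul, Algebra.algebraMap_eq_smul_one]
  refine ⟨?_, fun l hlc => ⟨fun q x y => ?_, ?_⟩⟩
  · obtain ⟨T, hT, hT0⟩ : ∃ T ∈ commutant ρ, ∀ c : ℝ, T ≠ c • 1 := by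
      by_contra! hc
      have : Module.finrank ℝ (commutant ρ) ≤ 1 := by
        refine finrank_le_one ⟨1, one_mem_commutant⟩ fun T => ?_
        obtain ⟨c, hc⟩ := hc T.1 T.2
        exact ⟨c, Subtype.ext hc.symm⟩
      omega
    obtain ⟨a, b, J, hJ, hJ2, -⟩ := exists_unit hρ h hT hT0
    refine ⟨Complex.lift ⟨J, hJ2⟩, fun q => ?_⟩
    rw [hl]
    refine (commutant ρ).add_mem (algebraMap_mem_commutant _) ((commutant ρ).smul_mem _ ?_)
    have : Complex.lift ⟨J, hJ2⟩ Complex.I = J := by simp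
    rwa [this]
  · have hI : l Complex.I * l Complex.I = -1 := by rw [← map_mul, Complex.I_mul_I, map_neg, map_one]
    have := inner_of_adjoint_eq_neg (adjoint_of_sq hρ h (hlc _) hI)
    rw [hl l q, hl l (star q)]
    simp [inner_add_left, inner_add_right, inner_smul_left, inner_smul_right, this]
  · have hI : l Complex.I * l Complex.I = -1 := by rw [← map_mul, Complex.I_mul_I, map_neg, map_one]
    let l' : ℂ →ₗ[ℝ] commutant ρ := l.toLinearMap.codRestrict _ hlc
    have hinj : Function.Injective l' := by
      intro a b hab
      exact (l : ℂ →+* Module.End ℝ E).injective (congrArg Subtype.val hab)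
    have hsurj : Function.Surjective l' := by
      refine (LinearMap.injective_iff_surjective_of_finrank_eq_finrank ?_).1 hinj
      rw [hd, Complex.finrank_real_complex]
    intro T hT
    obtain ⟨q, hq⟩ := hsurj ⟨T, hT⟩
    exact ⟨q, (congrArg Subtype.val hq).symm⟩

/-- The quaternion `a + b i + c j + d k`. -/
def quat (a b c d : ℝ) : ℍ[ℝ] := ⟨a, b, c, d⟩

@[simp] theorem quat_re (a b c d : ℝ) : (quat a b c d).re = a := rfl
@[simp] theorem quat_imI (a b c d : ℝ) : (quat a b c d).imI = b := rfl
@[simp] theorem quat_imJ (a b c d : ℝ) : (quat a b c d).imJ = c := rfl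
@[simp] theorem quat_imK (a b c d : ℝ) : (quat a b c d).imK = d := rfl

/-- The homomorphism out of the quaternions with given values on the imaginary units. -/
def quatLift {A : Type*} [Ring A] [Algebra ℝ A] (B : QuaternionAlgebra.Basis A (-1 : ℝ) 0 (-1)) :
    ℍ[ℝ] →ₐ[ℝ] A := B.liftHom

theorem quatLift_apply {A : Type*} [Ring A] [Algebra ℝ A]
    (B : QuaternionAlgebra.Basis A (-1 : ℝ) 0 (-1)) (a b c d : ℝ) :
    quatLift B (quat a b c d) = algebraMap ℝ A a + b • B.i + c • B.j + d • B.k := rfl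

/-- That nothing lies beyond `ℍ` needs no dimension count: an element of the commutant that
anticommutes with `i` and `j` commutes with `k = ij`, so if it also anticommutes with `k` it is
zero. -/
theorem isCommutantField_quaternion {m : ℕ} (hm : m % 8 = 3 ∨ m % 8 = 4 ∨ m % 8 = 5) :
    IsCommutantField ℍ[ℝ] m := by
  intro E _ _ _ ρ hρ h
  have := h.1
  let qi : ℍ[ℝ] := quat 0 1 0 0
  let qj : ℍ[ℝ] := quat 0 0 1 0
  let qk : ℍ[ℝ] := quat 0 0 0 1
  have hz : ∀ z : ℍ[ℝ], z = algebraMap ℝ ℍ[ℝ] z.re + z.imI • qi + z.imJ • qj + z.imK • qk := by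
    intro z
    ext <;> simp [qi, qj, qk]
  have hl : ∀ (l : ℍ[ℝ] →ₐ[ℝ] Module.End ℝ E) z,
      l z = z.re • 1 + z.imI • l qi + z.imJ • l qj + z.imK • l qk := by
    intro l z
    conv_lhs => rw [hz z]
    rw [map_add, map_add, map_add, l.commutes, map_smul, map_smul, map_smul,
      Algebra.algebraMap_eq_smul_one]
  have hii : qi * qi = -1 := by ext <;> simp [qi]
  have hjj : qj * qj = -1 := by ext <;> simp [qj]
  have hkk : qk * qk = -1 := by ext <;> simp [qk]
  have hij : qi * qj = qk := by ext <;> simp [qi, qj, qk]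
  have hji : qj * qi = -qk := by ext <;> simp [qi, qj, qk]
  refine ⟨?_, fun l hlc => ?_⟩
  · obtain ⟨I, J, hI, hJ, hI2, hJ2, hJI⟩ := exists_quaternion_units hρ h hm
    let B : QuaternionAlgebra.Basis (Module.End ℝ E) (-1 : ℝ) 0 (-1) :=
      { i := I
        j := J
        k := I * J
        i_mul_i := by simp [hI2]
        j_mul_j := by simp [hJ2]
        i_mul_j := rfl
        j_mul_i := by simp [hJI] }
    have hB1 : quatLift B qi = I := by simp [quatLift_apply, qi, B]
    have hB2 : quatLift B qj = J := by simp [quatLift_apply, qj, B]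
    have hiM : quatLift B qi ∈ commutant ρ := by rwa [hB1]
    have hjM : quatLift B qj ∈ commutant ρ := by rwa [hB2]
    refine ⟨quatLift B, fun q => ?_⟩
    rw [hl, ← hij, map_mul]
    exact (commutant ρ).add_mem ((commutant ρ).add_mem ((commutant ρ).add_mem
      (algebraMap_mem_commutant _) ((commutant ρ).smul_mem _ hiM)) ((commutant ρ).smul_mem _ hjM))
      ((commutant ρ).smul_mem _ (mul_mem_commutant hiM hjM))
  · have hi2 : l qi * l qi = -1 := by rw [← map_mul, hii, map_neg, map_one]
    have hj2 : l qj * l qj = -1 := by rw [← map_mul, hjj, map_neg, map_one]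
    have hk2 : l qk * l qk = -1 := by rw [← map_mul, hkk, map_neg, map_one]
    have hi := inner_of_adjoint_eq_neg (adjoint_of_sq hρ h (hlc _) hi2)
    have hj := inner_of_adjoint_eq_neg (adjoint_of_sq hρ h (hlc _) hj2)
    have hk := inner_of_adjoint_eq_neg (adjoint_of_sq hρ h (hlc _) hk2)
    refine ⟨fun q x y => ?_, fun T hT => ?_⟩
    · rw [hl l q, hl l (star q)]
      simp [inner_add_left, inner_add_right, inner_smul_left, inner_smul_right, hi, hj, hk]
    · obtain ⟨c, S, hS, hs, rfl⟩ := exists_skew_part hρ h hT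
      obtain ⟨di, hdi⟩ := skew_anticomm hρ h (hlc _) hi2 hS hs
      obtain ⟨dj, hdj⟩ := skew_anticomm hρ h (hlc _) hj2 hS hs
      obtain ⟨dk, hdk⟩ := skew_anticomm hρ h (hlc _) hk2 hS hs
      have hlij : l qi * l qj = l qk := by rw [← map_mul, hij]
      have hlji : l qj * l qi = -l qk := by rw [← map_mul, hji, map_neg]
      have hlik : l qi * l qk = -l qj := by
        rw [← hlij, ← mul_assoc, hi2, neg_one_mul]
      have hlki : l qk * l qi = l qj := by
        have := congrArg (fun X => X * l qi) hlji
        simp only [mul_assoc, hi2, mul_neg, mul_one, neg_mul] at this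
        exact (neg_injective this).symm
      have hlkj : l qk * l qj = -l qi := by
        rw [← hlij, mul_assoc, hj2, mul_neg, mul_one]
      have hljk : l qj * l qk = l qi := by
        have := congrArg (fun X => l qj * X) hlji
        simp only [← mul_assoc, hj2, mul_neg, neg_mul, one_mul] at this
        exact (neg_injective this).symm
      -- The coefficients are half the scalar anticommutators of `S` with the units, so that `S'`
      -- anticommutes with all three.
      let S' := S + (di / 2) • l qi + (dj / 2) • l qj + (dk / 2) • l qk
      have h1 : l qi * S' = -(S' * l qi) := by
        rw [eq_neg_iff_add_eq_zero]
        simp only [S', mul_add, add_mul, mul_smul_comm, smul_mul_assoc, hi2, hlij, hlik, hlki, hlji,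
          smul_neg]
        linear_combination (norm := module) hdi
      have h2 : l qj * S' = -(S' * l qj) := by
        rw [eq_neg_iff_add_eq_zero]
        simp only [S', mul_add, add_mul, mul_smul_comm, smul_mul_assoc, hj2, hlij, hljk, hlkj, hlji,
          smul_neg]
        linear_combination (norm := module) hdj
      have h3 : l qk * S' = -(S' * l qk) := by
        rw [eq_neg_iff_add_eq_zero]
        simp only [S', mul_add, add_mul, mul_smul_comm, smul_mul_assoc, hk2, hlik, hljk, hlkj, hlki,
          smul_neg]
        linear_combination (norm := module) hdk
      have h4 : l qk * S' = S' * l qk := by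
        rw [← hlij, mul_assoc, h2, mul_neg, ← mul_assoc, h1, neg_mul, neg_neg, mul_assoc]
      have h5 : l qk * S' = 0 := by
        have h6 : (2 : ℝ) • (l qk * S') = 0 := by
          rw [two_smul]; nth_rewrite 1 [h3]; rw [h4, neg_add_cancel]
        exact (smul_eq_zero.1 h6).resolve_left two_ne_zero
      have h6 : S' = 0 := by
        have := congrArg (fun X => l qk * X) h5
        simpa only [← mul_assoc, hk2, neg_mul, one_mul, mul_zero, neg_eq_zero] using this
      refine ⟨quat c (-(di / 2)) (-(dj / 2)) (-(dk / 2)), ?_⟩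
      rw [hl]
      simp only [quat_re, quat_imI, quat_imJ, quat_imK, neg_smul]
      have : S = -((di / 2) • l qi) + -((dj / 2) • l qj) + -((dk / 2) • l qk) := by
        rw [← sub_eq_zero, ← h6]
        simp only [S']
        abel
      rw [this]
      abel

/-! ### Existence of irreducible representations by matrices -/

section Existence

variable {m : ℕ}

@[simp] theorem colAct_apply {K : Type} [Ring K] [Algebra ℝ K] {r : ℕ}
    (A : Matrix (Fin r) (Fin r) K) (v : Fin r → K) : colAct A v = A.mulVec v := rfl

/-- The real representation on columns given by a homomorphism into a matrix algebra. -/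
def colRep {K : Type} [Ring K] [Algebra ℝ K] {r : ℕ} (χ : Cl m →ₐ[ℝ] Matrix (Fin r) (Fin r) K) :
    Cl m →ₐ[ℝ] Module.End ℝ (Fin r → K) :=
  AlgHom.ofLinearMap
    { toFun := fun a => colAct (χ a)
      map_add' := fun a b => LinearMap.ext fun x => by simp [Matrix.add_mulVec]
      map_smul' := fun c a => LinearMap.ext fun x => by simp [Matrix.smul_mulVec] }
    (LinearMap.ext fun x => by simp) (fun a b => LinearMap.ext fun x => by simp)

theorem irrRep_colRep {K : Type} [Ring K] [Algebra ℝ K] {r : ℕ}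
    {χ : Cl m →ₐ[ℝ] Matrix (Fin r) (Fin r) K} : IrrRep (colRep χ) ↔ IsIrreducibleRep χ := Iff.rfl

/-- A nonzero invariant subspace of least dimension is irreducible. -/
theorem exists_irreducible_sub {M : Type*} [AddCommGroup M] [Module ℝ M] [FiniteDimensional ℝ M]
    [Nontrivial M] (ρ : Cl m →ₐ[ℝ] Module.End ℝ M) :
    ∃ (U : Submodule ℝ M) (hU : IsInvariant ρ U), IrrRep (subRep ρ U hU) := by
  classical
  have hex : ∃ d, ∃ U : Submodule ℝ M, IsInvariant ρ U ∧ U ≠ ⊥ ∧ Module.finrank ℝ U = d :=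
    ⟨_, ⊤, fun _ _ _ => trivial, top_ne_bot, rfl⟩
  obtain ⟨U, hU, hU0, hd⟩ := Nat.find_spec hex
  refine ⟨U, hU, Submodule.nontrivial_iff_ne_bot.2 hU0, fun W hW => ?_⟩
  by_cases hW0 : W = ⊥
  · exact Or.inl hW0
  · right
    have hinv : IsInvariant ρ (W.map U.subtype) := by
      rintro a _ ⟨x, hx, rfl⟩
      exact ⟨_, hW a x hx, rfl⟩
    have hne : W.map U.subtype ≠ ⊥ := fun h =>
      hW0 (Submodule.map_injective_of_injective U.subtype_injective (h.trans (Submodule.map_bot _).symm))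
    have h1 := Nat.find_min' hex ⟨_, hinv, hne, rfl⟩
    rw [← hd, LinearEquiv.finrank_eq (Submodule.equivMapOfInjective _ U.subtype_injective W).symm]
      at h1
    exact Submodule.eq_top_of_finrank_eq (le_antisymm (Submodule.finrank_le W) h1)

/-- The scalars in the commutant make `E` a right vector space over `K`. The Clifford algebra acts
linearly over `K`, hence by matrices in any basis. -/
theorem exists_isIrreducibleRep {K : Type} [DivisionRing K] [StarRing K] [Algebra ℝ K]
    [StarModule ℝ K] {E : Type*} [AddCommGroup E] [Module ℝ E] [FiniteDimensional ℝ E]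
    {ρ : Cl m →ₐ[ℝ] Module.End ℝ E} (h : IrrRep ρ) (l : K →ₐ[ℝ] Module.End ℝ E)
    (hl : ∀ q, l q ∈ commutant ρ) :
    ∃ (r : ℕ) (χ : Cl m →ₐ[ℝ] Matrix (Fin r) (Fin r) K), IsIrreducibleRep χ := by
  -- `l` is a left action; composing it with the conjugation, which reverses products, gives the
  -- right action needed for matrices to act on columns from the left.
  let _ : Module Kᵐᵒᵖ E :=
    { smul := fun q x => l (star q.unop) x
      one_smul := fun x => by change l (star (1 : K)) x = x; simp
      mul_smul := fun p q x => by
        change l (star (q.unop * p.unop)) x = l (star p.unop) (l (star q.unop) x)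
        simp
      smul_zero := fun q => map_zero _
      smul_add := fun q => map_add _
      add_smul := fun p q x => by
        change l (star (p.unop + q.unop)) x = l (star p.unop) x + l (star q.unop) x
        simp
      zero_smul := fun x => by change l (star (0 : K)) x = 0; simp }
  have hsmul : ∀ (q : Kᵐᵒᵖ) (x : E), q • x = l (star q.unop) x := fun _ _ => rfl
  have : IsScalarTower ℝ Kᵐᵒᵖ E := ⟨fun c q x => by simp [hsmul]⟩
  have : Module.Finite Kᵐᵒᵖ E := Module.Finite.of_restrictScalars_finite ℝ _ _
  let b := Module.finBasis Kᵐᵒᵖ E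
  let f : E ≃ₗ[ℝ] (Fin (Module.finrank Kᵐᵒᵖ E) → K) :=
    (b.equivFun.restrictScalars ℝ).trans
      (LinearEquiv.piCongrRight fun _ => (MulOpposite.opLinearEquiv ℝ).symm)
  have hf : ∀ x i, f x i = (b.repr x i).unop := fun _ _ => rfl
  have hkey : ∀ a x i, f (ρ a x) i = ∑ j, f (ρ a (b j)) i * f x j := by
    intro a x i
    have hx : ρ a x = ∑ j, b.repr x j • ρ a (b j) := by
      conv_lhs => rw [← b.sum_repr x]
      rw [map_sum]
      refine Finset.sum_congr rfl fun j _ => ?_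
      rw [hsmul, hsmul, hl]
    rw [hf, hx, map_sum, Finsupp.finsetSum_apply, Finset.unop_sum]
    refine Finset.sum_congr rfl fun j _ => ?_
    rw [map_smul, Finsupp.smul_apply, smul_eq_mul, MulOpposite.unop_mul]
    rfl
  let χ : Cl m →ₐ[ℝ] Matrix (Fin (Module.finrank Kᵐᵒᵖ E)) (Fin (Module.finrank Kᵐᵒᵖ E)) K :=
    AlgHom.ofLinearMap
      { toFun := fun a => Matrix.of fun i j => f (ρ a (b j)) i
        map_add' := fun a b => by ext; simp
        map_smul' := fun c a => by ext; simp }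
      (by
        ext i j
        simp only [LinearMap.coe_mk, AddHom.coe_mk, map_one, Module.End.one_apply, Matrix.of_apply,
          hf, b.repr_self, Finsupp.single_apply, Matrix.one_apply, eq_comm]
        split_ifs <;> simp)
      (fun a c => by
        ext i j
        simp only [LinearMap.coe_mk, AddHom.coe_mk, map_mul, Module.End.mul_apply, Matrix.of_apply,
          Matrix.mul_apply]
        exact hkey _ _ _)
  refine ⟨_, χ, irrRep_colRep.1 (h.of_equiv f fun a x => ?_)⟩
  ext i
  exact hkey a x i

end Existence

/-! ### Existence of intertwiners -/

section Intertwiners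

variable {m : ℕ} {M M' : Type*} [AddCommGroup M] [Module ℝ M] [AddCommGroup M'] [Module ℝ M']
  {ρ : Cl m →ₐ[ℝ] Module.End ℝ M} {σ : Cl m →ₐ[ℝ] Module.End ℝ M'}

/-- The average of the rank one map `φ ⊗ w`. -/
def average (ρ : Cl m →ₐ[ℝ] Module.End ℝ M) (σ : Cl m →ₐ[ℝ] Module.End ℝ M') (φ : M →ₗ[ℝ] ℝ)
    (w : M') : M →ₗ[ℝ] M' :=
  ∑ I : Finset (Fin (m + 1)), eps I.card • (φ ∘ₗ ρ (mon I)).smulRight (σ (mon I) w)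

theorem average_apply (φ : M →ₗ[ℝ] ℝ) (w : M') (x : M) : average ρ σ φ w x =
    ∑ I : Finset (Fin (m + 1)), eps I.card • (φ (ρ (mon I) x) • σ (mon I) w) := by
  simp [average, LinearMap.sum_apply]

theorem average_intertwines (φ : M →ₗ[ℝ] ℝ) (w : M') : Intertwines ρ σ (average ρ σ φ w) := by
  refine intertwines_of_gen fun i x => ?_
  let β : Cl m →ₗ[ℝ] Cl m →ₗ[ℝ] M' :=
    (LinearMap.lsmul ℝ M').compl₁₂
      (φ ∘ₗ (LinearMap.applyₗ (ρ (e i) x)) ∘ₗ ρ.toLinearMap)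
      ((LinearMap.applyₗ w) ∘ₗ σ.toLinearMap)
  have hβ : ∀ a b, β a b = φ (ρ a (ρ (e i) x)) • σ b w := fun _ _ => rfl
  have key := sum_mon_conj' β i
  simp only [hβ] at key
  rw [average_apply, average_apply, ← key, map_sum]
  refine Finset.sum_congr rfl fun I _ => ?_
  rw [map_smul, map_smul, ← Module.End.mul_apply (ρ _), ← map_mul, mul_assoc, e_sq, mul_one,
    map_mul σ, Module.End.mul_apply]

theorem average_mem {U : Submodule ℝ M'} (hU : IsInvariant σ U) (φ : M →ₗ[ℝ] ℝ) {w : M'}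
    (hw : w ∈ U) : LinearMap.range (average ρ σ φ w) ≤ U := by
  rintro _ ⟨x, rfl⟩
  rw [average_apply]
  exact U.sum_mem fun I _ => U.smul_mem _ (U.smul_mem _ (hU _ _ hw))

/-- Summing the averages of `φ ⊗ w` over dual bases gives `∑ eps |I| • tr(ρ e_I) • σ(e_I) w`. All
traces vanish except those of `1` and, for even `m`, of the volume element. -/
theorem sum_trace_eq_zero [FiniteDimensional ℝ M] {w : M'} (h : ∀ φ, average ρ σ φ w = 0) :
    (Module.finrank ℝ M : ℝ) • w + (if Even m then eps (m + 1) * LinearMap.trace ℝ M (ρ (vol m))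
      else 0) • σ (vol m) w = 0 := by
  let b := Module.finBasis ℝ M
  have h1 : ∑ I : Finset (Fin (m + 1)),
      (eps I.card * LinearMap.trace ℝ M (ρ (mon I))) • σ (mon I) w = 0 := by
    have h2 : ∑ k, average ρ σ (b.coord k) w (b k) = 0 := by simp [h]
    rw [← h2]
    simp only [average_apply]
    rw [Finset.sum_comm]
    refine Finset.sum_congr rfl fun I _ => ?_
    rw [← Finset.smul_sum, ← Finset.sum_smul, smul_smul]
    congr 2
    rw [LinearMap.trace_eq_matrix_trace ℝ b, Matrix.trace]
    simp [LinearMap.toMatrix_apply]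
  have hne : (∅ : Finset (Fin (m + 1))) ≠ Finset.univ := Finset.univ_nonempty.ne_empty.symm
  rw [← Finset.sum_subset (Finset.subset_univ {∅, Finset.univ}), Finset.sum_pair hne] at h1
  · simp only [Finset.card_empty, mon_empty, map_one, LinearMap.trace_one, Module.End.one_apply] at h1
    have : eps 0 = 1 := by simp [eps]
    rw [this, one_mul] at h1
    split_ifs with he
    · simpa [vol] using h1
    · rw [trace_mon ρ hne.symm (fun h => he h.2)] at h1
      simpa using h1
  · intro I _ hI
    simp only [Finset.mem_insert, Finset.mem_singleton, not_or] at hI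
    rw [trace_mon ρ hI.1 fun h => hI.2 h.1]
    simp

theorem eps_vol (hm : Even m) : eps (m + 1) = if m % 4 = 0 then 1 else -1 := by
  have hm' : m % 4 = 0 ∨ m % 4 = 2 := by rw [Nat.even_iff] at hm; omega
  rw [eps_eq, ← Nat.div_add_mod m 4, add_assoc, pow_add, pow_mul, Complex.I_pow_four, one_pow]
  rcases hm' with h | h <;> rw [h] <;> simp [pow_succ, Nat.add_mod]

/-- The volume element is central with square one, so its eigenspaces are invariant. -/
theorem exists_vol_eq (h : IrrRep ρ) (hm : m % 4 = 0) :
    ∃ s : ℝ, s * s = 1 ∧ ∀ x, ρ (vol m) x = s • x := by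
  have he : Even m := Nat.even_iff.2 (by omega)
  have hcomm : ∀ a x, ρ a (ρ (vol m) x) = ρ (vol m) (ρ a x) := by
    intro a x
    rw [← Module.End.mul_apply, ← map_mul, vol_central he, map_mul, Module.End.mul_apply]
  have hsq : ∀ x, ρ (vol m) (ρ (vol m) x) = x := by
    intro x
    rw [← Module.End.mul_apply, ← map_mul, vol_sq, eps_vol he, if_pos hm]
    simp
  have hinv : IsInvariant ρ (LinearMap.ker (ρ (vol m) - 1)) := by
    intro a w hw
    rw [LinearMap.mem_ker, LinearMap.sub_apply, Module.End.one_apply, sub_eq_zero] at hw ⊢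
    rw [← hcomm, hw]
  rcases h.2 _ hinv with h | h
  · refine ⟨-1, by norm_num, fun x => ?_⟩
    have : ρ (vol m) x + x ∈ LinearMap.ker (ρ (vol m) - 1) := by
      rw [LinearMap.mem_ker, LinearMap.sub_apply, Module.End.one_apply, map_add, hsq]
      abel
    rw [h, Submodule.mem_bot] at this
    rw [neg_one_smul]
    exact eq_neg_of_add_eq_zero_left this
  · refine ⟨1, by norm_num, fun x => ?_⟩
    have : x ∈ LinearMap.ker (ρ (vol m) - 1) := by rw [h]; trivial
    rw [LinearMap.mem_ker, LinearMap.sub_apply, Module.End.one_apply, sub_eq_zero] at this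
    rw [this, one_smul]

/-- If all averages at `w` vanish, then `d • w + c • vol w = 0` with `d = dim M > 0`. This is absurd
for odd `m`, where the second term is absent; for `m ≡ 2 (mod 4)`, where `vol² = -1` makes `d + c
vol` invertible; and for `m ≡ 0 (mod 4)`, where equal signs of `vol` turn the left side into `2d •
w`. -/
theorem exists_intertwiner [FiniteDimensional ℝ M] [Nontrivial M] {U : Submodule ℝ M'}
    (hU : IsInvariant σ U) {w : M'} (hwU : w ∈ U) (hw : w ≠ 0)
    (hm : Odd m ∨ m % 4 = 2 ∨ m % 4 = 0 ∧ ∃ s : ℝ, (∀ x, ρ (vol m) x = s • x) ∧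
      s * s = 1 ∧ σ (vol m) w = s • w) :
    ∃ T : M →ₗ[ℝ] M', Intertwines ρ σ T ∧ T ≠ 0 ∧ LinearMap.range T ≤ U := by
  by_contra! hcon
  have hz : ∀ φ, average ρ σ φ w = 0 := by
    intro φ
    by_contra h0
    exact hcon _ (average_intertwines φ w) h0 (average_mem hU φ hwU)
  have hd : (0 : ℝ) < Module.finrank ℝ M := by exact_mod_cast Module.finrank_pos
  have key := sum_trace_eq_zero hz
  rcases hm with hm | hm | ⟨hm, s, hs, hss, hsw⟩
  · rw [if_neg (Nat.not_even_iff_odd.2 hm), zero_smul, add_zero] at key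
    exact (smul_ne_zero hd.ne' hw) key
  · have he : Even m := Nat.even_iff.2 (by omega)
    rw [if_pos he] at key
    set d : ℝ := (Module.finrank ℝ M : ℝ)
    set c : ℝ := eps (m + 1) * LinearMap.trace ℝ M (ρ (vol m))
    have hsq : σ (vol m) (σ (vol m) w) = -w := by
      rw [← Module.End.mul_apply, ← map_mul, vol_sq, eps_vol he, if_neg (by omega)]
      simp
    have key2 := congrArg (σ (vol m)) key
    rw [map_add, map_smul, map_smul, hsq, map_zero] at key2
    -- Multiply the relation by `d - c vol`.
    have h3 : (d * d + c * c) • w = 0 := by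
      have h4 : (d * d + c * c) • w = d • (d • w + c • σ (vol m) w) -
          c • (d • σ (vol m) w + c • -w) := by module
      rw [h4, key, key2]
      simp
    exact (smul_ne_zero (add_pos_of_pos_of_nonneg (mul_pos hd hd) (mul_self_nonneg c)).ne' hw) h3
  · have he : Even m := Nat.even_iff.2 (by omega)
    have hρ : ρ (vol m) = s • 1 := LinearMap.ext fun x => by simp [hs]
    rw [if_pos he, eps_vol he, if_pos hm, hρ, hsw, map_smul, LinearMap.trace_one, smul_eq_mul,
      one_mul, smul_smul] at key
    have : s * (Module.finrank ℝ M : ℝ) * s = Module.finrank ℝ M := by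
      rw [mul_right_comm, hss, one_mul]
    rw [this, ← add_smul] at key
    exact (smul_ne_zero (by positivity) hw) key

end Intertwiners

/-! ### Orthogonal decomposition into irreducible subspaces -/

/-- Split off a copy of `ρ` inside `U` and continue in its orthogonal complement, which is invariant
as the generators are symmetric. By `hscale` each embedding can be normalized so that all copies
induce the inner product given by `j₀`. -/
theorem exists_decomposition {m : ℕ} {E M : Type*} [NormedAddCommGroup E] [InnerProductSpace ℝ E]
    [FiniteDimensional ℝ E] [AddCommGroup M] [Module ℝ M] {ρ : Cl m →ₐ[ℝ] Module.End ℝ M}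
    {σ : Cl m →ₐ[ℝ] Module.End ℝ E} (hσ : IsSymmRep σ) {j₀ : M →ₗ[ℝ] E}
    (hscale : ∀ T, Intertwines ρ σ T → ∃ c : ℝ, ∀ x y,
      inner ℝ (T x) (T y) = c * inner ℝ (j₀ x) (j₀ y)) (U : Submodule ℝ E) (hU : IsInvariant σ U)
    (hex : ∀ U' ≤ U, IsInvariant σ U' → U' ≠ ⊥ →
      ∃ T : M →ₗ[ℝ] E, Intertwines ρ σ T ∧ T ≠ 0 ∧ LinearMap.range T ≤ U') :
    ∃ (k : ℕ) (j : Fin k → M →ₗ[ℝ] E), (∀ a, Intertwines ρ σ (j a)) ∧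
      (∀ a b x y, inner ℝ (j a x) (j b y) = if a = b then inner ℝ (j₀ x) (j₀ y) else 0) ∧
      ⨆ a, LinearMap.range (j a) = U := by
  induction hn : Module.finrank ℝ U using Nat.strong_induction_on generalizing U with
  | _ n ih =>
    by_cases hU0 : U = ⊥
    · exact ⟨0, Fin.elim0, fun a => a.elim0, fun a => a.elim0, by simp [hU0]⟩
    obtain ⟨T, hT, hT0, hTU⟩ := hex U le_rfl hU hU0
    obtain ⟨c, hc⟩ := hscale T hT
    obtain ⟨x₀, hx₀⟩ : ∃ x, T x ≠ 0 := by
      by_contra! hc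
      exact hT0 (LinearMap.ext hc)
    have hcpos : 0 < c := by
      have h1 : 0 < inner ℝ (T x₀) (T x₀) := real_inner_self_pos.2 hx₀
      have h2 : 0 ≤ inner ℝ (j₀ x₀) (j₀ x₀) := real_inner_self_nonneg
      rw [hc] at h1
      exact pos_of_mul_pos_left h1 h2
    let T' : M →ₗ[ℝ] E := (Real.sqrt c)⁻¹ • T
    have hT' : Intertwines ρ σ T' := fun a x => by simp [T', hT a x]
    have hT'in : ∀ x y, inner ℝ (T' x) (T' y) = inner ℝ (j₀ x) (j₀ y) := by
      intro x y
      simp only [T', LinearMap.smul_apply, inner_smul_left, inner_smul_right, hc, conj_trivial]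
      rw [← mul_assoc, ← mul_assoc, ← mul_inv, Real.mul_self_sqrt hcpos.le,
        inv_mul_cancel₀ hcpos.ne', one_mul]
    have hR : LinearMap.range T' ≤ U := by
      rintro _ ⟨x, rfl⟩
      exact U.smul_mem _ (hTU ⟨x, rfl⟩)
    let U' := (LinearMap.range T')ᗮ ⊓ U
    have hU'inv : IsInvariant σ U' := fun a w hw =>
      ⟨hσ.orthogonal hT'.isInvariant_range a w hw.1, hU a w hw.2⟩
    have hlt : U' < U := by
      refine lt_of_le_of_ne inf_le_right fun h => ?_
      have h1 : T' x₀ ∈ U' := by rw [h]; exact hR ⟨x₀, rfl⟩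
      have h2 : inner ℝ (T' x₀) (T' x₀) = 0 := (Submodule.mem_orthogonal _ _).1 h1.1 _ ⟨x₀, rfl⟩
      rw [inner_self_eq_zero] at h2
      refine hx₀ ?_
      simpa [T', (Real.sqrt_pos.2 hcpos).ne'] using h2
    obtain ⟨k, j, hj1, hj2, hj3⟩ := ih _ (hn ▸ Submodule.finrank_lt_finrank_of_lt hlt) U' hU'inv
      (fun W hW => hex W (hW.trans hlt.le)) rfl
    have horth : ∀ a x y, inner ℝ (T' x) (j a y) = 0 := by
      intro a x y
      have h1 : j a y ∈ U' := by
        rw [← hj3]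
        exact Submodule.mem_iSup_of_mem a ⟨y, rfl⟩
      exact (Submodule.mem_orthogonal _ _).1 h1.1 _ ⟨x, rfl⟩
    refine ⟨k + 1, Fin.cons T' j, ?_, ?_, ?_⟩
    · intro a
      refine Fin.cases ?_ (fun a => ?_) a
      · exact hT'
      · exact hj1 a
    · intro a b x y
      refine Fin.cases ?_ (fun a => ?_) a <;> refine Fin.cases ?_ (fun b => ?_) b
      · simp [hT'in]
      · simp [horth, (Fin.succ_ne_zero b).symm]
      · rw [real_inner_comm]
        simp [horth]
      · simp [hj2]
    · have h1 : ⨆ a, LinearMap.range ((Fin.cons T' j : Fin (k + 1) → M →ₗ[ℝ] E) a) =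
          LinearMap.range T' ⊔ U' := by
        rw [← hj3]
        refine le_antisymm (iSup_le fun a => ?_) (sup_le ?_ (iSup_le fun a => ?_))
        · refine Fin.cases ?_ (fun a => ?_) a
          · exact le_sup_left
          · exact le_sup_of_le_right (le_iSup (fun a => LinearMap.range (j a)) a)
        · exact le_iSup (fun a => LinearMap.range ((Fin.cons T' j : Fin (k + 1) → M →ₗ[ℝ] E) a)) 0
        · exact le_iSup (fun a => LinearMap.range ((Fin.cons T' j : Fin (k + 1) → M →ₗ[ℝ] E) a)) a.succ
      rw [h1]
      exact Submodule.sup_orthogonal_inf_of_hasOrthogonalProjection hR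

/-! ### The pin group -/

section PinGroup

variable {m n : ℕ}

theorem stdForm_eq_zero {v : Fin (m + 1) → ℝ} (h : stdForm m v = 0) : v = 0 := by
  rw [stdForm_apply, Finset.sum_eq_zero_iff_of_nonneg fun i _ => sq_nonneg _] at h
  ext i
  simpa using h i (Finset.mem_univ i)

theorem ι_mul_ι_self {v : Fin (m + 1) → ℝ} (h : stdForm m v = 1) :
    CliffordAlgebra.ι (stdForm m) v * CliffordAlgebra.ι (stdForm m) v = 1 := by
  rw [CliffordAlgebra.ι_sq_scalar, h, map_one]

/-- A unit vector as a unit of the Clifford algebra. -/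
def unitVec (v : Fin (m + 1) → ℝ) (h : stdForm m v = 1) : (Cl m)ˣ :=
  ⟨CliffordAlgebra.ι (stdForm m) v, CliffordAlgebra.ι (stdForm m) v, ι_mul_ι_self h, ι_mul_ι_self h⟩

theorem unitVec_mem (v : Fin (m + 1) → ℝ) (h : stdForm m v = 1) : unitVec v h ∈ Pin m :=
  Subgroup.subset_closure ⟨v, h, rfl⟩

/-- Unit vectors are their own inverses, so no separate case for inverses is needed. -/
theorem pin_induction {p : ∀ u : (Cl m)ˣ, u ∈ Pin m → Prop} (one : p 1 (Pin m).one_mem)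
    (mul : ∀ v h u (hu : u ∈ Pin m), p u hu →
      p (unitVec v h * u) ((Pin m).mul_mem (unitVec_mem v h) hu))
    {u : (Cl m)ˣ} (hu : u ∈ Pin m) : p u hu := by
  have key : ∀ {u : (Cl m)ˣ} {v : Fin (m + 1) → ℝ} (h : stdForm m v = 1),
      (u : Cl m) = CliffordAlgebra.ι (stdForm m) v → u = unitVec v h :=
    fun h h' => Units.ext h'
  refine Subgroup.closure_induction_left (p := p) one ?_ ?_ hu
  · rintro x ⟨v, h, hx⟩ y hy hp
    obtain rfl := key h hx
    exact mul v h y hy hp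
  · rintro x ⟨v, h, hx⟩ y hy hp
    obtain rfl := key h hx
    exact mul v h y hy hp

/-- Conjugation by a unit vector is minus the reflection in its orthogonal hyperplane. -/
theorem ι_conj (v w : Fin (m + 1) → ℝ) (h : stdForm m v = 1) :
    CliffordAlgebra.ι (stdForm m) v * CliffordAlgebra.ι (stdForm m) w *
      CliffordAlgebra.ι (stdForm m) v =
    CliffordAlgebra.ι (stdForm m) (QuadraticMap.polar (stdForm m) v w • v - w) := by
  have h1 := CliffordAlgebra.ι_mul_ι_add_swap (Q := stdForm m) v w
  rw [← eq_sub_iff_add_eq] at h1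
  rw [h1, sub_mul, mul_assoc, ι_mul_ι_self h, mul_one, map_sub, map_smul, Algebra.smul_def]

theorem pin_conj {u : (Cl m)ˣ} (hu : u ∈ Pin m) (w : Fin (m + 1) → ℝ) :
    ∃ w', (u : Cl m) * CliffordAlgebra.ι (stdForm m) w * ((u⁻¹ : (Cl m)ˣ) : Cl m) =
      CliffordAlgebra.ι (stdForm m) w' := by
  induction hu using pin_induction with
  | one => exact ⟨w, by simp⟩
  | mul v h u _ ih =>
    obtain ⟨w', hw'⟩ := ih
    refine ⟨QuadraticMap.polar (stdForm m) v w' • v - w', ?_⟩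
    rw [← ι_conj v w' h, ← hw', mul_inv_rev]
    change CliffordAlgebra.ι (stdForm m) v * u * _ * (_ * CliffordAlgebra.ι (stdForm m) v) = _
    simp only [mul_assoc]

theorem involute_e (i : Fin (m + 1)) : CliffordAlgebra.involute (e i) = -e i := by
  rw [e, CliffordAlgebra.involute_ι]

theorem pin_involute {u : (Cl m)ˣ} (hu : u ∈ Pin m) :
    CliffordAlgebra.involute (u : Cl m) = u ∨ CliffordAlgebra.involute (u : Cl m) = -u := by
  induction hu using pin_induction with
  | one => left; simp
  | mul v h u _ ih =>
    have : CliffordAlgebra.involute ((unitVec v h * u : (Cl m)ˣ) : Cl m) =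
        -CliffordAlgebra.ι (stdForm m) v * CliffordAlgebra.involute (u : Cl m) := by
      rw [Units.val_mul, map_mul]
      congr 1
      exact CliffordAlgebra.involute_ι v
    rw [this]
    rcases ih with ih | ih <;> rw [ih]
    · right; rw [neg_mul]; rfl
    · left; rw [neg_mul_neg]; rfl

theorem pin_reverse {u : (Cl m)ˣ} (hu : u ∈ Pin m) :
    CliffordAlgebra.reverse (u : Cl m) * u = 1 := by
  induction hu using pin_induction with
  | one => simp
  | mul v h u _ ih =>
    have : ((unitVec v h : (Cl m)ˣ) : Cl m) = CliffordAlgebra.ι (stdForm m) v := rfl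
    rw [Units.val_mul, CliffordAlgebra.reverse.map_mul, this, CliffordAlgebra.reverse_ι, mul_assoc,
      ← mul_assoc (CliffordAlgebra.ι (stdForm m) v), ι_mul_ι_self h, one_mul, ih]

theorem involute_mon (I : Finset (Fin (m + 1))) :
    CliffordAlgebra.involute (mon I) = (-1 : ℝ) ^ I.card • mon I := by
  induction I using Finset.induction_on with
  | empty => simp
  | insert j I hj ih =>
    obtain ⟨s, hs, h⟩ := mon_insert hj
    rw [h, map_smul, map_mul, ih, involute_e, Finset.card_insert_of_notMem hj, pow_succ]
    simp only [neg_mul, mul_smul_comm, smul_neg, mul_neg, mul_one, neg_smul]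
    rw [smul_comm]

theorem reverse_mon (I : Finset (Fin (m + 1))) :
    CliffordAlgebra.reverse (mon I) * mon I = 1 := by
  induction I using Finset.induction_on with
  | empty => simp
  | insert j I hj ih =>
    obtain ⟨s, hs, h⟩ := mon_insert hj
    have hj : CliffordAlgebra.reverse (e j) = e j := CliffordAlgebra.reverse_ι _
    rw [h, map_smul, smul_mul_smul_comm, hs, one_smul, CliffordAlgebra.reverse.map_mul, hj, mul_assoc,
      ← mul_assoc (e j), e_sq, one_mul, ih]

/-- A central element is `a + b vol`, with `b = 0` for odd `m`. For even `m` the volume element is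
odd, while a pin element is even or odd, so one coefficient vanishes. As `reverse u * u = 1`, the
other is `±1`. -/
theorem finite_central_pin : {u : (Cl m)ˣ | u ∈ Pin m ∧ ∀ a : Cl m, a * u = u * a}.Finite := by
  have hfin : ({1, -1, vol m, -vol m} : Set (Cl m)).Finite := by simp
  refine (hfin.preimage (Units.val_injective.injOn (s := Set.univ) |>.mono
    (Set.subset_univ _))).subset ?_
  rintro u ⟨hu, hc⟩
  have hsq : ∀ (a : ℝ) (x : Cl m), CliffordAlgebra.reverse x * x = 1 → (u : Cl m) = a • x →
      (u : Cl m) = x ∨ (u : Cl m) = -x := by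
    intro a x hx hux
    have h1 := pin_reverse hu
    rw [hux, map_smul, smul_mul_smul_comm, hx, ← Algebra.algebraMap_eq_smul_one,
      ← map_one (algebraMap ℝ (Cl m))] at h1
    have h2 := (algebraMap ℝ (Cl m)).injective h1
    rw [hux]
    rcases mul_self_eq_one_iff.1 h2 with h | h <;> rw [h] <;> simp
  have hrev1 : CliffordAlgebra.reverse (1 : Cl m) * 1 = 1 := by simp
  have hmem : (u : Cl m) = 1 ∨ (u : Cl m) = -1 ∨ (u : Cl m) = vol m ∨ (u : Cl m) = -vol m := by
    obtain ⟨⟨a, b, hab⟩, ho⟩ := mem_span_of_central hc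
    rcases Nat.even_or_odd m with he | hodd
    · have hv : CliffordAlgebra.involute (vol m) = -vol m := by
        rw [vol, involute_mon, Finset.card_univ, Fintype.card_fin, he.add_one.neg_one_pow,
          neg_one_smul]
      have h2 := hab
      have h3 : CliffordAlgebra.involute (u : Cl m) = a • 1 - b • vol m := by
        rw [hab, map_add, map_smul, map_smul, map_one, hv, smul_neg, sub_eq_add_neg]
      have hhalf : ∀ x : Cl m, (2 : ℝ) • x = 0 → x = 0 := fun x hx =>
        (smul_eq_zero.1 hx).resolve_left two_ne_zero
      rcases pin_involute hu with h | h
      · have h4 : b • vol m = 0 := hhalf _ (by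
          rw [h3, hab] at h
          have : (2 : ℝ) • b • vol m = (a • 1 + b • vol m) - (a • 1 - b • vol m) := by module
          rw [this, h, sub_self])
        rw [h4, add_zero] at hab
        rcases hsq a 1 hrev1 hab with h | h <;> simp [h]
      · have h4 : a • (1 : Cl m) = 0 := hhalf _ (by
          rw [h3, hab] at h
          have : (2 : ℝ) • a • (1 : Cl m) = (a • 1 - b • vol m) + (a • 1 + b • vol m) := by module
          rw [this, h, neg_add_cancel])
        rw [h4, zero_add] at hab
        rcases hsq b (vol m) (reverse_mon _) hab with h | h <;> simp [h]
    · obtain ⟨a, ha⟩ := ho hodd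
      rcases hsq a 1 hrev1 ha with h | h <;> simp [h]
  simpa using hmem

end PinGroup

/-! ### The orthogonal action of the pin group on `V` -/

namespace CliffordSystem

variable {m n : ℕ} (C : CliffordSystem m n)

theorem rep_ι (v : Fin (m + 1) → ℝ) : C.rep (CliffordAlgebra.ι (stdForm m) v) = C.gen v :=
  CliffordAlgebra.lift_ι_apply ..

theorem gen_apply (v : Fin (m + 1) → ℝ) : C.gen v = ∑ i, v i • C.P i :=
  Fintype.linearCombination_apply ..

theorem rep_e (i : Fin (m + 1)) : C.rep (e i) = C.P i := by
  rw [e, rep_ι, gen, Fintype.linearCombination_apply_single, one_smul]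

theorem gen_symm (v : Fin (m + 1) → ℝ) : (C.gen v).IsSymmetric := by
  intro x y
  rw [gen_apply]
  simp only [LinearMap.sum_apply, LinearMap.smul_apply, sum_inner, inner_sum, inner_smul_left,
    inner_smul_right, conj_trivial]
  exact Finset.sum_congr rfl fun i _ => by rw [C.symm i x y]

theorem isSymmRep : IsSymmRep C.rep := fun i => by rw [rep_e]; exact C.symm i

theorem gen_sq (v : Fin (m + 1) → ℝ) (x : V n) : C.gen v (C.gen v x) = stdForm m v • x := by
  rw [← Module.End.mul_apply, gen_mul_self, Module.algebraMap_end_apply]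

theorem norm_gen {v : Fin (m + 1) → ℝ} (h : stdForm m v = 1) (x : V n) : ‖C.gen v x‖ = ‖x‖ := by
  have : inner ℝ (C.gen v x) (C.gen v x) = inner ℝ x x := by
    rw [C.gen_symm v, C.gen_sq, h, one_smul]
  rw [real_inner_self_eq_norm_sq, real_inner_self_eq_norm_sq] at this
  exact (sq_eq_sq₀ (norm_nonneg _) (norm_nonneg _)).1 this

theorem gen_injective : Function.Injective C.gen := by
  rw [injective_iff_map_eq_zero]
  intro v hv
  refine stdForm_eq_zero ?_
  obtain ⟨x, hx⟩ := exists_ne (0 : V n)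
  have := C.gen_sq v x
  rw [hv] at this
  simpa [hx] using this.symm

theorem norm_rep_pin {u : (Cl m)ˣ} (hu : u ∈ Pin m) (x : V n) : ‖C.rep (u : Cl m) x‖ = ‖x‖ := by
  induction hu using pin_induction with
  | one => simp
  | mul v h u _ ih =>
    have : C.rep ((unitVec v h * u : (Cl m)ˣ) : Cl m) x = C.gen v (C.rep (u : Cl m) x) := by
      rw [← C.rep_ι, ← Module.End.mul_apply, ← map_mul]
      rfl
    rw [this, C.norm_gen h, ih]

/-- The orthogonal transformation given by a norm preserving endomorphism. -/
def _root_.FKM.isoOf (f : Module.End ℝ (V n)) (hf : ∀ x, ‖f x‖ = ‖x‖) : OV n :=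
  (LinearIsometry.mk f hf).toLinearIsometryEquiv rfl

@[simp] theorem _root_.FKM.isoOf_apply (f : Module.End ℝ (V n)) (hf : ∀ x, ‖f x‖ = ‖x‖) (x : V n) :
    isoOf f hf x = f x := rfl

/-- The homomorphism `Pin(m+1) → O(V)`. -/
def pinHom : Pin m →* OV n where
  toFun u := isoOf (C.rep ((u : (Cl m)ˣ) : Cl m)) (C.norm_rep_pin u.2)
  map_one' := by ext1 x; simp
  map_mul' u v := by ext1 x; simp

@[simp] theorem pinHom_apply (u : Pin m) (x : V n) :
    C.pinHom u x = C.rep ((u : (Cl m)ˣ) : Cl m) x := rfl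

theorem range_pinHom {L : Subgroup (Cl m)ˣ} (hL : L ≤ Pin m) :
    (C.pinHom.comp (Subgroup.inclusion hL)).range = C.image L := by
  ext A
  constructor
  · rintro ⟨u, rfl⟩
    exact ⟨u, u.2, fun x => rfl⟩
  · rintro ⟨u, hu, h⟩
    exact ⟨⟨u, hu⟩, by ext1 x; exact (h x).symm⟩

theorem mem_uPlus {U : OV n} :
    U ∈ C.uPlus ↔ Intertwines C.rep C.rep (U.toLinearEquiv : V n →ₗ[ℝ] V n) := by
  constructor
  · intro h
    refine intertwines_of_gen fun i x => ?_
    rw [rep_e]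
    exact (h _ (Submodule.subset_span ⟨i, rfl⟩) x).symm
  · intro h Q hQ x
    induction hQ using Submodule.span_induction with
    | mem Q hQ =>
      obtain ⟨i, rfl⟩ := hQ
      rw [← rep_e]
      exact (h (e i) x).symm
    | zero => simp
    | add Q R _ _ hQ hR => simp [hQ, hR]
    | smul c Q _ hQ => simp [hQ]

/-- Only finitely many elements of the pin group act by endomorphisms that commute with `𝒫`. -/
theorem finite_pin_commutant :
    {u : (Cl m)ˣ | u ∈ Pin m ∧ C.rep (u : Cl m) ∈ commutant C.rep}.Finite := by
  refine finite_central_pin.subset ?_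
  rintro u ⟨hu, hc⟩
  refine ⟨hu, commute_of_gen fun i => ?_⟩
  -- `C.rep` need not be faithful, but it is injective on vectors, and `u * e i * u⁻¹` is a vector.
  -- Commuting in the representation therefore implies commuting in the algebra.
  obtain ⟨w, hw⟩ := pin_conj hu (Pi.single i 1)
  have h1 : (u : Cl m) * e i = CliffordAlgebra.ι (stdForm m) w * u := by
    rw [← hw, mul_assoc, mul_assoc, Units.inv_mul, mul_one]
    rfl
  have h2 : C.rep (u : Cl m) * C.rep (e i) = C.rep (e i) * C.rep (u : Cl m) :=
    LinearMap.ext fun x => hc (e i) x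
  rw [← map_mul, h1, map_mul] at h2
  have h3 : C.rep (CliffordAlgebra.ι (stdForm m) w) = C.rep (e i) := by
    have := congrArg (fun X => X * C.rep ((u⁻¹ : (Cl m)ˣ) : Cl m)) h2
    simpa only [mul_assoc, ← map_mul, Units.mul_inv, map_one, mul_one] using this
  rw [e, rep_ι, rep_ι] at h3
  rw [h1, C.gen_injective h3]
  rfl

end CliffordSystem

/-! ### Scalars acting from the right -/

section RightMul

variable {K : Type} [DivisionRing K] [Algebra ℝ K] {r : ℕ}

/-- Right multiplication of columns by a scalar. -/
def rmul (q : K) : Module.End ℝ (Fin r → K) where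
  toFun v i := v i * q
  map_add' v w := by ext; simp [add_mul]
  map_smul' c v := by ext; simp

@[simp] theorem rmul_apply (q : K) (v : Fin r → K) (i : Fin r) : rmul q v i = v i * q := rfl

theorem rmul_zero : (rmul 0 : Module.End ℝ (Fin r → K)) = 0 := by ext; simp

theorem rmul_injective [Nontrivial (Fin r → K)] {p q : K}
    (h : ∀ v : Fin r → K, rmul p v = rmul q v) : p = q := by
  have : Nonempty (Fin r) := by
    by_contra hc
    rw [not_nonempty_iff] at hc
    exact not_subsingleton (Fin r → K) inferInstance
  obtain ⟨i⟩ := this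
  simpa using congrFun (h fun _ => 1) i

theorem colAct_rmul (A : Matrix (Fin r) (Fin r) K) (q : K) (v : Fin r → K) :
    colAct A (rmul q v) = rmul q (colAct A v) := by
  ext i
  simp [Matrix.mulVec, dotProduct, Finset.sum_mul, mul_assoc]

/-- Right multiplication by conjugates, as a left action. -/
def rmulHom [StarRing K] [StarModule ℝ K] : K →ₐ[ℝ] Module.End ℝ (Fin r → K) :=
  AlgHom.ofLinearMap
    { toFun := fun q => rmul (star q)
      map_add' := fun p q => LinearMap.ext fun v => by ext; simp [mul_add]
      map_smul' := fun c q => LinearMap.ext fun v => by ext; simp }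
    (LinearMap.ext fun v => by ext; simp)
    (fun p q => LinearMap.ext fun v => by ext; simp [mul_assoc])

end RightMul

/-! ### Twisting representations by `α` -/

section Twist

variable {m : ℕ} {M M' : Type*} [AddCommGroup M] [Module ℝ M] [AddCommGroup M'] [Module ℝ M']

/-- The composition of a representation with the automorphism `α`. -/
def twistRep (ρ : Cl m →ₐ[ℝ] Module.End ℝ M) : Cl m →ₐ[ℝ] Module.End ℝ M :=
  ρ.comp CliffordAlgebra.involute

theorem twistRep_apply (ρ : Cl m →ₐ[ℝ] Module.End ℝ M) (a : Cl m) :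
    twistRep ρ a = ρ (CliffordAlgebra.involute a) := rfl

theorem intertwines_twist {ρ : Cl m →ₐ[ℝ] Module.End ℝ M} {σ : Cl m →ₐ[ℝ] Module.End ℝ M'}
    {T : M →ₗ[ℝ] M'} (h : Intertwines (twistRep ρ) σ T) : Intertwines ρ (twistRep σ) T := by
  intro a x
  have := h (CliffordAlgebra.involute a) x
  rwa [twistRep_apply, CliffordAlgebra.involute_involute] at this

theorem intertwines_twist_twist {ρ : Cl m →ₐ[ℝ] Module.End ℝ M} {σ : Cl m →ₐ[ℝ] Module.End ℝ M'}
    {T : M →ₗ[ℝ] M'} : Intertwines (twistRep ρ) (twistRep σ) T ↔ Intertwines ρ σ T := by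
  constructor
  · intro h a x
    have := h (CliffordAlgebra.involute a) x
    rwa [twistRep_apply, twistRep_apply, CliffordAlgebra.involute_involute] at this
  · intro h a x
    exact h _ x

theorem IsSymmRep.twist {E : Type*} [NormedAddCommGroup E] [InnerProductSpace ℝ E]
    {ρ : Cl m →ₐ[ℝ] Module.End ℝ E} (h : IsSymmRep ρ) : IsSymmRep (twistRep ρ) := by
  intro i x y
  rw [twistRep_apply, involute_e, map_neg, LinearMap.neg_apply, LinearMap.neg_apply,
    inner_neg_left, inner_neg_right, h i]

theorem IrrRep.twist {ρ : Cl m →ₐ[ℝ] Module.End ℝ M} (h : IrrRep ρ) : IrrRep (twistRep ρ) := by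
  refine ⟨h.1, fun W hW => h.2 W fun a w hw => ?_⟩
  have := hW (CliffordAlgebra.involute a) w hw
  rwa [twistRep_apply, CliffordAlgebra.involute_involute] at this

variable {K : Type} [Ring K] [Algebra ℝ K] {r : ℕ}

theorem colRep_twist (χ : Cl m →ₐ[ℝ] Matrix (Fin r) (Fin r) K) :
    colRep (twist χ) = twistRep (colRep χ) := rfl

theorem twist_twist (χ : Cl m →ₐ[ℝ] Matrix (Fin r) (Fin r) K) : twist (twist χ) = χ :=
  AlgHom.ext fun a => by simp [twist]

theorem IsIrreducibleRep.twist {χ : Cl m →ₐ[ℝ] Matrix (Fin r) (Fin r) K}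
    (h : IsIrreducibleRep χ) : IsIrreducibleRep (twist χ) :=
  irrRep_colRep.1 (colRep_twist χ ▸ (irrRep_colRep.2 h).twist)

end Twist

/-! ### Invariant inner products on the irreducible representations -/

/-- The embedding `j₀` of the representation `χ` induces an inner product for which conjugation of
scalars is the adjoint; the commutant of `χ` consists of the scalars, and any embedding of `χ` or
of its twist induces a multiple of this inner product. -/
structure ScalarData {m n : ℕ} (C : CliffordSystem m n) {K : Type} [DivisionRing K] [StarRing K]
    [Algebra ℝ K] {r : ℕ} (χ : Cl m →ₐ[ℝ] Matrix (Fin r) (Fin r) K)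
    (j₀ : (Fin r → K) →ₗ[ℝ] V n) : Prop where
  inj : Function.Injective j₀
  adj : ∀ q x y, inner ℝ (j₀ (rmul q x)) (j₀ y) = inner ℝ (j₀ x) (j₀ (rmul (star q) y))
  full : ∀ T, Intertwines (colRep χ) (colRep χ) T → ∃ q, T = rmul q
  scale : ∀ T, Intertwines (colRep χ) C.rep T ∨ Intertwines (colRep (twist χ)) C.rep T →
    ∃ c : ℝ, ∀ x y, inner ℝ (T x) (T y) = c * inner ℝ (j₀ x) (j₀ y)

section ScalarData

variable {m n : ℕ} {C : CliffordSystem m n} {K : Type} [DivisionRing K] [StarRing K]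
    [Algebra ℝ K] {r : ℕ}
    {χ : Cl m →ₐ[ℝ] Matrix (Fin r) (Fin r) K} {j₀ : (Fin r → K) →ₗ[ℝ] V n}

/-- The image of `j₀` is an irreducible subspace of `V` with symmetric generators, so the results on
commutants apply there and are pulled back along `j₀`. Different embeddings induce proportional
inner products because `S* S` is a symmetric element of the commutant. -/
theorem scalarData_of_intertwines [StarModule ℝ K] [FiniteDimensional ℝ K] (hK : IsCommutantField K m) (hχ : IsIrreducibleRep χ)
    (hj : Intertwines (colRep χ) C.rep j₀) (hj0 : j₀ ≠ 0) : ScalarData C χ j₀ := by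
  have hirr := irrRep_colRep.2 hχ
  have hinj : Function.Injective j₀ := hirr.injective hj hj0
  let W := LinearMap.range j₀
  have hW : IsInvariant C.rep W := hj.isInvariant_range
  let f : (Fin r → K) ≃ₗ[ℝ] W := LinearEquiv.ofInjective j₀ hinj
  have hfj : ∀ x, (f x : V n) = j₀ x := fun _ => rfl
  have hf : Intertwines (colRep χ) (subRep C.rep W hW) f.toLinearMap :=
    fun a x => Subtype.ext (hj a x)
  have hfs : Intertwines (subRep C.rep W hW) (colRep χ) f.symm.toLinearMap := by
    intro a x
    apply f.injective
    have := hf a (f.symm x)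
    simp only [LinearEquiv.coe_coe, LinearEquiv.apply_symm_apply] at this ⊢
    exact this.symm
  have hWirr : IrrRep (subRep C.rep W hW) := hirr.of_equiv f hf
  have hWsymm : IsSymmRep (subRep C.rep W hW) := C.isSymmRep.subRep hW
  let l : K →ₐ[ℝ] Module.End ℝ W := ((f.conjAlgEquiv ℝ).toAlgHom).comp rmulHom
  have hl : ∀ q x, l q x = f (rmul (star q) (f.symm x)) := fun _ _ => rfl
  have hlc : ∀ q, l q ∈ commutant (subRep C.rep W hW) := by
    intro q a x
    have h1 : f.symm (subRep C.rep W hW a x) = colAct (χ a) (f.symm x) := hfs a x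
    rw [hl, hl, h1, ← colAct_rmul]
    exact hf a _
  have hfull := (hK W _ hWsymm hWirr).2 l hlc
  refine ⟨hinj, fun q x y => ?_, fun T hT => ?_, fun T hT => ?_⟩
  · have := hfull.adj (star q) (f x) (f y)
    rw [hl, hl, f.symm_apply_apply, f.symm_apply_apply, star_star] at this
    exact this
  · obtain ⟨q, hq⟩ := hfull.full (f.toLinearMap ∘ₗ T ∘ₗ f.symm.toLinearMap) (hf.comp (hT.comp hfs))
    refine ⟨star q, LinearMap.ext fun x => f.injective ?_⟩
    have := LinearMap.congr_fun hq (f x)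
    rw [hl] at this
    simpa using this
  -- An embedding of the twist is an embedding of `χ` into the twist of `V`, whose generators are
  -- again symmetric.
  · obtain ⟨σ, hσ, hTσ⟩ : ∃ σ : Cl m →ₐ[ℝ] Module.End ℝ (V n), IsSymmRep σ ∧
        Intertwines (colRep χ) σ T := by
      rcases hT with hT | hT
      · exact ⟨_, C.isSymmRep, hT⟩
      · exact ⟨_, C.isSymmRep.twist, intertwines_twist hT⟩
    let S : W →ₗ[ℝ] V n := T ∘ₗ f.symm.toLinearMap
    have hS : Intertwines (subRep C.rep W hW) σ S := hTσ.comp hfs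
    obtain ⟨c, hc⟩ := exists_scalar hWirr (T := LinearMap.adjoint S ∘ₗ S)
      (LinearMap.isSymmetric_adjoint_comp_self S) ((adjoint_intertwines hWsymm hσ hS).comp hS)
    refine ⟨c, fun x y => ?_⟩
    have h1 := LinearMap.adjoint_inner_left S (f y) (S (f x))
    have h2 : LinearMap.adjoint S (S (f x)) = c • f x := LinearMap.congr_fun hc (f x)
    have h3 : ∀ x, S (f x) = T x := fun x => by simp [S]
    rw [h2, h3, h3] at h1
    rw [← h1]
    exact (inner_smul_left (j₀ x) (j₀ y) c)

theorem ScalarData.of_twist (h : ScalarData C (twist χ) j₀) : ScalarData C χ j₀ where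
  inj := h.inj
  adj := h.adj
  full T hT := h.full T (intertwines_twist_twist.2 hT)
  scale T hT := h.scale T (by rw [twist_twist]; exact hT.symm)

end ScalarData

/-! ### Orthogonal frames of irreducible copies -/

section Frames

variable {m n : ℕ} {C : CliffordSystem m n} {K : Type} [Ring K] [Algebra ℝ K] {r : ℕ}
  {j₀ : (Fin r → K) →ₗ[ℝ] V n}

/-- A decomposition of `V` into irreducible subspaces indexed by `ι`, isometric up to a common
factor to the representations `ψ a`. -/
structure IsFrame (C : CliffordSystem m n) (j₀ : (Fin r → K) →ₗ[ℝ] V n) {ι : Type} [Fintype ι]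
    (ψ : ι → Cl m →ₐ[ℝ] Matrix (Fin r) (Fin r) K) (T : V n ≃ₗ[ℝ] (ι → Fin r → K)) : Prop where
  map_rep : ∀ a x i, T (C.rep a x) i = colAct (ψ i a) (T x i)
  inner_eq : ∀ x y, inner ℝ x y = ∑ i, inner ℝ (j₀ (T x i)) (j₀ (T y i))

theorem exists_frame (hinj : Function.Injective j₀) {ι : Type} [Fintype ι] [DecidableEq ι]
    (ψ : ι → Cl m →ₐ[ℝ] Matrix (Fin r) (Fin r) K) (j : ι → (Fin r → K) →ₗ[ℝ] V n)
    (h1 : ∀ i, Intertwines (colRep (ψ i)) C.rep (j i))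
    (h2 : ∀ a b x y, inner ℝ (j a x) (j b y) = if a = b then inner ℝ (j₀ x) (j₀ y) else 0)
    (h3 : ⨆ i, LinearMap.range (j i) = ⊤) : ∃ T : V n ≃ₗ[ℝ] (ι → Fin r → K), IsFrame C j₀ ψ T := by
  let S : (ι → Fin r → K) →ₗ[ℝ] V n := ∑ i, j i ∘ₗ LinearMap.proj i
  have hS : ∀ x, S x = ∑ i, j i (x i) := fun x => by simp [S, LinearMap.sum_apply]
  have hin : ∀ x y, inner ℝ (S x) (S y) = ∑ i, inner ℝ (j₀ (x i)) (j₀ (y i)) := by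
    intro x y
    simp only [hS, sum_inner, inner_sum, h2]
    simp
  have hSinj : Function.Injective S := by
    rw [injective_iff_map_eq_zero]
    intro x hx
    have := hin x x
    rw [hx, inner_zero_left, eq_comm, Finset.sum_eq_zero_iff_of_nonneg
      fun i _ => real_inner_self_nonneg] at this
    funext i
    have hi := this i (Finset.mem_univ i)
    rw [inner_self_eq_zero] at hi
    exact hinj (by rw [hi, Pi.zero_apply, map_zero])
  have hSsurj : Function.Surjective S := by
    rw [← LinearMap.range_eq_top, eq_top_iff, ← h3]
    refine iSup_le fun i => ?_
    rintro _ ⟨x, rfl⟩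
    refine ⟨Pi.single i x, ?_⟩
    rw [hS, Finset.sum_eq_single i]
    · simp
    · intro k _ hk
      simp [hk]
    · simp
  let T := (LinearEquiv.ofBijective S ⟨hSinj, hSsurj⟩).symm
  have hST : ∀ x, S (T x) = x := (LinearEquiv.ofBijective S ⟨hSinj, hSsurj⟩).apply_symm_apply
  refine ⟨T, fun a x i => ?_, fun x y => ?_⟩
  · have h4 : T (C.rep a x) = fun i => colAct (ψ i a) (T x i) := by
      apply hSinj
      rw [hST]
      conv_lhs => rw [← hST x, hS, map_sum]
      rw [hS]
      exact Finset.sum_congr rfl fun i _ => (h1 i a _).symm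
    rw [h4]
  · rw [← hin, hST, hST]

end Frames

theorem involute_vol {m : ℕ} (hm : Even m) : CliffordAlgebra.involute (vol m) = -vol m := by
  rw [vol, involute_mon, Finset.card_univ, Fintype.card_fin, hm.add_one.neg_one_pow, neg_one_smul]

section DivisionRing

variable {m : ℕ} {K : Type} [DivisionRing K] [Algebra ℝ K] {r : ℕ}
    {χ : Cl m →ₐ[ℝ] Matrix (Fin r) (Fin r) K}

/-- There are no intertwiners between `χ` and its twist if `m ≡ 0 (mod 4)`. -/
theorem intertwines_twist_eq_zero (hm : m % 4 = 0) (hχ : IsIrreducibleRep χ)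
    {S : Module.End ℝ (Fin r → K)} (hS : Intertwines (colRep χ) (colRep (twist χ)) S ∨
      Intertwines (colRep (twist χ)) (colRep χ) S) : S = 0 := by
  have he : Even m := Nat.even_iff.2 (by omega)
  obtain ⟨s, hss, hs⟩ := exists_vol_eq (irrRep_colRep.2 hχ) hm
  have hst : ∀ x, colRep (twist χ) (vol m) x = (-s) • x := by
    intro x
    rw [colRep_twist, twistRep_apply, involute_vol he, map_neg, LinearMap.neg_apply, hs, neg_smul]
  have hs0 : s ≠ 0 := by rintro rfl; norm_num at hss
  -- The volume element is odd and central, so it acts by opposite signs on `χ` and its twist; every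
  -- value of an intertwiner satisfies this equation.
  have hfin : ∀ y : Fin r → K, s • y = (-s) • y → y = 0 := by
    intro y hy
    have : (2 * s) • y = 0 := by
      have h2 : (2 * s) • y = s • y - (-s) • y := by module
      rw [h2, hy, sub_self]
    exact (smul_eq_zero.1 this).resolve_left (mul_ne_zero two_ne_zero hs0)
  ext1 x
  refine LinearMap.ext fun y => ?_
  have h := hfin (S (LinearMap.single ℝ (fun _ : Fin r => K) x y)) (by
    rcases hS with hS | hS
    · have := hS (vol m) (LinearMap.single ℝ (fun _ : Fin r => K) x y)
      rwa [hs, hst, map_smul] at this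
    · have := hS (vol m) (LinearMap.single ℝ (fun _ : Fin r => K) x y)
      rw [hs, hst, map_smul] at this
      exact this.symm)
  simpa using h

theorem exists_irreducible {n : ℕ} (C : CliffordSystem m n) [StarRing K] [StarModule ℝ K]
    [FiniteDimensional ℝ K] (hK : IsCommutantField K m) :
    ∃ (r : ℕ) (χ : Cl m →ₐ[ℝ] Matrix (Fin r) (Fin r) K), IsIrreducibleRep χ := by
  obtain ⟨U, hU, hirr⟩ := exists_irreducible_sub C.rep
  obtain ⟨l, hl⟩ := (hK U _ (C.isSymmRep.subRep hU) hirr).1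
  exact exists_isIrreducibleRep hirr l hl

end DivisionRing

/-! ### Existence of frames -/

section Decomposition

variable {m n : ℕ} (C : CliffordSystem m n) {K : Type} [DivisionRing K] [StarRing K]
    [Algebra ℝ K] [StarModule ℝ K] [FiniteDimensional ℝ K] {r : ℕ}
    {χ : Cl m →ₐ[ℝ] Matrix (Fin r) (Fin r) K}

theorem exists_isotypic_frame (hm : Odd m ∨ m % 4 = 2) (hK : IsCommutantField K m)
    (hχ : IsIrreducibleRep χ) : ∃ j₀, ScalarData C χ j₀ ∧ ∃ (k : ℕ)
      (T : V n ≃ₗ[ℝ] (Fin k → Fin r → K)), IsFrame C j₀ (fun _ => χ) T := by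
  have := hχ.1
  have hex : ∀ U' : Submodule ℝ (V n), IsInvariant C.rep U' → U' ≠ ⊥ →
      ∃ T : (Fin r → K) →ₗ[ℝ] V n, Intertwines (colRep χ) C.rep T ∧ T ≠ 0 ∧
        LinearMap.range T ≤ U' := by
    intro U' hU' h0
    obtain ⟨w, hw, hw0⟩ := Submodule.exists_mem_ne_zero_of_ne_bot h0
    exact exists_intertwiner hU' hw hw0 (hm.imp_right Or.inl)
  obtain ⟨j₀, hj, hj0, -⟩ := hex ⊤ (fun _ _ _ => trivial) top_ne_bot
  have hS := scalarData_of_intertwines hK hχ hj hj0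
  obtain ⟨k, j, h1, h2, h3⟩ := exists_decomposition C.isSymmRep
    (fun T hT => hS.scale T (Or.inl hT)) ⊤ (fun _ _ _ => trivial) (fun U' _ => hex U')
  exact ⟨j₀, hS, k, exists_frame hS.inj _ j h1 h2 h3⟩

/-- The volume element acts on `V` as a central involution. Its two eigenspaces are invariant and
orthogonal; one is a sum of copies of `χ` and the other of copies of the twist. -/
theorem exists_two_type_frame (hm : m % 4 = 0) (hK : IsCommutantField K m)
    (hχ : IsIrreducibleRep χ) : ∃ j₀, ScalarData C χ j₀ ∧ ∃ (kp kn : ℕ)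
      (T : V n ≃ₗ[ℝ] (Fin kp ⊕ Fin kn → Fin r → K)),
        IsFrame C j₀ (Sum.elim (fun _ => χ) fun _ => twist χ) T := by
  have := hχ.1
  have he : Even m := Nat.even_iff.2 (by omega)
  obtain ⟨s, hss, hs⟩ := exists_vol_eq (irrRep_colRep.2 hχ) hm
  have hst : ∀ x, colRep (twist χ) (vol m) x = (-s) • x := by
    intro x
    rw [colRep_twist, twistRep_apply, involute_vol he, map_neg, LinearMap.neg_apply, hs, neg_smul]
  have hmem : ∀ (t : ℝ) (w : V n), w ∈ LinearMap.ker (C.rep (vol m) - t • 1) ↔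
      C.rep (vol m) w = t • w := by
    intro t w
    rw [LinearMap.mem_ker, LinearMap.sub_apply, LinearMap.smul_apply, Module.End.one_apply,
      sub_eq_zero]
  have hinv : ∀ t : ℝ, IsInvariant C.rep (LinearMap.ker (C.rep (vol m) - t • 1)) := by
    intro t a w hw
    rw [hmem] at hw ⊢
    rw [← Module.End.mul_apply, ← map_mul, ← vol_central he, map_mul, Module.End.mul_apply, hw,
      map_smul]
  have hsq : ∀ w, C.rep (vol m) (C.rep (vol m) w) = w := by
    intro w
    rw [← Module.End.mul_apply, ← map_mul, vol_sq, eps_vol he, if_pos hm]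
    simp
  have hplus : ∀ t : ℝ, t * t = 1 → ∀ w,
      w + t • C.rep (vol m) w ∈ LinearMap.ker (C.rep (vol m) - t • 1) := by
    intro t ht w
    rw [hmem, map_add, map_smul, hsq, smul_add, smul_smul, ht, one_smul, add_comm]
  have hsum : LinearMap.ker (C.rep (vol m) - s • 1) ⊔ LinearMap.ker (C.rep (vol m) - (-s) • 1) = ⊤ := by
    rw [eq_top_iff]
    intro w _
    have hw : w = (1 / 2 : ℝ) • (w + s • C.rep (vol m) w) + (1 / 2 : ℝ) • (w + (-s) • C.rep (vol m) w) := by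
      module
    rw [hw]
    exact Submodule.add_mem_sup (Submodule.smul_mem _ _ (hplus s hss w))
      (Submodule.smul_mem _ _ (hplus (-s) (by rw [neg_mul_neg, hss]) w))
  have hex : ∀ (ψ : Cl m →ₐ[ℝ] Matrix (Fin r) (Fin r) K) (t : ℝ), t * t = 1 →
      (∀ x, colRep ψ (vol m) x = t • x) →
      ∀ U' ≤ LinearMap.ker (C.rep (vol m) - t • 1), IsInvariant C.rep U' → U' ≠ ⊥ →
      ∃ T : (Fin r → K) →ₗ[ℝ] V n, Intertwines (colRep ψ) C.rep T ∧ T ≠ 0 ∧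
        LinearMap.range T ≤ U' := by
    intro ψ t ht htψ U' hle hU' h0
    obtain ⟨w, hw, hw0⟩ := Submodule.exists_mem_ne_zero_of_ne_bot h0
    exact exists_intertwiner hU' hw hw0 (Or.inr (Or.inr ⟨hm, t, htψ, ht, (hmem t w).1 (hle hw)⟩))
  have hsneg : -s * -s = 1 := by rw [neg_mul_neg, hss]
  -- `χ` itself may not occur in `V`; then its twist does and supplies the same data.
  obtain ⟨j₀, hS⟩ : ∃ j₀, ScalarData C χ j₀ := by
    by_cases h0 : LinearMap.ker (C.rep (vol m) - s • 1) = ⊥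
    · have h1 : LinearMap.ker (C.rep (vol m) - (-s) • 1) ≠ ⊥ := by
        intro h1
        rw [h0, h1, bot_sup_eq] at hsum
        exact bot_ne_top hsum
      obtain ⟨j₀, hj, hj0, -⟩ := hex (twist χ) (-s) hsneg hst _ le_rfl (hinv _) h1
      exact ⟨j₀, (scalarData_of_intertwines hK hχ.twist hj hj0).of_twist⟩
    · obtain ⟨j₀, hj, hj0, -⟩ := hex χ s hss hs _ le_rfl (hinv _) h0
      exact ⟨j₀, scalarData_of_intertwines hK hχ hj hj0⟩
  obtain ⟨kp, jp, hp1, hp2, hp3⟩ := exists_decomposition C.isSymmRep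
    (fun T hT => hS.scale T (Or.inl hT)) _ (hinv s) (hex χ s hss hs)
  obtain ⟨kn, jn, hn1, hn2, hn3⟩ := exists_decomposition C.isSymmRep
    (fun T hT => hS.scale T (Or.inr hT)) _ (hinv (-s)) (hex (twist χ) (-s) hsneg hst)
  have horth : ∀ a b x y, inner ℝ (jp a x) (jn b y) = 0 := by
    intro a b x y
    have h1 : jp a x ∈ LinearMap.ker (C.rep (vol m) - s • 1) := by
      rw [← hp3]; exact Submodule.mem_iSup_of_mem a ⟨x, rfl⟩
    have h2 : jn b y ∈ LinearMap.ker (C.rep (vol m) - (-s) • 1) := by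
      rw [← hn3]; exact Submodule.mem_iSup_of_mem b ⟨y, rfl⟩
    rw [hmem] at h1 h2
    -- The volume element is orthogonal and acts with opposite signs on the two vectors, so their
    -- inner product is its own negative.
    have h3 := C.isSymmRep.inner_mon Finset.univ (jp a x) (jn b y)
    change inner ℝ (C.rep (vol m) (jp a x)) (C.rep (vol m) (jn b y)) = _ at h3
    rw [h1, h2, inner_smul_left, inner_smul_right, conj_trivial, ← mul_assoc, mul_neg, hss] at h3
    linarith
  refine ⟨j₀, hS, kp, kn, exists_frame hS.inj _ (Sum.elim jp jn) ?_ ?_ ?_⟩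
  · rintro (i | i)
    · exact hp1 i
    · exact hn1 i
  · rintro (a | a) (b | b) x y
    · simp [hp2]
    · simp [horth]
    · rw [real_inner_comm]; simp [horth]
    · simp [hn2]
  · rw [iSup_sum]
    simp only [Sum.elim_inl, Sum.elim_inr]
    rw [hp3, hn3, hsum]

end Decomposition

/-! ### The equivalence of representations attached to a frame -/

/-- The map `q` identifies the group `B` with the unitary matrices supported on `adm`, the product
being that of matrices acting on columns of right scalars. -/
structure IsUnitaryModel {K : Type} [Ring K] [StarRing K] {ι : Type} [Fintype ι] [DecidableEq ι]
    (adm : ι → ι → Prop) {B : Type} [Group B] (q : B → Matrix ι ι K) : Prop where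
  one : q 1 = 1
  mul : ∀ b b' a c, q (b * b') a c = ∑ d, q b' d c * q b a d
  supp : ∀ b a c, ¬adm a c → q b a c = 0
  unit : ∀ b c d, ∑ a, q b a c * star (q b a d) = if c = d then 1 else 0
  surj : ∀ Q : Matrix ι ι K, (∀ a c, ¬adm a c → Q a c = 0) →
    (∀ c d, ∑ a, Q a c * star (Q a d) = if c = d then 1 else 0) → ∃ b, q b = Q
  inj : Function.Injective q

/-- The blocks of an endomorphism commuting with `𝒫` are intertwiners, so by `hfull` they are right
multiplications, which vanish off `adm`. By `hadj` such a matrix preserves the inner product exactly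
when it is unitary. Thus `B` is isomorphic to `U⁺(𝒫)`, which commutes with the image of `L`. -/
theorem isEquivalentToAction_of_frame {m n : ℕ} {C : CliffordSystem m n} {K : Type}
    [DivisionRing K] [StarRing K] [Algebra ℝ K] {r : ℕ} [Nontrivial (Fin r → K)]
    {j₀ : (Fin r → K) →ₗ[ℝ] V n} (hinj : Function.Injective j₀)
    (hadj : ∀ q x y, inner ℝ (j₀ (rmul q x)) (j₀ y) = inner ℝ (j₀ x) (j₀ (rmul (star q) y)))
    {ι : Type} [Fintype ι] [DecidableEq ι] {ψ : ι → Cl m →ₐ[ℝ] Matrix (Fin r) (Fin r) K}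
    {T : V n ≃ₗ[ℝ] (ι → Fin r → K)} (hT : IsFrame C j₀ ψ T) {adm : ι → ι → Prop}
    (hadm : ∀ a b, adm a b → ψ a = ψ b)
    (hfull : ∀ a b (S : Module.End ℝ (Fin r → K)), Intertwines (colRep (ψ b)) (colRep (ψ a)) S →
      ∃ q, S = rmul q ∧ (¬adm a b → q = 0))
    {B : Type} [Group B] {q : B → Matrix ι ι K} (hq : IsUnitaryModel adm q)
    {L : Subgroup (Cl m)ˣ} (hL : L ≤ Pin m)
    {X : Type} [AddCommGroup X] [Module ℝ X] {act : Cl m → B → (X →ₗ[ℝ] X)}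
    (τ : X ≃ₗ[ℝ] (ι → Fin r → K))
    (hτ : ∀ f b z a, τ (act f b z) a = ∑ d, rmul (q b a d) (colAct (ψ a f) (τ z d))) :
    IsEquivalentToAction C (C.image L ⊔ C.uPlus) L B X act := by
  obtain ⟨hq1, hqmul, hqadm, hqunit, hqsurj, hqinj⟩ := hq
  let R : Matrix ι ι K → Module.End ℝ (ι → Fin r → K) := fun Q =>
    LinearMap.pi fun a => ∑ d, rmul (Q a d) ∘ₗ LinearMap.proj d
  have hR : ∀ Q z a, R Q z a = ∑ d, rmul (Q a d) (z d) := fun Q z a => by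
    simp [R, LinearMap.sum_apply]
  let D : Matrix ι ι K → Module.End ℝ (V n) := fun Q => T.symm.toLinearMap ∘ₗ R Q ∘ₗ T.toLinearMap
  have hD : ∀ Q x a, T (D Q x) a = ∑ d, rmul (Q a d) (T x d) := fun Q x a => by
    simp only [D, LinearMap.comp_apply, LinearEquiv.coe_coe, LinearEquiv.apply_symm_apply, hR]
  -- Moving right multiplications across the inner product with `hadj` collects them into the Gram
  -- matrix of `Q`.
  have hDin : ∀ Q x y, inner ℝ (D Q x) (D Q y) =
      ∑ d, ∑ c, inner ℝ (j₀ (T x d)) (j₀ (rmul (∑ a, Q a c * star (Q a d)) (T y c))) := by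
    intro Q x y
    rw [hT.inner_eq]
    have h1 : ∀ a, inner ℝ (j₀ (T (D Q x) a)) (j₀ (T (D Q y) a)) =
        ∑ d, ∑ c, inner ℝ (j₀ (T x d)) (j₀ (rmul (Q a c * star (Q a d)) (T y c))) := by
      intro a
      rw [hD, hD, map_sum, map_sum, sum_inner]
      refine Finset.sum_congr rfl fun d _ => ?_
      rw [inner_sum]
      refine Finset.sum_congr rfl fun c _ => ?_
      rw [hadj]
      congr 2
      ext i
      simp [mul_assoc]
    rw [Finset.sum_congr rfl fun a _ => h1 a, Finset.sum_comm]
    refine Finset.sum_congr rfl fun d _ => ?_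
    rw [Finset.sum_comm]
    refine Finset.sum_congr rfl fun c _ => ?_
    rw [← inner_sum, ← map_sum]
    congr 2
    ext i
    simp [Finset.mul_sum]
  have hDnorm : ∀ b x, ‖D (q b) x‖ = ‖x‖ := by
    intro b x
    have h1 : inner ℝ (D (q b) x) (D (q b) x) = inner ℝ x x := by
      rw [hDin, hT.inner_eq]
      refine Finset.sum_congr rfl fun d _ => ?_
      rw [Finset.sum_eq_single d]
      · rw [hqunit, if_pos rfl]
        congr 2
        ext i
        simp
      · intro c _ hc
        rw [hqunit, if_neg hc, rmul_zero]
        simp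
      · simp
    rw [real_inner_self_eq_norm_sq, real_inner_self_eq_norm_sq] at h1
    exact (sq_eq_sq₀ (norm_nonneg _) (norm_nonneg _)).1 h1
  let Ψ : B →* OV n :=
    { toFun := fun b => isoOf (D (q b)) (hDnorm b)
      map_one' := by
        ext1 x
        apply T.injective
        ext a i
        rw [isoOf_apply, hD, hq1]
        simp [Matrix.one_apply, Finset.sum_apply]
      map_mul' := fun b b' => by
        ext1 x
        apply T.injective
        ext a i
        change _ = T (D (q b) (D (q b') x)) a i
        rw [isoOf_apply, hD, hD]
        simp only [Finset.sum_apply, rmul_apply, hD, hqmul, Finset.mul_sum, Finset.sum_mul]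
        rw [Finset.sum_comm]
        simp only [mul_assoc] }
  have hΨ : ∀ b x, Ψ b x = D (q b) x := fun _ _ => rfl
  have hTrep : ∀ f Q, (∀ a c, ¬adm a c → Q a c = 0) → ∀ x a,
      T (C.rep f (D Q x)) a = ∑ d, rmul (Q a d) (colAct (ψ a f) (T x d)) := by
    intro f Q hQ x a
    rw [hT.map_rep, hD, map_sum]
    exact Finset.sum_congr rfl fun d _ => colAct_rmul _ _ _
  have hcomm : ∀ f Q, (∀ a c, ¬adm a c → Q a c = 0) → ∀ x,
      C.rep f (D Q x) = D Q (C.rep f x) := by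
    intro f Q hQ x
    apply T.injective
    funext a
    rw [hTrep f Q hQ, hD]
    refine Finset.sum_congr rfl fun d _ => ?_
    by_cases h : adm a d
    · rw [hT.map_rep, hadm a d h]
    · rw [hQ a d h, rmul_zero]
      rfl
  have hΨu : Ψ.range = C.uPlus := by
    ext U
    rw [C.mem_uPlus]
    constructor
    · rintro ⟨b, rfl⟩
      intro f x
      exact (hcomm f (q b) (hqadm b) x).symm
    · intro hU
      have hSe : ∀ a c, ∃ p : K, (∀ v, T (U (T.symm (Pi.single c v))) a = rmul p v) ∧
          (¬adm a c → p = 0) := by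
        intro a c
        let S : Module.End ℝ (Fin r → K) := LinearMap.proj a ∘ₗ T.toLinearMap ∘ₗ
          (U.toLinearEquiv : V n →ₗ[ℝ] V n) ∘ₗ T.symm.toLinearMap ∘ₗ
            LinearMap.single ℝ (fun _ => Fin r → K) c
        have hS : Intertwines (colRep (ψ c)) (colRep (ψ a)) S := by
          intro f v
          change T (U (T.symm (Pi.single c (colAct (ψ c f) v)))) a =
            colAct (ψ a f) (T (U (T.symm (Pi.single c v))) a)
          rw [← hT.map_rep]
          have h1 : C.rep f (U (T.symm (Pi.single c v))) = U (C.rep f (T.symm (Pi.single c v))) :=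
            (hU f _).symm
          have h2 : T.symm (Pi.single c (colAct (ψ c f) v)) =
              C.rep f (T.symm (Pi.single c v)) := by
            apply T.injective
            rw [LinearEquiv.apply_symm_apply]
            funext d
            rw [hT.map_rep, LinearEquiv.apply_symm_apply]
            by_cases hd : d = c
            · subst hd; simp
            · simp [hd]
          rw [h1, h2]
        obtain ⟨p, hp, hp0⟩ := hfull a c S hS
        exact ⟨p, fun v => LinearMap.congr_fun hp v, hp0⟩
      obtain ⟨Q, hQ1, hQ2⟩ : ∃ Q : Matrix ι ι K,
          (∀ a c v, T (U (T.symm (Pi.single c v))) a = rmul (Q a c) v) ∧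
          ∀ a c, ¬adm a c → Q a c = 0 := by
        choose Q hQ1 hQ2 using hSe
        exact ⟨Matrix.of Q, hQ1, hQ2⟩
      have hUD : ∀ x, U x = D Q x := by
        intro x
        apply T.injective
        funext a
        rw [hD]
        have hx : x = ∑ d, T.symm (Pi.single d (T x d)) := by
          apply T.injective
          rw [map_sum]
          simp only [LinearEquiv.apply_symm_apply]
          exact (Finset.univ_sum_single (T x)).symm
        conv_lhs => rw [hx]
        rw [map_sum, map_sum, Finset.sum_apply]
        exact Finset.sum_congr rfl fun d _ => hQ1 a d _
      obtain ⟨b, hb⟩ := hqsurj Q hQ2 (by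
        intro c d
        -- Testing orthogonality of `U` on vectors in two single blocks isolates one entry of the
        -- Gram matrix.
        have hin : ∀ v w : Fin r → K, inner ℝ (j₀ v)
            (j₀ (rmul (∑ a, Q a c * star (Q a d)) w - rmul (if c = d then 1 else 0) w)) = 0 := by
          intro v w
          have h1 : inner ℝ (U (T.symm (Pi.single d v))) (U (T.symm (Pi.single c w))) =
              inner ℝ (T.symm (Pi.single d v)) (T.symm (Pi.single c w)) := U.inner_map_map _ _
          rw [hUD, hUD, hDin, hT.inner_eq] at h1
          simp only [LinearEquiv.apply_symm_apply] at h1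
          have h5 : ∑ x, inner ℝ (j₀ ((Pi.single d v : ι → Fin r → K) x))
              (j₀ ((Pi.single c w : ι → Fin r → K) x)) =
              inner ℝ (j₀ v) (j₀ (rmul (if c = d then 1 else 0) w)) := by
            rw [Finset.sum_eq_single d (fun a _ ha => by simp [ha]) (by simp), Pi.single_eq_same]
            congr 2
            by_cases hcd : c = d
            · subst hcd
              ext i
              simp
            · rw [if_neg hcd, rmul_zero]
              simp [Ne.symm hcd]
          rw [h5, Finset.sum_eq_single d, Finset.sum_eq_single c] at h1
          · simp only [Pi.single_eq_same] at h1
            rw [map_sub, inner_sub_right, h1, sub_self]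
          · intro a _ ha
            simp [ha]
          · simp
          · intro a _ ha
            simp [ha]
          · simp
        refine rmul_injective (r := r) fun w => ?_
        have h2 := inner_self_eq_zero.1 (hin (rmul (∑ a, Q a c * star (Q a d)) w -
          rmul (if c = d then 1 else 0) w) w)
        exact sub_eq_zero.1 (hinj (h2.trans (map_zero _).symm)))
      refine ⟨b, ?_⟩
      ext1 x
      rw [hΨ, hb, hUD]
  have hΨinj : Function.Injective Ψ := by
    intro b b' h
    apply hqinj
    ext a c
    refine rmul_injective (r := r) fun v => ?_
    have h1 : D (q b) (T.symm (Pi.single c v)) = D (q b') (T.symm (Pi.single c v)) := by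
      rw [← hΨ, ← hΨ, h]
    have h2 := congrFun (congrArg T h1) a
    rw [hD, hD, LinearEquiv.apply_symm_apply, Finset.sum_eq_single c, Finset.sum_eq_single c] at h2
    · simpa using h2
    · intro d _ hd; simp [hd]
    · simp
    · intro d _ hd; simp [hd]
    · simp
  have hcomm2 : ∀ (f : L) (b : B), Commute ((C.pinHom.comp (Subgroup.inclusion hL)) f) (Ψ b) := by
    intro f b
    ext1 x
    exact hcomm _ (q b) (hqadm b) x
  refine ⟨MonoidHom.noncommCoprod _ Ψ hcomm2, ?_, ?_, ?_, ?_, T.trans τ.symm, ?_⟩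
  · rw [MonoidHom.noncommCoprod_range, C.range_pinHom hL, hΨu]
  · have hfin := C.finite_pin_commutant
    -- If `(f, b)` is in the kernel, `f` acts as an element of `U⁺(𝒫)`, which leaves finitely many
    -- `f`; each determines `b`, since `Ψ` is injective.
    have hmap : Set.MapsTo (fun p : L × B => ((p.1 : (Cl m)ˣ)))
        ((MonoidHom.noncommCoprod _ Ψ hcomm2).ker : Set (L × B))
        {u : (Cl m)ˣ | u ∈ Pin m ∧ C.rep (u : Cl m) ∈ commutant C.rep} := by
      rintro ⟨f, b⟩ hp
      refine ⟨hL f.2, ?_⟩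
      have h1 : (C.pinHom (Subgroup.inclusion hL f)) * Ψ b = 1 := hp
      have h2 : C.pinHom (Subgroup.inclusion hL f) = Ψ b⁻¹ := by
        rw [map_inv]; exact eq_inv_of_mul_eq_one_left h1
      have h3 : C.pinHom (Subgroup.inclusion hL f) ∈ C.uPlus := by
        rw [h2, ← hΨu]
        exact ⟨_, rfl⟩
      exact C.mem_uPlus.1 h3
    refine Set.Finite.of_injOn hmap ?_ hfin
    rintro ⟨f, b⟩ hp ⟨f', b'⟩ hp' h
    have hf : f = f' := Subtype.ext h
    subst hf
    have h1 : (C.pinHom (Subgroup.inclusion hL f)) * Ψ b = 1 := hp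
    have h2 : (C.pinHom (Subgroup.inclusion hL f)) * Ψ b' = 1 := hp'
    rw [hΨinj (mul_left_cancel (h1.trans h2.symm))]
  · intro f x
    simp
  · rw [MonoidHom.noncommCoprod_comp_inr, hΨu]
  · intro f b x
    apply τ.injective
    funext a
    rw [hτ]
    simp only [LinearEquiv.trans_apply, LinearEquiv.apply_symm_apply]
    exact hTrep _ _ (hqadm b) x a

/-- The pairs `(M, b)` of an `r × r` matrix and `b ∈ B` act on `X` as on `k` copies of `K^r`, on
which `B` is the group of unitary matrices of right multiplications. -/
def IsColumnModel {K : Type} [DivisionRing K] [StarRing K] [Algebra ℝ K] {r : ℕ} {B X : Type} [Group B] [AddCommGroup X] [Module ℝ X]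
    (act : Matrix (Fin r) (Fin r) K → B → (X →ₗ[ℝ] X)) (k : ℕ) : Prop :=
  ∃ (q : B → Matrix (Fin k) (Fin k) K) (τ : X ≃ₗ[ℝ] (Fin k → Fin r → K)),
    IsUnitaryModel (fun _ _ => True) q ∧
      ∀ M b z a, τ (act M b z) a = ∑ d, rmul (q b a d) (colAct M (τ z d))

theorem IsUnitaryModel.sum {K : Type} [Ring K] [StarRing K] {ι κ : Type} [Fintype ι] [DecidableEq ι] [Fintype κ] [DecidableEq κ]
    {B₁ B₂ : Type} [Group B₁] [Group B₂] {q₁ : B₁ → Matrix ι ι K} {q₂ : B₂ → Matrix κ κ K}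
    (h₁ : IsUnitaryModel (fun _ _ => True) q₁) (h₂ : IsUnitaryModel (fun _ _ => True) q₂) :
    IsUnitaryModel (fun a c : ι ⊕ κ => a.isLeft = c.isLeft)
      (fun b : B₁ × B₂ => Matrix.fromBlocks (q₁ b.1) 0 0 (q₂ b.2)) where
  one := by rw [Prod.fst_one, Prod.snd_one, h₁.one, h₂.one, Matrix.fromBlocks_one]
  mul := by
    rintro b b' (a | a) (c | c) <;> simp [h₁.mul, h₂.mul]
  supp := by
    rintro b (a | a) (c | c) h <;> simp_all
  unit := by
    rintro b (c | c) (d | d) <;> simp [h₁.unit, h₂.unit]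
  surj := by
    intro Q hQ hu
    have h10 : ∀ a c, Q (.inr a) (.inl c) = 0 := fun a c => hQ _ _ (by simp)
    have h01 : ∀ a c, Q (.inl a) (.inr c) = 0 := fun a c => hQ _ _ (by simp)
    obtain ⟨b₁, hb₁⟩ := h₁.surj Q.toBlocks₁₁ (by simp) (fun c d => by
      have := hu (.inl c) (.inl d)
      simpa [h10, Matrix.toBlocks₁₁] using this)
    obtain ⟨b₂, hb₂⟩ := h₂.surj Q.toBlocks₂₂ (by simp) (fun c d => by
      have := hu (.inr c) (.inr d)
      simpa [h01, Matrix.toBlocks₂₂] using this)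
    refine ⟨(b₁, b₂), ?_⟩
    ext (a | a) (c | c)
    · simp [hb₁]; rfl
    · simp [hQ]
    · simp [hQ]
    · simp [hb₂]; rfl
  inj := by
    rintro ⟨a, b⟩ ⟨a', b'⟩ h
    have h := Matrix.fromBlocks_inj.1 h
    exact Prod.ext (h₁.inj h.1) (h₂.inj h.2.2.2)

/-! ### Tensor products as spaces of columns -/

theorem isColumnModel_unitaryGroup {K : Type} [Field K] [StarRing K] [Algebra ℝ K] (r k : ℕ) :
    IsColumnModel (fun (M : Matrix (Fin r) (Fin r) K) (U : Matrix.unitaryGroup (Fin k) K) =>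
      tensorAct M U.1) k := by
  refine ⟨fun U => U.1, (TensorProduct.piScalarRight K K (Fin r → K) (Fin k)).restrictScalars ℝ,
    ⟨rfl, ?_, ?_, ?_, ?_, Subtype.val_injective⟩, ?_⟩
  · intro b b' a c
    simp [Matrix.mul_apply, mul_comm]
  · simp
  · intro b c d
    have h := congrFun (congrFun (Matrix.UnitaryGroup.star_mul_self b) d) c
    rw [Matrix.mul_apply, Matrix.one_apply] at h
    simpa [Matrix.star_apply, mul_comm, eq_comm] using h
  · intro Q _ h
    refine ⟨⟨Q, Matrix.mem_unitaryGroup_iff'.2 ?_⟩, rfl⟩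
    ext c d
    rw [Matrix.mul_apply, Matrix.one_apply]
    have := h d c
    simpa [Matrix.star_apply, mul_comm, eq_comm] using this
  · intro M U z a
    ext i
    induction z with
    | zero => simp
    | add x y hx hy => simp only [map_add, Pi.add_apply, hx, hy, Finset.sum_add_distrib]
    | tmul v w =>
      simp only [tensorAct, LinearMap.coe_restrictScalars, TensorProduct.map_tmul,
        LinearEquiv.restrictScalars_apply, TensorProduct.piScalarRight_apply,
        TensorProduct.piScalarRightHom_tmul, Matrix.mulVecLin_apply, Matrix.mulVec, dotProduct,
        Pi.smul_apply, smul_eq_mul, Finset.sum_apply, rmul_apply, colAct_apply, Finset.sum_mul,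
        Finset.mul_sum]
      rw [Finset.sum_comm]
      refine Finset.sum_congr rfl fun c _ => Finset.sum_congr rfl fun j _ => ?_
      ring

/-- The map `v ⊗ w ↦ (v * star (w a))_a`. -/
def quatTensorHom (r k : ℕ) : QuatTensor r k →ₗ[ℝ] (Fin k → Fin r → ℍ[ℝ]) :=
  (quatRel r k).liftQ (TensorProduct.lift (LinearMap.mk₂ ℝ
      (fun (v : Fin r → ℍ[ℝ]) (w : Fin k → ℍ[ℝ]) a i => v i * star (w a))
      (fun _ _ _ => by ext1 a; ext1 i; simp [add_mul]) (fun _ _ _ => by ext1 a; ext1 i; simp)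
      (fun _ _ _ => by ext1 a; ext1 i; simp [mul_add]) (fun _ _ _ => by ext1 a; ext1 i; simp)))
    (Submodule.span_le.2 (by
      rintro _ ⟨v, w, q, rfl⟩
      rw [SetLike.mem_coe, LinearMap.mem_ker, map_sub, sub_eq_zero]
      ext1 a; ext1 i
      simp [mul_assoc]))

theorem quatTensorHom_mk (r k : ℕ) (v : Fin r → ℍ[ℝ]) (w : Fin k → ℍ[ℝ]) :
    quatTensorHom r k (Submodule.Quotient.mk (v ⊗ₜ w)) = fun a i => v i * star (w a) := rfl

/-- The map `x ↦ ∑ a, x a ⊗ e_a`. -/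
def quatTensorInv (r k : ℕ) : (Fin k → Fin r → ℍ[ℝ]) →ₗ[ℝ] QuatTensor r k :=
  ∑ a, (quatRel r k).mkQ ∘ₗ
    (TensorProduct.mk ℝ (Fin r → ℍ[ℝ]) (Fin k → ℍ[ℝ])).flip (Pi.single a 1) ∘ₗ LinearMap.proj a

theorem quatTensorInv_apply (r k : ℕ) (x : Fin k → Fin r → ℍ[ℝ]) : quatTensorInv r k x =
    ∑ a, (Submodule.Quotient.mk (x a ⊗ₜ Pi.single a 1) : QuatTensor r k) := by
  simp [quatTensorInv, LinearMap.sum_apply]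

/-- The isomorphism of `ℍ^r ⊗_ℍ ℍ^k` with `k` copies of `ℍ^r`. -/
def quatTensorEquiv (r k : ℕ) : QuatTensor r k ≃ₗ[ℝ] (Fin k → Fin r → ℍ[ℝ]) :=
  LinearEquiv.ofLinearMap (quatTensorHom r k) (quatTensorInv r k)
    (by
      refine LinearMap.ext fun x => ?_
      ext1 a; ext1 i
      rw [LinearMap.comp_apply, quatTensorInv_apply, map_sum, Finset.sum_apply, Finset.sum_apply,
        Finset.sum_eq_single a]
      · simp [quatTensorHom_mk]
      · intro c _ hc
        simp [quatTensorHom_mk, Pi.single_eq_of_ne hc.symm]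
      · simp)
    (by
      refine LinearMap.ext fun z => ?_
      obtain ⟨z, rfl⟩ := Submodule.Quotient.mk_surjective _ z
      rw [LinearMap.comp_apply, LinearMap.id_apply]
      induction z with
      | zero => simp
      | add x y hx hy => rw [Submodule.Quotient.mk_add, map_add, map_add, hx, hy]
      | tmul v w =>
        rw [quatTensorHom_mk, quatTensorInv_apply]
        have h1 : ∀ a, (Submodule.Quotient.mk ((fun i => v i * star (w a)) ⊗ₜ Pi.single a 1) :
            QuatTensor r k) = Submodule.Quotient.mk (v ⊗ₜ Pi.single a (w a)) := by
          intro a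
          rw [Submodule.Quotient.eq]
          refine Submodule.subset_span ⟨v, Pi.single a 1, star (w a), ?_⟩
          congr 2
          ext1 j
          by_cases hj : j = a
          · subst hj; simp
          · simp [hj]
        rw [Finset.sum_congr rfl fun a _ => h1 a]
        change ∑ a, (quatRel r k).mkQ (v ⊗ₜ Pi.single a (w a)) = (quatRel r k).mkQ (v ⊗ₜ w)
        rw [← map_sum, ← TensorProduct.tmul_sum, Finset.univ_sum_single])

theorem quatTensorEquiv_mk (r k : ℕ) (v : Fin r → ℍ[ℝ]) (w : Fin k → ℍ[ℝ]) (a : Fin k)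
    (i : Fin r) :
    quatTensorEquiv r k (Submodule.Quotient.mk (v ⊗ₜ w)) a i = v i * star (w a) := rfl

theorem isColumnModel_sp (r k : ℕ) :
    IsColumnModel (fun (M : Matrix (Fin r) (Fin r) ℍ[ℝ]) (U : Sp k) => quatTensorAct M U.1) k := by
  -- The entries are conjugated because `v ⊗ w` corresponds to the columns `v * star (w a)`, and
  -- `star` carries the left factor `U a c` of `w c` to the right.
  refine ⟨fun U => U.1.map star, quatTensorEquiv r k, ⟨?_, ?_, ?_, ?_, ?_, ?_⟩, ?_⟩
  · simp
  · intro b b' a c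
    simp [Matrix.mul_apply]
  · simp
  · intro b c d
    have h0 : star b.1 * b.1 = 1 := Unitary.star_mul_self_of_mem b.2
    have h := congrFun (congrFun h0 c) d
    rw [Matrix.mul_apply, Matrix.one_apply] at h
    simpa [Matrix.star_apply] using h
  · intro Q _ h
    have h1 : star (Q.map star) * Q.map star = 1 := by
      ext1 c d
      rw [Matrix.mul_apply, Matrix.one_apply, ← h c d]
      simp [Matrix.star_apply]
    refine ⟨⟨Q.map star, Unitary.mem_iff.2 ⟨h1, mul_eq_one_comm.1 h1⟩⟩, ?_⟩
    ext1 a c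
    simp
  · intro U U' h
    apply Subtype.ext
    ext1 a c
    have := congrFun (congrFun h a) c
    simpa using this
  · intro M U z a
    ext1 i
    obtain ⟨z, rfl⟩ := Submodule.Quotient.mk_surjective _ z
    change quatTensorEquiv r k (Submodule.Quotient.mk (TensorProduct.map (colAct M) (colAct U.1) z)) a i = _
    induction z with
    | zero => simp
    | add x y hx hy =>
      simp only [map_add, Submodule.Quotient.mk_add, Pi.add_apply, hx, hy, Finset.sum_add_distrib]
    | tmul v w =>
      have h1 : ∀ c, quatTensorEquiv r k (Submodule.Quotient.mk (v ⊗ₜ w)) c =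
          rmul (star (w c)) v := fun c => rfl
      rw [TensorProduct.map_tmul, quatTensorEquiv_mk, Finset.sum_apply]
      simp only [h1, colAct_rmul, rmul_apply, Matrix.map_apply]
      simp [Matrix.mulVec, dotProduct, Finset.mul_sum, mul_assoc]

/-! ### The tensor product descriptions -/

section Equivalence

variable {m n : ℕ} (C : CliffordSystem m n) {K : Type} [DivisionRing K] [StarRing K]
    [Algebra ℝ K] [StarModule ℝ K] [FiniteDimensional ℝ K] {r : ℕ}
    {χ : Cl m →ₐ[ℝ] Matrix (Fin r) (Fin r) K}

theorem exists_isotypic_equivalence (hm : Odd m ∨ m % 4 = 2) (hK : IsCommutantField K m)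
    (hχ : IsIrreducibleRep χ) {L : Subgroup (Cl m)ˣ} (hL : L ≤ Pin m) {B X : ℕ → Type}
    [∀ k, Group (B k)] [∀ k, AddCommGroup (X k)] [∀ k, Module ℝ (X k)]
    {act : ∀ k, Matrix (Fin r) (Fin r) K → B k → (X k →ₗ[ℝ] X k)}
    (hact : ∀ k, IsColumnModel (act k) k) :
    ∃ k, IsSumOf C χ k ∧
      IsEquivalentToAction C (C.image L ⊔ C.uPlus) L (B k) (X k) (fun f b => act k (χ f) b) := by
  have := hχ.1
  obtain ⟨j₀, hS, k, T, hT⟩ := exists_isotypic_frame C hm hK hχ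
  obtain ⟨q, τ, hq, hτ⟩ := hact k
  refine ⟨k, ⟨T, hT.map_rep⟩, isEquivalentToAction_of_frame hS.inj hS.adj hT
    (fun _ _ _ => rfl) (fun _ _ S hc => ?_) hq hL τ (fun f b z a => hτ _ b z a)⟩
  obtain ⟨p, hp⟩ := hS.full S hc
  exact ⟨p, hp, fun h => absurd trivial h⟩

theorem exists_two_type_equivalence (hm : m % 4 = 0) (hK : IsCommutantField K m)
    (hχ : IsIrreducibleRep χ) {L : Subgroup (Cl m)ˣ} (hL : L ≤ Pin m) {B X : ℕ → Type}
    [∀ k, Group (B k)] [∀ k, AddCommGroup (X k)] [∀ k, Module ℝ (X k)]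
    {act : ∀ k, Matrix (Fin r) (Fin r) K → B k → (X k →ₗ[ℝ] X k)}
    (hact : ∀ k, IsColumnModel (act k) k) :
    ∃ kp kn, IsSumOf₂ C χ (twist χ) kp kn ∧
      IsEquivalentToAction C (C.image L ⊔ C.uPlus) L (B kp × B kn) (X kp × X kn)
        (fun f b => (act kp (χ f) b.1).prodMap (act kn (twist χ f) b.2)) := by
  have := hχ.1
  obtain ⟨j₀, hS, kp, kn, T, hT⟩ := exists_two_type_frame C hm hK hχ
  obtain ⟨q₁, τ₁, hq₁, hτ₁⟩ := hact kp
  obtain ⟨q₂, τ₂, hq₂, hτ₂⟩ := hact kn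
  let e := LinearEquiv.sumArrowLequivProdArrow (Fin kp) (Fin kn) ℝ (Fin r → K)
  refine ⟨kp, kn, ⟨T.trans e, fun a x => ⟨fun i => hT.map_rep a x _, fun i => hT.map_rep a x _⟩⟩,
    isEquivalentToAction_of_frame hS.inj hS.adj hT ?_ ?_ (hq₁.sum hq₂) hL
      ((τ₁.prodCongr τ₂).trans e.symm) ?_⟩
  · rintro (a | a) (b | b) h <;> simp_all
  · have hz : ∀ S : Module.End ℝ (Fin r → K), S = 0 → ∀ P : Prop, ∃ q : K, S = rmul q ∧
        (P → q = 0) := fun S hS P => ⟨0, by rw [hS, rmul_zero], fun _ => rfl⟩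
    rintro (a | a) (b | b) S hc
    · obtain ⟨p, hp⟩ := hS.full S hc
      exact ⟨p, hp, fun h => absurd rfl h⟩
    · exact hz S (intertwines_twist_eq_zero hm hχ (Or.inr hc)) _
    · exact hz S (intertwines_twist_eq_zero hm hχ (Or.inl hc)) _
    · obtain ⟨p, hp⟩ := hS.full S (intertwines_twist_twist.1 hc)
      exact ⟨p, hp, fun h => absurd rfl h⟩
  · rintro f b ⟨z₁, z₂⟩ (a | a)
    · rw [Fintype.sum_sum_type]
      simp only [Matrix.fromBlocks_apply₁₁, Matrix.fromBlocks_apply₁₂, Matrix.zero_apply, rmul_zero,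
        LinearMap.zero_apply, Finset.sum_const_zero, add_zero]
      exact hτ₁ _ b.1 z₁ a
    · rw [Fintype.sum_sum_type]
      simp only [Matrix.fromBlocks_apply₂₁, Matrix.fromBlocks_apply₂₂, Matrix.zero_apply, rmul_zero,
        LinearMap.zero_apply, Finset.sum_const_zero, zero_add]
      exact hτ₂ _ b.2 z₂ a

end Equivalence

instance : StarModule ℝ ℍ[ℝ] := ⟨fun c q => by rw [Quaternion.star_smul, star_trivial c]⟩

theorem spin_le_pin (m : ℕ) : Spin m ≤ Pin m := inf_le_left

namespace CliffordSystem

variable {m n : ℕ} (C : CliffordSystem m n)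

/-! ### The quadratic map defined by a Clifford system -/

/-- The quadratic map `x ↦ (⟨P_i x, x⟩)_i`. -/
def quadMap (x : V n) : Fin (m + 1) → ℝ := fun i => inner ℝ (C.P i x) x

theorem cartanMunzner_eq (x : V n) :
    C.cartanMunzner x = inner ℝ x x ^ 2 - 2 * stdForm m (C.quadMap x) := by
  rw [stdForm_apply]
  rfl

theorem inner_gen (v : Fin (m + 1) → ℝ) (x y : V n) :
    inner ℝ (C.gen v x) y = ∑ i, v i * inner ℝ (C.P i x) y := by
  rw [gen_apply]
  simp [LinearMap.sum_apply, sum_inner, inner_smul_left]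

theorem inner_gen_self (v : Fin (m + 1) → ℝ) (x : V n) :
    inner ℝ (C.gen v x) x = ∑ i, v i * C.quadMap x i := C.inner_gen v x x

theorem gen_single (i : Fin (m + 1)) : C.gen (Pi.single i 1) = C.P i := by
  rw [gen, Fintype.linearCombination_apply_single, one_smul]

theorem inner_gen_gen (v : Fin (m + 1) → ℝ) (x y : V n) :
    inner ℝ (C.gen v x) (C.gen v y) = stdForm m v * inner ℝ x y := by
  rw [C.gen_symm v, C.gen_sq, inner_smul_right]

theorem inner_gen_quadMap (x : V n) :
    inner ℝ (C.gen (C.quadMap x) x) x = stdForm m (C.quadMap x) := by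
  rw [inner_gen_self, stdForm_apply]
  exact Finset.sum_congr rfl fun i _ => (pow_two _).symm

theorem stdForm_nonneg (v : Fin (m + 1) → ℝ) : 0 ≤ stdForm m v := by
  rw [stdForm_apply]
  positivity

/-- With `s = |q(x)|²`, the vector `gen (q x) x - s x` has squared norm `s - s²`. In the case `s =
1` it vanishes, which is `gen_quadMap`. -/
theorem stdForm_quadMap_le {x : V n} (hx : ‖x‖ = 1) : stdForm m (C.quadMap x) ≤ 1 := by
  have h1 : inner ℝ x x = (1 : ℝ) := by rw [real_inner_self_eq_norm_sq, hx, one_pow]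
  have h2 := real_inner_self_nonneg (x := C.gen (C.quadMap x) x - stdForm m (C.quadMap x) • x)
  have h4 : inner ℝ x (C.gen (C.quadMap x) x) = stdForm m (C.quadMap x) := by
    rw [real_inner_comm, inner_gen_quadMap]
  rw [inner_sub_left, inner_sub_right, inner_sub_right, inner_gen_gen, inner_smul_left,
    inner_smul_left, inner_smul_right, inner_smul_right, h4, inner_gen_quadMap,
    h1, conj_trivial] at h2
  have h3 := stdForm_nonneg (C.quadMap x)
  nlinarith

theorem gen_quadMap {x : V n} (hx : ‖x‖ = 1) (h : stdForm m (C.quadMap x) = 1) :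
    C.gen (C.quadMap x) x = x := by
  have h1 : inner ℝ x x = (1 : ℝ) := by rw [real_inner_self_eq_norm_sq, hx, one_pow]
  have h4 : inner ℝ x (C.gen (C.quadMap x) x) = 1 := by
    rw [real_inner_comm, inner_gen_quadMap, h]
  rw [← sub_eq_zero, ← inner_self_eq_zero (𝕜 := ℝ), inner_sub_left, inner_sub_right,
    inner_sub_right, inner_gen_gen, h4, inner_gen_quadMap, h, h1]
  norm_num

/-- `⟨v, q(x)⟩ = 1` with `|v| = 1` and `|q(x)| ≤ 1` is the equality case of Cauchy–Schwarz. Together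
with `gen_quadMap` this decomposes the set `|q| = 1` into the unit spheres of eigenspaces. -/
theorem quadMap_of_gen_eq {v : Fin (m + 1) → ℝ} (hv : stdForm m v = 1) {x : V n} (hx : ‖x‖ = 1)
    (h : C.gen v x = x) : C.quadMap x = v := by
  have h1 : ∑ i, v i * C.quadMap x i = 1 := by
    rw [← inner_gen_self, h, real_inner_self_eq_norm_sq, hx, one_pow]
  have h2 := C.stdForm_quadMap_le hx
  rw [← sub_eq_zero]
  apply stdForm_eq_zero
  refine le_antisymm ?_ (stdForm_nonneg _)
  rw [stdForm_apply] at hv h2 ⊢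
  have h3 : ∑ i, (C.quadMap x - v) i ^ 2 =
      ∑ i, C.quadMap x i ^ 2 - 2 * ∑ i, v i * C.quadMap x i + ∑ i, v i ^ 2 := by
    rw [Finset.mul_sum, ← Finset.sum_sub_distrib, ← Finset.sum_add_distrib]
    refine Finset.sum_congr rfl fun i _ => ?_
    rw [Pi.sub_apply]
    ring
  rw [h3, h1, hv]
  linarith

theorem quadMap_smul (c : ℝ) (x : V n) : C.quadMap (c • x) = c ^ 2 • C.quadMap x := by
  ext i
  simp [quadMap, inner_smul_left, inner_smul_right, pow_two, mul_assoc]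

theorem quadMap_add (x y : V n) (i : Fin (m + 1)) :
    C.quadMap (x + y) i = C.quadMap x i + C.quadMap y i + 2 * inner ℝ (C.P i x) y := by
  have h : inner ℝ (C.P i y) x = inner ℝ (C.P i x) y := by rw [C.symm i y x, real_inner_comm]
  simp only [quadMap, map_add, inner_add_left, inner_add_right]
  rw [h]
  ring

theorem continuous_quadMap : Continuous C.quadMap := by
  refine continuous_pi fun i => ?_
  exact ((C.P i).continuous_of_finiteDimensional).inner continuous_id

/-! ### Orthogonal transformations that preserve the Cartan–Münzner polynomial -/

theorem mem_aut_of_cartanMunzner {A : OV n}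
    (h : ∀ x, C.cartanMunzner (A x) = C.cartanMunzner x) : A ∈ C.aut := by
  have key : ∀ A : OV n, (∀ x, C.cartanMunzner (A x) = C.cartanMunzner x) →
      ∀ L ∈ C.leaves, A '' L = L := by
    rintro A h L ⟨-, c, rfl⟩
    ext x
    constructor
    · rintro ⟨y, ⟨hy, hc⟩, rfl⟩
      exact ⟨by simpa using hy, (h y).trans hc⟩
    · rintro ⟨hx, hc⟩
      refine ⟨A.symm x, ⟨by simpa using hx, ?_⟩, A.apply_symm_apply x⟩
      rw [← h, A.apply_symm_apply, hc]
  intro L hL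
  rw [key A h L hL, key A⁻¹ (fun x => ?_) L hL]
  · exact ⟨hL, hL⟩
  · rw [← h]
    exact congrArg C.cartanMunzner (A.apply_symm_apply x)

theorem gen_mul_P_mul_gen {v : Fin (m + 1) → ℝ} (hv : stdForm m v = 1) (i : Fin (m + 1)) (x : V n) :
    C.gen v (C.P i (C.gen v x)) = (2 * v i) • C.gen v x - C.P i x := by
  have h := congrArg (fun a => C.rep a x) (ι_conj v (Pi.single i 1) hv)
  have hp : QuadraticMap.polar (stdForm m) v (Pi.single i 1) = 2 * v i := by
    rw [QuadraticMap.polar, stdForm_apply, stdForm_apply, stdForm_single, ← Finset.sum_sub_distrib,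
      Finset.sum_eq_single i]
    · simp; ring
    · intro j _ hj
      simp [hj]
    · simp
  simpa only [map_mul, Module.End.mul_apply, rep_ι, gen_single, hp, map_sub, map_smul,
    LinearMap.sub_apply, LinearMap.smul_apply] using h

/-- By the conjugation formula `q(gen v x) = 2⟨v, q(x)⟩ v - q(x)`, minus a reflection of `q(x)`, so
`|q|` is unchanged. -/
theorem cartanMunzner_gen {v : Fin (m + 1) → ℝ} (hv : stdForm m v = 1) (x : V n) :
    C.cartanMunzner (C.gen v x) = C.cartanMunzner x := by
  have h1 : ∀ i, C.quadMap (C.gen v x) i = 2 * v i * inner ℝ (C.gen v x) x - C.quadMap x i := by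
    intro i
    rw [quadMap, ← C.gen_symm v, C.gen_mul_P_mul_gen hv, inner_sub_left, inner_smul_left]
    rfl
  rw [cartanMunzner_eq, cartanMunzner_eq, inner_gen_gen, hv, one_mul]
  congr 2
  have h2 := C.inner_gen_self v x
  rw [stdForm_apply] at hv ⊢
  rw [stdForm_apply]
  set s := inner ℝ (C.gen v x) x with hs
  have h3 : ∑ i, C.quadMap (C.gen v x) i ^ 2 = 4 * s ^ 2 * ∑ i, v i ^ 2 -
      4 * s * ∑ i, v i * C.quadMap x i + ∑ i, C.quadMap x i ^ 2 := by
    rw [Finset.mul_sum, Finset.mul_sum, ← Finset.sum_sub_distrib, ← Finset.sum_add_distrib]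
    refine Finset.sum_congr rfl fun i _ => ?_
    rw [h1]
    ring
  rw [h3, hv, ← h2]
  ring

theorem cartanMunzner_rep {u : (Cl m)ˣ} (hu : u ∈ Pin m) (x : V n) :
    C.cartanMunzner (C.rep (u : Cl m) x) = C.cartanMunzner x := by
  induction hu using pin_induction with
  | one => simp
  | mul v h u _ ih =>
    have : C.rep ((unitVec v h * u : (Cl m)ˣ) : Cl m) x = C.gen v (C.rep (u : Cl m) x) := by
      rw [← C.rep_ι, ← Module.End.mul_apply, ← map_mul]
      rfl
    rw [this, C.cartanMunzner_gen h, ih]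

theorem image_sup_uPlus_le_aut {L : Subgroup (Cl m)ˣ} (hL : L ≤ Pin m) :
    C.image L ⊔ C.uPlus ≤ C.aut := by
  refine sup_le ?_ ?_
  · rintro A ⟨u, hu, hA⟩
    refine C.mem_aut_of_cartanMunzner fun x => ?_
    rw [hA, C.cartanMunzner_rep (hL hu)]
  · intro A hA
    refine C.mem_aut_of_cartanMunzner fun x => ?_
    rw [cartanMunzner_eq, cartanMunzner_eq, A.inner_map_map]
    congr 3
    ext i
    rw [quadMap, hA _ (Submodule.subset_span ⟨i, rfl⟩), A.inner_map_map]
    rfl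

end CliffordSystem

theorem exists_norm_eq_one_of_finrank_lt {E : Type*} [NormedAddCommGroup E] [InnerProductSpace ℝ E]
    [FiniteDimensional ℝ E] {U W : Submodule ℝ E}
    (h : Module.finrank ℝ W < Module.finrank ℝ U) :
    ∃ z ∈ U, ‖z‖ = 1 ∧ ∀ w ∈ W, inner ℝ w z = 0 := by
  have h1 := W.finrank_add_finrank_orthogonal
  have h2 := Submodule.finrank_sup_add_finrank_inf_eq U Wᗮ
  have h3 := (U ⊔ Wᗮ).finrank_le
  have h4 : U ⊓ Wᗮ ≠ ⊥ := by
    intro h5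
    rw [h5, finrank_bot] at h2
    omega
  obtain ⟨z, ⟨hzU, hzW⟩, hz⟩ := Submodule.exists_mem_ne_zero_of_ne_bot h4
  refine ⟨(‖z‖⁻¹ : ℝ) • z, U.smul_mem _ hzU, norm_smul_inv_norm hz, fun w hw => ?_⟩
  rw [inner_smul_right, hzW w hw, mul_zero]

/-! ### Eigenspaces of the unit elements of `𝒫` -/

namespace CliffordSystem

variable {m n : ℕ} (C : CliffordSystem m n)

/-- The eigenspace of `gen v` for the eigenvalue `1`. -/
def eigen (v : Fin (m + 1) → ℝ) : Submodule ℝ (V n) := LinearMap.ker (C.gen v - 1)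

theorem mem_eigen {v : Fin (m + 1) → ℝ} {x : V n} : x ∈ C.eigen v ↔ C.gen v x = x := by
  rw [eigen, LinearMap.mem_ker, LinearMap.sub_apply, Module.End.one_apply, sub_eq_zero]

theorem mem_eigen_neg {v : Fin (m + 1) → ℝ} {x : V n} : x ∈ C.eigen (-v) ↔ C.gen v x = -x := by
  rw [mem_eigen, map_neg, LinearMap.neg_apply, neg_eq_iff_eq_neg]

theorem add_gen_mem_eigen {v : Fin (m + 1) → ℝ} (hv : stdForm m v = 1) (x : V n) :
    x + C.gen v x ∈ C.eigen v := by
  rw [mem_eigen, map_add, C.gen_sq, hv, one_smul, add_comm]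

theorem sub_gen_mem_eigen_neg {v : Fin (m + 1) → ℝ} (hv : stdForm m v = 1) (x : V n) :
    x - C.gen v x ∈ C.eigen (-v) := by
  rw [mem_eigen_neg, map_sub, C.gen_sq, hv, one_smul, neg_sub]

theorem stdForm_neg (v : Fin (m + 1) → ℝ) : stdForm m (-v) = stdForm m v :=
  QuadraticMap.map_neg _ _

theorem inner_eigen_eigen_neg {v : Fin (m + 1) → ℝ} {x y : V n}
    (hx : x ∈ C.eigen v) (hy : y ∈ C.eigen (-v)) : inner ℝ x y = 0 := by
  have h := C.gen_symm v x y
  rw [C.mem_eigen.1 hx, C.mem_eigen_neg.1 hy, inner_neg_right] at h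
  linarith

theorem trace_gen (hm : 1 ≤ m) (v : Fin (m + 1) → ℝ) : LinearMap.trace ℝ _ (C.gen v) = 0 := by
  rw [gen_apply, map_sum]
  refine Finset.sum_eq_zero fun i _ => ?_
  rw [map_smul, smul_eq_zero]
  right
  obtain ⟨s, hs, h⟩ := mon_insert (Finset.notMem_empty i)
  have hs0 : s ≠ 0 := by rintro rfl; norm_num at hs
  have h1 := trace_mon C.rep (I := insert i ∅) (Finset.insert_ne_empty _ _) (by
    rintro ⟨h, -⟩
    have := congrArg Finset.card h
    simp at this
    omega)
  rw [h, mon_empty, mul_one, map_smul, map_smul, rep_e, smul_eq_zero] at h1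
  exact h1.resolve_left hs0

/-- The dimension is the trace of the projection `(1 + gen v) / 2`. For `m ≥ 1` the generators are
traceless, since another one anticommutes with them. -/
theorem finrank_eigen (hm : 1 ≤ m) {v : Fin (m + 1) → ℝ} (hv : stdForm m v = 1) :
    Module.finrank ℝ (C.eigen v) = n + 1 := by
  have hp : LinearMap.IsProj (C.eigen v) ((1 / 2 : ℝ) • (1 + C.gen v)) := by
    constructor
    · intro x
      exact Submodule.smul_mem _ _ (C.add_gen_mem_eigen hv x)
    · intro x hx
      rw [LinearMap.smul_apply, LinearMap.add_apply, Module.End.one_apply, C.mem_eigen.1 hx,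
        ← two_smul ℝ x, smul_smul]
      norm_num
  have h := hp.trace
  rw [map_smul, map_add, C.trace_gen hm, LinearMap.trace_one, finrank_euclideanSpace_fin,
    smul_eq_mul] at h
  push_cast at h
  have h2 : (Module.finrank ℝ (C.eigen v) : ℝ) = ((n + 1 : ℕ) : ℝ) := by
    rw [← h]
    push_cast
    ring
  exact_mod_cast h2

/-! ### The images of the focal manifolds -/

/-- A curve through all leaves: combine unit vectors `a`, `b` of the two eigenspaces of `P 0` with
`⟨P_i a, b⟩ = 0` for all `i`, so that `q` has no mixed term. Such a `b` exists because the `m + 1`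
conditions leave room in dimension `n + 1`. -/
theorem exists_leaf (hm : 1 ≤ m) (hn : m < n) : ∃ x : ℝ → V n, Continuous x ∧
    ∀ s ∈ Set.Icc (0 : ℝ) 1, ‖x s‖ = 1 ∧ stdForm m (C.quadMap (x s)) = s ^ 2 := by
  have hE := stdForm_single (m := m) 0
  have hf := C.finrank_eigen hm hE
  have hf' := C.finrank_eigen hm ((stdForm_neg _).trans hE)
  obtain ⟨a, ha, ha1, -⟩ := exists_norm_eq_one_of_finrank_lt (U := C.eigen (Pi.single 0 1))
    (W := ⊥) (by rw [finrank_bot, hf]; omega)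
  let W := Submodule.span ℝ (Set.range fun i => C.P i a)
  have hW : Module.finrank ℝ W ≤ m + 1 :=
    (finrank_range_le_card (R := ℝ) fun i => C.P i a).trans (Fintype.card_fin _).le
  obtain ⟨b, hb, hb1, hbW⟩ := exists_norm_eq_one_of_finrank_lt (U := C.eigen (-Pi.single 0 1))
    (W := W) (by omega)
  have hab : inner ℝ a b = 0 := C.inner_eigen_eigen_neg ha hb
  have hPab : ∀ i, inner ℝ (C.P i a) b = 0 := fun i => hbW _ (Submodule.subset_span ⟨i, rfl⟩)
  have hqa := C.quadMap_of_gen_eq hE ha1 (C.mem_eigen.1 ha)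
  have hqb := C.quadMap_of_gen_eq ((stdForm_neg _).trans hE) hb1 (C.mem_eigen.1 hb)
  -- The squares of the coefficients add up to `1` and differ by `s`, which gives unit norm and `q(x
  -- s) = s • E_0`.
  refine ⟨fun s => √((1 + s) / 2) • a + √((1 - s) / 2) • b, by fun_prop, fun s hs => ⟨?_, ?_⟩⟩
  · have h1 := norm_add_sq_real (√((1 + s) / 2) • a) (√((1 - s) / 2) • b)
    rw [inner_smul_left, inner_smul_right, hab, norm_smul, norm_smul, ha1, hb1, mul_one, mul_one,
      Real.norm_eq_abs, Real.norm_eq_abs, sq_abs, sq_abs, Real.sq_sqrt (by linarith [hs.1]),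
      Real.sq_sqrt (by linarith [hs.2])] at h1
    have h2 : ‖√((1 + s) / 2) • a + √((1 - s) / 2) • b‖ ^ 2 = 1 := by rw [h1]; ring
    exact (pow_eq_one_iff_of_nonneg (norm_nonneg _) two_ne_zero).1 h2
  · have h1 : C.quadMap (√((1 + s) / 2) • a + √((1 - s) / 2) • b) = s • Pi.single 0 1 := by
      ext i
      rw [quadMap_add, quadMap_smul, quadMap_smul, hqa, hqb, map_smul, inner_smul_left,
        inner_smul_right, hPab, Real.sq_sqrt (by linarith [hs.1]),
        Real.sq_sqrt (by linarith [hs.2])]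
      simp only [Pi.smul_apply, Pi.neg_apply, smul_eq_mul]
      ring
    rw [h1, QuadraticMap.map_smul, hE]
    simp [pow_two]

theorem aut_level {A : OV n} (hA : A ∈ C.aut) {x y : V n} (hx : ‖x‖ = 1) (hy : ‖y‖ = 1) :
    stdForm m (C.quadMap (A x)) = stdForm m (C.quadMap (A y)) ↔
      stdForm m (C.quadMap x) = stdForm m (C.quadMap y) := by
  have hF : ∀ x : V n, ‖x‖ = 1 → C.cartanMunzner x = 1 - 2 * stdForm m (C.quadMap x) := by
    intro x hx
    rw [cartanMunzner_eq, real_inner_self_eq_norm_sq, hx]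
    norm_num
  have key : ∀ B : OV n, (∀ L ∈ C.leaves, B '' L ∈ C.leaves) → ∀ x y : V n, ‖x‖ = 1 → ‖y‖ = 1 →
      stdForm m (C.quadMap x) = stdForm m (C.quadMap y) →
      stdForm m (C.quadMap (B x)) = stdForm m (C.quadMap (B y)) := by
    intro B hB x y hx hy h
    obtain ⟨-, c, hc⟩ := hB {z | z ∈ Metric.sphere (0 : V n) 1 ∧
      C.cartanMunzner z = C.cartanMunzner x} ⟨⟨x, by simpa using hx, rfl⟩, _, rfl⟩
    have h1 : B x ∈ B '' {z | z ∈ Metric.sphere (0 : V n) 1 ∧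
      C.cartanMunzner z = C.cartanMunzner x} := ⟨x, ⟨by simpa using hx, rfl⟩, rfl⟩
    have h2 : B y ∈ B '' {z | z ∈ Metric.sphere (0 : V n) 1 ∧
      C.cartanMunzner z = C.cartanMunzner x} :=
        ⟨y, ⟨by simpa using hy, by rw [hF y hy, hF x hx, h]⟩, rfl⟩
    rw [hc] at h1 h2
    have h3 := h1.2.trans h2.2.symm
    rw [hF _ (by rw [B.norm_map, hx]), hF _ (by rw [B.norm_map, hy])] at h3
    linarith
  constructor
  · intro h
    have := key A⁻¹ (fun L hL => (hA L hL).2) (A x) (A y) (by rw [A.norm_map, hx])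
      (by rw [A.norm_map, hy]) h
    have hs : ∀ z, (A⁻¹ : OV n) (A z) = z := A.symm_apply_apply
    rwa [hs, hs] at this
  · exact key A (fun L hL => (hA L hL).1) x y hx hy

/-- An automorphism preserves or exchanges the focal manifolds. -/
theorem aut_focal (hm : 1 ≤ m) (hn : m < n) {A : OV n} (hA : A ∈ C.aut) :
    (∀ x : V n, ‖x‖ = 1 → stdForm m (C.quadMap x) = 1 → stdForm m (C.quadMap (A x)) = 1) ∨
    ∀ x : V n, ‖x‖ = 1 → (stdForm m (C.quadMap x) = 1 → stdForm m (C.quadMap (A x)) = 0) ∧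
      (stdForm m (C.quadMap x) = 0 → stdForm m (C.quadMap (A x)) = 1) := by
  obtain ⟨x, hxc, hx⟩ := C.exists_leaf hm hn
  have hnorm : ∀ y : V n, ‖y‖ = 1 → ‖A y‖ = 1 := fun y hy => by rw [A.norm_map, hy]
  let ψ : ℝ → ℝ := fun s => stdForm m (C.quadMap (A (x s)))
  have hψ : ∀ s ∈ Set.Icc (0 : ℝ) 1, ∀ y : V n, ‖y‖ = 1 → stdForm m (C.quadMap y) = s ^ 2 →
      stdForm m (C.quadMap (A y)) = ψ s := fun s hs y hy h =>
    (C.aut_level hA hy (hx s hs).1).2 (h.trans (hx s hs).2.symm)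
  have hψc : Continuous ψ := by
    have : ψ = fun s => ∑ i, C.quadMap (A (x s)) i ^ 2 := funext fun s => stdForm_apply _
    rw [this]
    refine continuous_finsetSum _ fun i _ => ?_
    exact ((continuous_apply i).comp (C.continuous_quadMap.comp (A.continuous.comp hxc))).pow 2
  have hψi : Set.InjOn ψ (Set.Icc 0 1) := by
    intro s hs t ht h
    have h1 := (C.aut_level hA (hx s hs).1 (hx t ht).1).1 h
    rw [(hx s hs).2, (hx t ht).2] at h1
    exact (sq_eq_sq₀ hs.1 ht.1).1 h1
  have hψs : ∀ s ∈ Set.Icc (0 : ℝ) 1, ∃ t ∈ Set.Icc (0 : ℝ) 1, ψ t = s ^ 2 := by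
    intro s hs
    have hz : ‖A.symm (x s)‖ = 1 := by rw [A.symm.norm_map, (hx s hs).1]
    have h1 := C.stdForm_quadMap_le hz
    have h0 := stdForm_nonneg (C.quadMap (A.symm (x s)))
    have hmem : √(stdForm m (C.quadMap (A.symm (x s)))) ∈ Set.Icc (0 : ℝ) 1 :=
      ⟨Real.sqrt_nonneg _, Real.sqrt_le_one.2 h1⟩
    refine ⟨_, hmem, ?_⟩
    rw [← hψ _ hmem _ hz (Real.sq_sqrt h0).symm, A.apply_symm_apply, (hx s hs).2]
  have hI0 : (0 : ℝ) ∈ Set.Icc (0 : ℝ) 1 := by simp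
  have hI1 : (1 : ℝ) ∈ Set.Icc (0 : ℝ) 1 := by simp
  have hle : ψ 0 ≤ 1 ∧ ψ 1 ≤ 1 := ⟨C.stdForm_quadMap_le (hnorm _ (hx 0 hI0).1),
    C.stdForm_quadMap_le (hnorm _ (hx 1 hI1).1)⟩
  have hge : 0 ≤ ψ 1 := stdForm_nonneg _
  obtain ⟨s, hs, hs0⟩ := hψs 0 hI0
  obtain ⟨t, ht, ht1⟩ := hψs 1 hI1
  -- The level of the image leaf is a continuous injective function of `s` that takes the values `0`
  -- and `1`. By monotonicity it takes them at the endpoints, in one order or the other.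
  rcases hψc.continuousOn.strictMonoOn_of_injOn_Icc' zero_le_one hψi with hmono | hanti
  · left
    intro y hy h
    rw [hψ 1 hI1 y hy (by rw [h]; norm_num)]
    have := hmono.monotoneOn ht hI1 ht.2
    linarith
  · right
    intro y hy
    constructor
    · intro h
      rw [hψ 1 hI1 y hy (by rw [h]; norm_num)]
      have := hanti.antitoneOn hs hI1 hs.2
      linarith
    · intro h
      rw [hψ 0 hI0 y hy (by rw [h]; norm_num)]
      have := hanti.antitoneOn hI0 ht ht.1
      linarith

end CliffordSystem

namespace CliffordSystem

variable {m n : ℕ} (C : CliffordSystem m n)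

/-- The Clifford system `A⁻¹ P_i A`. -/
def conj (A : OV n) : CliffordSystem m n where
  P i := (A.symm.toLinearEquiv : V n →ₗ[ℝ] V n) ∘ₗ C.P i ∘ₗ (A.toLinearEquiv : V n →ₗ[ℝ] V n)
  symm i x y := by
    have h1 : ∀ z w : V n, inner ℝ (A.symm z) w = inner ℝ z (A w) := fun z w => by
      rw [← A.inner_map_map, A.apply_symm_apply]
    have h2 : ∀ z w : V n, inner ℝ z (A.symm w) = inner ℝ (A z) w := fun z w => by
      rw [← A.inner_map_map, A.apply_symm_apply]
    exact (h1 _ _).trans ((C.symm i _ _).trans (h2 _ _).symm)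
  rel i j := by
    ext1 x
    have h := congrArg (fun f => A.symm (f (A x))) (C.rel i j)
    split_ifs at h ⊢ <;> simpa [two_mul] using h

theorem conj_P (A : OV n) (i : Fin (m + 1)) (x : V n) :
    (C.conj A).P i x = A.symm (C.P i (A x)) := rfl

theorem conj_gen (A : OV n) (v : Fin (m + 1) → ℝ) (x : V n) :
    (C.conj A).gen v x = A.symm (C.gen v (A x)) := by
  simp [gen_apply, LinearMap.sum_apply, conj_P]

theorem conj_quadMap (A : OV n) (x : V n) : (C.conj A).quadMap x = C.quadMap (A x) := by
  ext i
  rw [quadMap, quadMap, conj_P, ← A.inner_map_map, A.apply_symm_apply]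

/-! ### The focal manifolds are not exchanged -/

section Exchange

variable {C} {C' : CliffordSystem m n}

theorem inner_eq_zero_of_exchange
    (h : ∀ x : V n, ‖x‖ = 1 → stdForm m (C.quadMap x) = 1 → stdForm m (C'.quadMap x) = 0)
    {v : Fin (m + 1) → ℝ} (hv : stdForm m v = 1) (j : Fin (m + 1)) {x y : V n}
    (hx : x ∈ C.eigen v) (hy : y ∈ C.eigen v) : inner ℝ (C'.P j x) y = 0 := by
  have hz : ∀ z ∈ C.eigen v, C'.quadMap z j = 0 := by
    intro z hz
    by_cases h0 : z = 0
    · subst h0; simp [quadMap]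
    · have h1 : ‖(‖z‖⁻¹ : ℝ) • z‖ = 1 := norm_smul_inv_norm h0
      have h2 := C.quadMap_of_gen_eq hv h1 (C.mem_eigen.1 (Submodule.smul_mem _ _ hz))
      have h3 := congrFun (stdForm_eq_zero (h _ h1 (by rw [h2, hv]))) j
      rw [quadMap_smul, Pi.smul_apply, smul_eq_mul, Pi.zero_apply, mul_eq_zero] at h3
      exact h3.resolve_left (pow_ne_zero 2 (inv_ne_zero (norm_ne_zero_iff.2 h0)))
  have h1 := C'.quadMap_add x y j
  rw [hz _ (add_mem hx hy), hz x hx, hz y hy] at h1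
  linarith

/-- After an exchange `C'.P j` pairs each of the eigenspaces `E(v)` and `E(-v)` trivially with
itself, by polarization of `q' = 0`. It therefore interchanges the two. -/
theorem anticomm_of_exchange
    (h : ∀ x : V n, ‖x‖ = 1 → stdForm m (C.quadMap x) = 1 → stdForm m (C'.quadMap x) = 0)
    {v : Fin (m + 1) → ℝ} (hv : stdForm m v = 1) (j : Fin (m + 1)) (x : V n) :
    C.gen v (C'.P j x) = -C'.P j (C.gen v x) := by
  have key : ∀ x y, inner ℝ (C'.P j x) y + inner ℝ (C'.P j (C.gen v x)) (C.gen v y) = 0 := by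
    intro x y
    have h1 := inner_eq_zero_of_exchange h hv j (C.add_gen_mem_eigen hv x)
      (C.add_gen_mem_eigen hv y)
    have h2 := inner_eq_zero_of_exchange h ((stdForm_neg v).trans hv) j
      (C.sub_gen_mem_eigen_neg hv x) (C.sub_gen_mem_eigen_neg hv y)
    simp only [map_add, map_sub, inner_add_left, inner_add_right, inner_sub_left,
      inner_sub_right] at h1 h2
    linarith
  rw [eq_neg_iff_add_eq_zero]
  refine ext_inner_right ℝ fun y => ?_
  rw [inner_add_left, inner_zero_left, C.gen_symm v]
  have := key x (C.gen v y)
  rwa [C.gen_sq, hv, one_smul] at this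

/-- All of `C` anticommutes with all of `C'`. For `2m < n` there is a unit vector with `q = q' = 0`,
against `h'`. For `2m = n` the product `C.P 0 * C.P 1` is a complex structure on an eigenspace of
odd dimension `2m + 1`. -/
theorem not_exchange (hm : 1 ≤ m) (hn : 2 * m ≤ n)
    (h : ∀ x : V n, ‖x‖ = 1 → stdForm m (C.quadMap x) = 1 → stdForm m (C'.quadMap x) = 0)
    (h' : ∀ x : V n, ‖x‖ = 1 → stdForm m (C.quadMap x) = 0 → stdForm m (C'.quadMap x) = 1) :
    False := by
  have hE := stdForm_single (m := m) 0
  have hf := C'.finrank_eigen hm hE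
  have hf' := C'.finrank_eigen hm ((stdForm_neg _).trans hE)
  have hanti : ∀ i j x, C.P i (C'.P j x) = -C'.P j (C.P i x) := by
    intro i j x
    rw [← C.gen_single]
    exact anticomm_of_exchange h (stdForm_single i) j x
  rcases hn.eq_or_lt with hn | hn
  · let U := C'.eigen (-Pi.single 0 1)
    have hU : ∀ x ∈ U, (C.P 0 * C.P 1) x ∈ U := by
      intro x hx
      rw [mem_eigen_neg, gen_single] at hx ⊢
      rw [Module.End.mul_apply, ← neg_inj, ← hanti, neg_neg, ← neg_inj, ← map_neg, ← hanti, hx]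
      simp
    let J : Module.End ℝ U := (C.P 0 * C.P 1).restrict hU
    have h01 : (0 : Fin (m + 1)) ≠ 1 := by
      intro h0
      have := congrArg Fin.val h0
      simp [Nat.mod_eq_of_lt (show 1 < m + 1 by omega)] at this
    have hsq : ∀ i x, C.P i (C.P i x) = x := by
      intro i x
      rw [← gen_single, gen_sq, stdForm_single, one_smul]
    have hJ : J * J = (-1 : ℝ) • 1 := by
      refine LinearMap.ext fun x => Subtype.ext ?_
      change C.P 0 (C.P 1 (C.P 0 (C.P 1 x))) = (-1 : ℝ) • (x : V n)
      have h2 := LinearMap.congr_fun (C.rel 0 1) (C.P 1 (x : V n))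
      rw [if_neg h01] at h2
      have h3 : C.P 1 (C.P 0 (C.P 1 (x : V n))) = -C.P 0 (x : V n) := by
        rw [LinearMap.add_apply, Module.End.mul_apply, Module.End.mul_apply, hsq,
          LinearMap.zero_apply] at h2
        exact eq_neg_of_add_eq_zero_right h2
      rw [h3, map_neg, hsq, neg_one_smul]
    -- `det(J)²` would be `(-1)` to an odd power.
    have hd := congrArg LinearMap.det hJ
    have hodd : Odd (Module.finrank ℝ U) := ⟨m, by rw [hf', ← hn]⟩
    rw [map_mul, LinearMap.det_smul, map_one, mul_one, hodd.neg_one_pow] at hd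
    nlinarith [mul_self_nonneg (LinearMap.det J)]
  · obtain ⟨a, ha, ha1, -⟩ := exists_norm_eq_one_of_finrank_lt (U := C'.eigen (Pi.single 0 1))
      (W := ⊥) (by rw [finrank_bot, hf]; omega)
    -- `C'.P 0 a = a` is omitted, as its orthogonality to `b` is automatic. This leaves `2m + 1`
    -- vectors, fewer than the dimension `n + 1` of the eigenspace.
    let W := Submodule.span ℝ (Set.range
      (Sum.elim (fun i : Fin (m + 1) => C.P i a) fun j : Fin m => C'.P j.succ a))
    have hW : Module.finrank ℝ W ≤ (m + 1) + m :=
      (finrank_range_le_card (R := ℝ) _).trans (by simp)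
    obtain ⟨b, hb, hb1, hbW⟩ := exists_norm_eq_one_of_finrank_lt
      (U := C'.eigen (-Pi.single 0 1)) (W := W) (by omega)
    have hab : inner ℝ a b = 0 := C'.inner_eigen_eigen_neg ha hb
    have hCab : ∀ i, inner ℝ (C.P i a) b = 0 := fun i =>
      hbW _ (Submodule.subset_span ⟨Sum.inl i, rfl⟩)
    have hCab' : ∀ i, inner ℝ (C'.P i a) b = 0 := by
      intro i
      refine Fin.cases ?_ (fun j => hbW _ (Submodule.subset_span ⟨Sum.inr j, rfl⟩)) i
      rw [← gen_single, C'.mem_eigen.1 ha, hab]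
    have hqa := C'.quadMap_of_gen_eq hE ha1 (C'.mem_eigen.1 ha)
    have hqb := C'.quadMap_of_gen_eq ((stdForm_neg _).trans hE) hb1 (C'.mem_eigen.1 hb)
    -- `C.P i` anticommutes with `C'.P 0`, so it maps an eigenvector into the opposite, orthogonal
    -- eigenspace.
    have hzero : ∀ z : V n, C'.P 0 z = z ∨ C'.P 0 z = -z → C.quadMap z = 0 := by
      intro z hz
      ext i
      have h1 : inner ℝ (C.P i (C'.P 0 z)) z = -inner ℝ (C.P i z) (C'.P 0 z) := by
        rw [hanti, inner_neg_left, C'.symm 0]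
      rw [quadMap, Pi.zero_apply]
      rcases hz with hz | hz
      · rw [hz] at h1
        linarith
      · rw [hz, map_neg, inner_neg_left, inner_neg_right] at h1
        linarith
    have hca : C.quadMap a = 0 := hzero a (Or.inl (by rw [← gen_single]; exact C'.mem_eigen.1 ha))
    have hcb : C.quadMap b = 0 :=
      hzero b (Or.inr (by rw [← gen_single]; exact C'.mem_eigen_neg.1 hb))
    have hs : (√(1 / 2) : ℝ) ^ 2 = 1 / 2 := Real.sq_sqrt (by norm_num)
    have hnorm : ‖(√(1 / 2) : ℝ) • (a + b)‖ = 1 := by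
      have h1 := norm_add_sq_real a b
      rw [hab, ha1, hb1] at h1
      have h2 : ‖(√(1 / 2) : ℝ) • (a + b)‖ ^ 2 = 1 := by
        rw [norm_smul, mul_pow, h1, Real.norm_eq_abs, sq_abs, hs]
        norm_num
      exact (pow_eq_one_iff_of_nonneg (norm_nonneg _) two_ne_zero).1 h2
    have h0 : C.quadMap ((√(1 / 2) : ℝ) • (a + b)) = 0 := by
      ext i
      rw [quadMap_smul, Pi.smul_apply, quadMap_add, hca, hcb, hCab]
      simp
    have h0' : C'.quadMap ((√(1 / 2) : ℝ) • (a + b)) = 0 := by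
      ext i
      rw [quadMap_smul, Pi.smul_apply, quadMap_add, hqa, hqb, hCab']
      simp
    have h1 := h' _ hnorm (by rw [h0, QuadraticMap.map_zero])
    rw [h0', QuadraticMap.map_zero] at h1
    exact zero_ne_one h1

end Exchange

/-! ### Clifford systems with the same focal manifold -/

section Focal

variable {C} {C' : CliffordSystem m n}

theorem stdForm_quadMap_of_focal
    (h : ∀ x : V n, ‖x‖ = 1 → stdForm m (C.quadMap x) = 1 → stdForm m (C'.quadMap x) = 1)
    {v : Fin (m + 1) → ℝ} (hv : stdForm m v = 1) {x : V n} (hx : x ∈ C.eigen v) :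
    stdForm m (C'.quadMap x) = (‖x‖ ^ 2) ^ 2 := by
  by_cases h0 : x = 0
  · subst h0
    have : C'.quadMap 0 = 0 := by ext i; simp [quadMap]
    rw [this]
    simp
  · have h1 : ‖(‖x‖⁻¹ : ℝ) • x‖ = 1 := norm_smul_inv_norm h0
    have h2 := C.quadMap_of_gen_eq hv h1 (C.mem_eigen.1 (Submodule.smul_mem _ _ hx))
    have h3 := h _ h1 (by rw [h2, hv])
    have h4 := norm_ne_zero_iff.2 h0
    rw [quadMap_smul, QuadraticMap.map_smul, smul_eq_mul] at h3
    field_simp at h3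
    rw [h3]
    ring

/-- On `E(v)` one has `|q'|² = ‖·‖⁴`. By `hB`, `q'(x + c z) = (1 + 2 c s) q'(x) + q'(z)` for `c =
±1`, so comparing norms gives `(1 + 2 c s)(⟨q'(x), q'(z)⟩ - 1) = 0`. Adding both signs removes the
possibly vanishing factor, and the unit vectors `q'(x)`, `q'(z)` coincide. -/
theorem quadMap_eq_of_inner_eq
    (h : ∀ x : V n, ‖x‖ = 1 → stdForm m (C.quadMap x) = 1 → stdForm m (C'.quadMap x) = 1)
    {v : Fin (m + 1) → ℝ} (hv : stdForm m v = 1) {x z : V n} (hx : x ∈ C.eigen v)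
    (hz : z ∈ C.eigen v) (hx1 : ‖x‖ = 1) (hz1 : ‖z‖ = 1)
    (hB : ∀ i, inner ℝ (C'.P i x) z = inner ℝ x z * C'.quadMap x i) :
    C'.quadMap x = C'.quadMap z := by
  set s := inner ℝ x z with hs
  have key : ∀ c : ℝ, c ^ 2 = 1 → 1 + 2 * (1 + 2 * (c * s)) *
      (∑ i, C'.quadMap x i * C'.quadMap z i) + (1 + 2 * (c * s)) ^ 2 = (2 + 2 * (c * s)) ^ 2 := by
    intro c hc
    have h1 := stdForm_quadMap_of_focal h hv (add_mem hx (Submodule.smul_mem _ c hz))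
    have h2 : ‖x + c • z‖ ^ 2 = 2 + 2 * (c * s) := by
      rw [norm_add_sq_real, hx1, inner_smul_right, norm_smul, hz1, mul_one, Real.norm_eq_abs,
        sq_abs, hc]
      ring
    have h3 := h x hx1 (by rw [C.quadMap_of_gen_eq hv hx1 (C.mem_eigen.1 hx), hv])
    have h4 := h z hz1 (by rw [C.quadMap_of_gen_eq hv hz1 (C.mem_eigen.1 hz), hv])
    rw [stdForm_apply] at h1 h3 h4
    rw [← h2, ← h1]
    have h5 : ∑ i, C'.quadMap (x + c • z) i ^ 2 = (1 + 2 * (c * s)) ^ 2 * ∑ i, C'.quadMap x i ^ 2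
        + 2 * (1 + 2 * (c * s)) * (∑ i, C'.quadMap x i * C'.quadMap z i) +
        ∑ i, C'.quadMap z i ^ 2 := by
      rw [Finset.mul_sum, Finset.mul_sum, ← Finset.sum_add_distrib, ← Finset.sum_add_distrib]
      refine Finset.sum_congr rfl fun i _ => ?_
      rw [quadMap_add, quadMap_smul, hc, one_smul, inner_smul_right, hB]
      ring
    rw [h5, h3, h4]
    ring
  have h1 := key 1 (by norm_num)
  have h2 := key (-1) (by norm_num)
  have h3 : ∑ i, C'.quadMap x i * C'.quadMap z i = 1 := by linarith
  have h4 := h x hx1 (by rw [C.quadMap_of_gen_eq hv hx1 (C.mem_eigen.1 hx), hv])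
  have h5 := h z hz1 (by rw [C.quadMap_of_gen_eq hv hz1 (C.mem_eigen.1 hz), hv])
  rw [stdForm_apply] at h4 h5
  rw [← sub_eq_zero]
  apply stdForm_eq_zero
  rw [stdForm_apply]
  have h6 : ∑ i, (C'.quadMap x - C'.quadMap z) i ^ 2 = ∑ i, C'.quadMap x i ^ 2 -
      2 * ∑ i, C'.quadMap x i * C'.quadMap z i + ∑ i, C'.quadMap z i ^ 2 := by
    rw [Finset.mul_sum, ← Finset.sum_sub_distrib, ← Finset.sum_add_distrib]
    refine Finset.sum_congr rfl fun i _ => ?_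
    rw [Pi.sub_apply]
    ring
  rw [h6, h3, h4, h5]
  norm_num

/-- `q'` is constant on the unit sphere of `E(v)`: any two of its points can be compared with a
common third one. If `w` is the constant value, `E(v)` lies in the eigenspace `E'(w)`, and equal
dimensions and symmetry give equality of the operators. -/
theorem exists_gen_eq (hm : 1 ≤ m) (hn : 2 * m ≤ n)
    (h : ∀ x : V n, ‖x‖ = 1 → stdForm m (C.quadMap x) = 1 → stdForm m (C'.quadMap x) = 1)
    {v : Fin (m + 1) → ℝ} (hv : stdForm m v = 1) : ∃ w, C.gen v = C'.gen w := by
  have hf := C.finrank_eigen hm hv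
  have hq1 : ∀ x ∈ C.eigen v, ‖x‖ = 1 → stdForm m (C'.quadMap x) = 1 := fun x hx hx1 =>
    h x hx1 (by rw [C.quadMap_of_gen_eq hv hx1 (C.mem_eigen.1 hx), hv])
  -- Orthogonality of `z` to the range of `R x` is the hypothesis `hB` of `quadMap_eq_of_inner_eq`.
  -- Since `R x` kills the unit vector `q'(x)`, the range has dimension at most `m`.
  let R : V n → (Fin (m + 1) → ℝ) →ₗ[ℝ] V n := fun x =>
    C'.gen.flip x - (LinearMap.toSpanSingleton ℝ (V n) x) ∘ₗ
      ∑ i, C'.quadMap x i • LinearMap.proj i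
  have hR : ∀ x w, R x w = C'.gen w x - (∑ i, C'.quadMap x i * w i) • x := fun x w => by
    simp [R, Finset.sum_smul]
  have hRr : ∀ x ∈ C.eigen v, ‖x‖ = 1 → Module.finrank ℝ (LinearMap.range (R x)) ≤ m := by
    intro x hx hx1
    have h1 := (R x).finrank_range_add_finrank_ker
    have h2 : LinearMap.ker (R x) ≠ ⊥ := by
      intro h2
      have h3 : C'.quadMap x ∈ LinearMap.ker (R x) := by
        have h4 := hq1 x hx hx1
        rw [LinearMap.mem_ker, hR, C'.gen_quadMap hx1 h4]
        rw [stdForm_apply] at h4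
        simp only [← pow_two, h4, one_smul, sub_self]
      rw [h2, Submodule.mem_bot] at h3
      have h4 := hq1 x hx hx1
      rw [h3, QuadraticMap.map_zero] at h4
      exact zero_ne_one h4
    have h3 : 0 < Module.finrank ℝ (LinearMap.ker (R x)) :=
      Nat.pos_of_ne_zero fun h => h2 (Submodule.finrank_eq_zero.1 h)
    rw [Module.finrank_fin_fun] at h1
    omega
  have hconst : ∀ x ∈ C.eigen v, ∀ y ∈ C.eigen v, ‖x‖ = 1 → ‖y‖ = 1 →
      C'.quadMap x = C'.quadMap y := by
    intro x hx y hy hx1 hy1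
    have h1 := Submodule.finrank_add_le_finrank_add_finrank (LinearMap.range (R x))
      (LinearMap.range (R y))
    have h2 := hRr x hx hx1
    have h3 := hRr y hy hy1
    -- The two ranges together have dimension at most `2m < n + 1`.
    obtain ⟨z, hz, hz1, hzW⟩ := exists_norm_eq_one_of_finrank_lt (U := C.eigen v)
      (W := LinearMap.range (R x) ⊔ LinearMap.range (R y)) (by omega)
    have h4 : ∀ u : V n, LinearMap.range (R u) ≤ LinearMap.range (R x) ⊔ LinearMap.range (R y) →
        ∀ i, inner ℝ (C'.P i u) z = inner ℝ u z * C'.quadMap u i := by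
      intro u hu i
      have h5 := hzW _ (hu ⟨Pi.single i 1, rfl⟩)
      rw [hR, gen_single, inner_sub_left, inner_smul_left, conj_trivial, sub_eq_zero] at h5
      rw [h5, mul_comm]
      congr 1
      simp [Pi.single_apply]
    rw [quadMap_eq_of_inner_eq h hv hx hz hx1 hz1 (h4 x le_sup_left),
      quadMap_eq_of_inner_eq h hv hy hz hy1 hz1 (h4 y le_sup_right)]
  obtain ⟨a, ha, ha1, -⟩ := exists_norm_eq_one_of_finrank_lt (U := C.eigen v)
    (W := ⊥) (by rw [finrank_bot, hf]; omega)
  have hw := hq1 a ha ha1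
  have hle : C.eigen v ≤ C'.eigen (C'.quadMap a) := by
    intro x hx
    by_cases h0 : x = 0
    · subst h0; exact Submodule.zero_mem _
    · have h1 : ‖(‖x‖⁻¹ : ℝ) • x‖ = 1 := norm_smul_inv_norm h0
      have h2 := Submodule.smul_mem _ (‖x‖⁻¹ : ℝ) hx
      have h3 : C'.gen (C'.quadMap a) ((‖x‖⁻¹ : ℝ) • x) = (‖x‖⁻¹ : ℝ) • x := by
        rw [hconst a ha _ h2 ha1 h1]
        exact C'.gen_quadMap h1 (hq1 _ h2 h1)
      rw [map_smul] at h3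
      exact C'.mem_eigen.2 (smul_right_injective _ (inv_ne_zero (norm_ne_zero_iff.2 h0)) h3)
  have heq := Submodule.eq_of_le_of_finrank_eq hle (by rw [hf, C'.finrank_eigen hm hw])
  refine ⟨C'.quadMap a, LinearMap.ext fun x => ?_⟩
  have h1 := C'.mem_eigen.1 (hle (C.add_gen_mem_eigen hv x))
  have h2 := C.sub_gen_mem_eigen_neg hv x
  -- For `y` in `E(-v)`, the vector `y + gen' w y` lies in `E'(w) = E(v)`, hence is orthogonal to
  -- `y`; by symmetry of `gen' w` it is orthogonal to itself.
  have h3 : C'.gen (C'.quadMap a) (x - C.gen v x) = -(x - C.gen v x) := by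
    set y := x - C.gen v x
    have h4 := C'.add_gen_mem_eigen hw y
    rw [← heq] at h4
    have h5 := C.inner_eigen_eigen_neg h4 h2
    have h6 : inner ℝ (y + C'.gen (C'.quadMap a) y) (y + C'.gen (C'.quadMap a) y) = (0 : ℝ) := by
      rw [inner_add_right, h5, zero_add, ← C'.gen_symm, map_add, C'.gen_sq, hw, one_smul,
        add_comm (C'.gen _ y) y, h5]
    rw [inner_self_eq_zero] at h6
    exact eq_neg_of_add_eq_zero_right h6
  rw [map_add] at h1
  rw [map_sub] at h3
  have h4 : (2 : ℝ) • C'.gen (C'.quadMap a) x = (2 : ℝ) • C.gen v x := by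
    calc (2 : ℝ) • C'.gen (C'.quadMap a) x
        = (C'.gen (C'.quadMap a) x + C'.gen (C'.quadMap a) (C.gen v x)) +
          (C'.gen (C'.quadMap a) x - C'.gen (C'.quadMap a) (C.gen v x)) := by module
      _ = _ := by rw [h1, h3]; module
  exact (smul_right_injective _ (two_ne_zero' ℝ) h4).symm

end Focal

end CliffordSystem

/-! ### The pin group covers the orthogonal group -/

section Covering

variable {m : ℕ}

theorem exists_pin_eq_mon (I : Finset (Fin (m + 1))) : ∃ u ∈ Pin m, (u : Cl m) = mon I := by
  induction I using Finset.induction_on with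
  | empty => exact ⟨1, (Pin m).one_mem, by simp⟩
  | insert j I hj ih =>
    obtain ⟨u, hu, hI⟩ := ih
    obtain ⟨s, hs, h⟩ := mon_insert hj
    have hv : stdForm m (s • Pi.single j 1) = 1 := by
      rw [QuadraticMap.map_smul, stdForm_single, hs, one_smul]
    refine ⟨unitVec _ hv * u, (Pin m).mul_mem (unitVec_mem _ hv) hu, ?_⟩
    rw [Units.val_mul, hI, h]
    change CliffordAlgebra.ι (stdForm m) _ * _ = _
    rw [map_smul, smul_mul_assoc]
    rfl

theorem vol_mul_ι (hm : Odd m) (w : Fin (m + 1) → ℝ) :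
    vol m * CliffordAlgebra.ι (stdForm m) w = -(CliffordAlgebra.ι (stdForm m) w * vol m) := by
  have h : ∀ i, vol m * e i = -(e i * vol m) := by
    intro i
    rw [vol, mon_comm, Finset.card_erase_of_mem (Finset.mem_univ i), Finset.card_univ,
      Fintype.card_fin, Nat.add_sub_cancel, hm.neg_one_pow, neg_one_smul, neg_neg]
  rw [ι_eq_sum, Finset.mul_sum, Finset.sum_mul, ← Finset.sum_neg_distrib]
  exact Finset.sum_congr rfl fun i _ => by rw [mul_smul_comm, smul_mul_assoc, h, smul_neg]

theorem stdForm_ofLp (v : EuclideanSpace ℝ (Fin (m + 1))) : stdForm m v.ofLp = ‖v‖ ^ 2 := by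
  rw [stdForm_apply, EuclideanSpace.real_norm_sq_eq]

theorem polar_stdForm (v w : Fin (m + 1) → ℝ) :
    QuadraticMap.polar (stdForm m) v w = 2 * ∑ i, v i * w i := by
  rw [QuadraticMap.polar, stdForm_apply, stdForm_apply, stdForm_apply, Finset.mul_sum,
    ← Finset.sum_sub_distrib, ← Finset.sum_sub_distrib]
  refine Finset.sum_congr rfl fun i _ => ?_
  rw [Pi.add_apply]
  ring

/-- Reflections generate the orthogonal group. A unit vector induces minus a reflection, and for odd
`m` the volume element anticommutes with all vectors and corrects the sign. -/
theorem exists_pin_conj (hm : Odd m)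
    (R : EuclideanSpace ℝ (Fin (m + 1)) ≃ₗᵢ[ℝ] EuclideanSpace ℝ (Fin (m + 1))) :
    ∃ u ∈ Pin m, ∀ w : EuclideanSpace ℝ (Fin (m + 1)),
      (u : Cl m) * CliffordAlgebra.ι (stdForm m) w.ofLp =
        CliffordAlgebra.ι (stdForm m) (R w).ofLp * u := by
  have hR := LinearIsometryEquiv.reflections_generate
    (F := EuclideanSpace ℝ (Fin (m + 1))).ge (Subgroup.mem_top R)
  induction hR using Subgroup.closure_induction with
  | mem R hR =>
    obtain ⟨v, rfl⟩ := hR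
    by_cases hv : v = 0
    · subst hv
      refine ⟨1, (Pin m).one_mem, fun w => ?_⟩
      rw [Submodule.reflection_orthogonal_apply, Submodule.reflection_singleton_apply]
      simp
    · have hv0 : ‖v‖ ≠ 0 := norm_ne_zero_iff.2 hv
      have hn : ‖(‖v‖⁻¹ : ℝ) • v‖ = 1 := norm_smul_inv_norm hv
      have hs : stdForm m ((‖v‖⁻¹ : ℝ) • v).ofLp = 1 := by rw [stdForm_ofLp, hn, one_pow]
      obtain ⟨u, hu, hvol⟩ := exists_pin_eq_mon (m := m) Finset.univ
      refine ⟨u * unitVec _ hs, (Pin m).mul_mem hu (unitVec_mem _ hs), fun w => ?_⟩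
      have h1 : (Submodule.reflection (ℝ ∙ v)ᗮ w).ofLp = -(QuadraticMap.polar (stdForm m)
          ((‖v‖⁻¹ : ℝ) • v).ofLp w.ofLp • ((‖v‖⁻¹ : ℝ) • v).ofLp - w.ofLp) := by
        rw [Submodule.reflection_orthogonal_apply, Submodule.reflection_singleton_apply,
          polar_stdForm]
        ext i
        simp only [PiLp.neg_apply, PiLp.sub_apply, PiLp.smul_apply, Pi.neg_apply, Pi.sub_apply,
          Pi.smul_apply, smul_eq_mul, PiLp.inner_apply, Real.inner_apply, mul_assoc,
          ← Finset.mul_sum, RCLike.ofReal_real_eq_id, id_eq, nsmul_eq_mul]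
        field_simp
        push_cast
        ring
      have h2 := ι_conj _ w.ofLp hs
      have h3 : CliffordAlgebra.ι (stdForm m) ((‖v‖⁻¹ : ℝ) • v).ofLp *
          CliffordAlgebra.ι (stdForm m) w.ofLp = CliffordAlgebra.ι (stdForm m)
            (QuadraticMap.polar (stdForm m) ((‖v‖⁻¹ : ℝ) • v).ofLp w.ofLp •
              ((‖v‖⁻¹ : ℝ) • v).ofLp - w.ofLp) *
            CliffordAlgebra.ι (stdForm m) ((‖v‖⁻¹ : ℝ) • v).ofLp := by
        rw [← h2, mul_assoc, ι_mul_ι_self hs, mul_one]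
      have h4 : ((unitVec _ hs : (Cl m)ˣ) : Cl m) =
        CliffordAlgebra.ι (stdForm m) ((‖v‖⁻¹ : ℝ) • v).ofLp := rfl
      rw [Units.val_mul, h4, mul_assoc, h3, h1, hvol, map_neg, ← mul_assoc, ← mul_assoc]
      congr 1
      rw [neg_mul]
      exact vol_mul_ι hm _
  | one => exact ⟨1, (Pin m).one_mem, fun w => by simp⟩
  | mul R R' _ _ h h' =>
    obtain ⟨u, hu, h⟩ := h
    obtain ⟨u', hu', h'⟩ := h'
    refine ⟨u * u', (Pin m).mul_mem hu hu', fun w => ?_⟩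
    rw [Units.val_mul, mul_assoc, h', ← mul_assoc, h, mul_assoc]
    rfl
  | inv R _ h =>
    obtain ⟨u, hu, h⟩ := h
    refine ⟨u⁻¹, (Pin m).inv_mem hu, fun w => ?_⟩
    have h1 := h (R⁻¹ w)
    have h2 : R (R⁻¹ w) = w := R.apply_symm_apply w
    rw [h2] at h1
    rw [Units.inv_mul_eq_iff_eq_mul, ← mul_assoc, h1, mul_assoc, Units.mul_inv, mul_one]

end Covering

namespace CliffordSystem

variable {m n : ℕ} (C : CliffordSystem m n)

/-- `A⁻¹ (gen v) A = gen (r v)` defines a linear map `r`, isometric because `(gen v)² = |v|²`. If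
the pin element `u` induces `r`, then `A χ(u)` commutes with `𝒫`. -/
theorem mem_image_sup_uPlus (hm : Odd m) {A : OV n}
    (hA : ∀ v, ∃ w, ∀ x, C.gen v (A x) = A (C.gen w x)) :
    A ∈ C.image (Pin m) ⊔ C.uPlus := by
  choose r hr using hA
  have hr' : ∀ v x, A.symm (C.gen v (A x)) = C.gen (r v) x := fun v x => by
    rw [hr, A.symm_apply_apply]
  have hadd : ∀ v w, r (v + w) = r v + r w := fun v w =>
    C.gen_injective (LinearMap.ext fun x => by
      rw [map_add, LinearMap.add_apply, ← hr', ← hr', ← hr', map_add, LinearMap.add_apply, map_add])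
  have hsmul : ∀ (c : ℝ) v, r (c • v) = c • r v := fun c v =>
    C.gen_injective (LinearMap.ext fun x => by
      rw [map_smul, LinearMap.smul_apply, ← hr', ← hr', map_smul, LinearMap.smul_apply, map_smul])
  let R : EuclideanSpace ℝ (Fin (m + 1)) →ₗᵢ[ℝ] EuclideanSpace ℝ (Fin (m + 1)) :=
    { toFun := fun v => WithLp.toLp 2 (r v.ofLp)
      map_add' := fun v w => congrArg (WithLp.toLp 2) (hadd _ _)
      map_smul' := fun c v => congrArg (WithLp.toLp 2) (hsmul _ _)
      norm_map' := fun v => by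
        obtain ⟨x, hx⟩ := exists_ne (0 : V n)
        have h1 : stdForm m (r v.ofLp) • x = stdForm m v.ofLp • x := by
          rw [← C.gen_sq, ← hr', ← hr', A.apply_symm_apply, C.gen_sq, map_smul, A.symm_apply_apply]
        have h2 := smul_left_injective ℝ hx h1
        have h3 := stdForm_ofLp (WithLp.toLp 2 (r v.ofLp))
        rw [h2, stdForm_ofLp] at h3
        exact ((sq_eq_sq₀ (norm_nonneg _) (norm_nonneg _)).1 h3).symm }
  obtain ⟨u, hu, h⟩ := exists_pin_conj hm (R.toLinearIsometryEquiv rfl)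
  have hU : A * C.pinHom ⟨u, hu⟩ ∈ C.uPlus := by
    rw [mem_uPlus]
    refine intertwines_of_gen fun i x => ?_
    have h1 := congrArg (fun a => C.rep a x) (h (WithLp.toLp 2 (Pi.single i 1)))
    simp only [map_mul, Module.End.mul_apply] at h1
    change A (C.rep (u : Cl m) (C.rep (e i) x)) = C.rep (e i) (A (C.rep (u : Cl m) x))
    rw [e, h1, rep_ι, rep_ι, hr]
    rfl
  have h1 : A = (A * C.pinHom ⟨u, hu⟩) * (C.pinHom ⟨u, hu⟩)⁻¹ := by rw [mul_inv_cancel_right]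
  rw [h1]
  refine mul_mem (Subgroup.mem_sup_right hU) (Subgroup.mem_sup_left (inv_mem ?_))
  exact ⟨u, hu, fun x => rfl⟩

theorem aut_eq (hm : Odd m) (hn : 2 * m ≤ n) : C.aut = C.image (Pin m) ⊔ C.uPlus := by
  refine le_antisymm (fun A hA => ?_) (C.image_sup_uPlus_le_aut le_rfl)
  have h1 : 1 ≤ m := hm.pos
  have hfocal : ∀ x : V n, ‖x‖ = 1 → stdForm m (C.quadMap x) = 1 →
      stdForm m ((C.conj A⁻¹).quadMap x) = 1 := by
    simp only [conj_quadMap]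
    rcases C.aut_focal h1 (by omega) (inv_mem hA) with h | h
    · exact h
    · exfalso
      -- For the conjugate system `q'(x) = q(A⁻¹ x)`, so the behaviour of `A⁻¹` on focal sets
      -- becomes a relation between two Clifford systems.
      refine not_exchange (C := C) (C' := C.conj A⁻¹) h1 hn (fun x hx => ?_) fun x hx => ?_
      · rw [conj_quadMap]
        exact (h x hx).1
      · rw [conj_quadMap]
        exact (h x hx).2
  have hunit : ∀ v, stdForm m v = 1 → ∃ w, ∀ x, C.gen v (A x) = A (C.gen w x) := by
    intro v hv
    obtain ⟨w, hw⟩ := exists_gen_eq h1 hn hfocal hv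
    refine ⟨w, fun x => ?_⟩
    rw [hw, conj_gen]
    change A (C.gen w (A.symm (A x))) = _
    rw [A.symm_apply_apply]
  refine C.mem_image_sup_uPlus hm fun v => ?_
  by_cases hv : v = 0
  · exact ⟨0, fun x => by simp [hv]⟩
  · have hpos : 0 < stdForm m v := (stdForm_nonneg v).lt_of_ne' fun h => hv (stdForm_eq_zero h)
    have hs := Real.sqrt_pos.2 hpos
    obtain ⟨w, hw⟩ := hunit ((√(stdForm m v))⁻¹ • v) (by
      rw [QuadraticMap.map_smul, ← mul_inv, Real.mul_self_sqrt hpos.le, smul_eq_mul,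
        inv_mul_cancel₀ hpos.ne'])
    refine ⟨√(stdForm m v) • w, fun x => ?_⟩
    rw [map_smul, LinearMap.smul_apply, map_smul, ← hw, map_smul, LinearMap.smul_apply, smul_smul,
      mul_inv_cancel₀ hs.ne', one_smul]

end CliffordSystem

end FKM

end

theorem mainTheorem8 (m n : ℕ) (C : CliffordSystem m n) (hpos : 0 < (n : ℤ) - m)
    (hle : (m : ℤ) ≤ (n : ℤ) - m) :
    (m % 8 = 1 ∨ m % 8 = 7 →
      (∃ (r : ℕ) (χ : Cl m →ₐ[ℝ] Matrix (Fin r) (Fin r) ℝ), IsIrreducibleRep χ) ∧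
      ∀ (r : ℕ) (χ : Cl m →ₐ[ℝ] Matrix (Fin r) (Fin r) ℝ), IsIrreducibleRep χ →
        ∃ k : ℕ, IsSumOf C χ k ∧
          IsEquivalentToAction C C.aut (Pin m) (Matrix.orthogonalGroup (Fin k) ℝ)
            ((Fin r → ℝ) ⊗[ℝ] (Fin k → ℝ)) (fun f U => tensorAct (χ f) U.1)) ∧
    (m % 8 = 3 ∨ m % 8 = 5 →
      (∃ (r : ℕ) (χ : Cl m →ₐ[ℝ] Matrix (Fin r) (Fin r) ℍ[ℝ]), IsIrreducibleRep χ) ∧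
      ∀ (r : ℕ) (χ : Cl m →ₐ[ℝ] Matrix (Fin r) (Fin r) ℍ[ℝ]), IsIrreducibleRep χ →
        ∃ k : ℕ, IsSumOf C χ k ∧
          IsEquivalentToAction C C.aut (Pin m) (Sp k)
            (QuatTensor r k) (fun f U => quatTensorAct (χ f) U.1)) ∧
    (m % 4 = 2 →
      C.spinUPlus ≤ C.aut ∧
      (∃ (r : ℕ) (χ : Cl m →ₐ[ℝ] Matrix (Fin r) (Fin r) ℂ), IsIrreducibleRep χ) ∧
      ∀ (r : ℕ) (χ : Cl m →ₐ[ℝ] Matrix (Fin r) (Fin r) ℂ), IsIrreducibleRep χ →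
        ∃ k : ℕ, IsSumOf C χ k ∧
          IsEquivalentToAction C C.spinUPlus (Spin m) (Matrix.unitaryGroup (Fin k) ℂ)
            ((Fin r → ℂ) ⊗[ℂ] (Fin k → ℂ)) (fun f U => tensorAct (χ f) U.1)) ∧
    (m % 8 = 0 →
      C.spinUPlus ≤ C.aut ∧
      (∃ (r : ℕ) (χ : Cl m →ₐ[ℝ] Matrix (Fin r) (Fin r) ℝ), IsIrreducibleRep χ) ∧
      ∀ (r : ℕ) (χ : Cl m →ₐ[ℝ] Matrix (Fin r) (Fin r) ℝ), IsIrreducibleRep χ →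
        ∃ kp kn : ℕ, IsSumOf₂ C χ (twist χ) kp kn ∧
          IsEquivalentToAction C C.spinUPlus (Spin m)
            (Matrix.orthogonalGroup (Fin kp) ℝ × Matrix.orthogonalGroup (Fin kn) ℝ)
            (((Fin r → ℝ) ⊗[ℝ] (Fin kp → ℝ)) × ((Fin r → ℝ) ⊗[ℝ] (Fin kn → ℝ)))
            (fun f U => (tensorAct (χ f) U.1.1).prodMap (tensorAct (twist χ f) U.2.1))) ∧
    (m % 8 = 4 →
      C.spinUPlus ≤ C.aut ∧
      (∃ (r : ℕ) (χ : Cl m →ₐ[ℝ] Matrix (Fin r) (Fin r) ℍ[ℝ]), IsIrreducibleRep χ) ∧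
      ∀ (r : ℕ) (χ : Cl m →ₐ[ℝ] Matrix (Fin r) (Fin r) ℍ[ℝ]), IsIrreducibleRep χ →
        ∃ kp kn : ℕ, IsSumOf₂ C χ (twist χ) kp kn ∧
          IsEquivalentToAction C C.spinUPlus (Spin m) (Sp kp × Sp kn)
            (QuatTensor r kp × QuatTensor r kn)
            (fun f U =>
              (quatTensorAct (χ f) U.1.1).prodMap (quatTensorAct (twist χ f) U.2.1))) := by
  have haut : Odd m → C.aut = C.image (Pin m) ⊔ C.uPlus := fun hm => C.aut_eq hm (by omega)
  have hsub : C.spinUPlus ≤ C.aut := C.image_sup_uPlus_le_aut (spin_le_pin m)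
  refine ⟨fun hm => ?_, fun hm => ?_, fun hm => ?_, fun hm => ?_, fun hm => ?_⟩
  · have hK := isCommutantField_real (m := m) (by omega)
    have ho : Odd m := Nat.odd_iff.2 (by omega)
    refine ⟨exists_irreducible C hK, fun r χ hχ => ?_⟩
    rw [haut ho]
    exact exists_isotypic_equivalence C (Or.inl ho) hK hχ le_rfl (isColumnModel_unitaryGroup r)
  · have hK := isCommutantField_quaternion (m := m) (by omega)
    have ho : Odd m := Nat.odd_iff.2 (by omega)
    refine ⟨exists_irreducible C hK, fun r χ hχ => ?_⟩
    rw [haut ho]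
    exact exists_isotypic_equivalence C (Or.inl ho) hK hχ le_rfl (isColumnModel_sp r)
  · have hK := isCommutantField_complex (m := m) hm
    exact ⟨hsub, exists_irreducible C hK, fun r χ hχ => exists_isotypic_equivalence C (Or.inr hm) hK
      hχ (spin_le_pin m) (isColumnModel_unitaryGroup r)⟩
  · have hK := isCommutantField_real (m := m) (by omega)
    exact ⟨hsub, exists_irreducible C hK, fun r χ hχ => exists_two_type_equivalence C (by omega) hK
      hχ (spin_le_pin m) (isColumnModel_unitaryGroup r)⟩
  · have hK := isCommutantField_quaternion (m := m) (by omega)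
    exact ⟨hsub, exists_irreducible C hK, fun r χ hχ => exists_two_type_equivalence C (by omega) hK
      hχ (spin_le_pin m) (isColumnModel_sp r)⟩
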